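/- Let $m,m_1,\vartheta_1>0$, $u_1\in\mathbb R^3$, $0<\epsilon<1$, and set $\alpha=\frac{m_1}{m+m_1}$, $\beta=\frac{1-\epsilon}{2}$, $\vartheta^{\#}=\frac{(1-\alpha)(1-\beta)}{1-\alpha(1-\beta)}\vartheta_1$, $$\mathcal M_1(v)=\Big(\frac{m_1}{2\pi\vartheta_1}\Big)^{3/2}e^{-m_1|v-u_1|^2/(2\vartheta_1)},\qquad \mathcal M(v)=\Big(\frac{m}{2\pi\vartheta^{\#}}\Big)^{3/2}e^{-m|v-u_1|^2/(2\vartheta^{\#})}\qquad(v\in\mathbb R^3).$$ For $v,w\in\mathbb R^3$ and $n\in\mathbb S^2$ put $q=v-w$, $v_\star=v-2\alpha\frac{1-\beta}{1-2\beta}(q\cdot n)n$ and $w_\star=w+2(1-\alpha)\frac{1-\beta}{1-2\beta}(q\cdot n)n$. Let $$Q(f)(v)=\int_{\mathbb R^3\times\mathbb S^2}|q\cdot n|\,\big[\epsilon^{-2}f(v_\star)\mathcal M_1(w_\star)-f(v)\mathcal M_1(w)\big]\,dw\,dn,\qquad \sigma(v)=\int_{\mathbb R^3\times\mathbb S^2}|q\cdot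 n|\,\mathcal M_1(w)\,dw\,dn,$$ where $dn$ is the surface measure on $\mathbb S^2$, and let $\nu_0=\inf_{v\in\mathbb R^3}\sigma(v)$. In the complex Hilbert space $\mathcal H=L^2(\mathbb R^3;\mathcal M^{-1}(v)\,dv)$ let $\mathcal L^-f=\sigma f$ with domain $\{f\in\mathcal H:\sigma f\in\mathcal H\}$, and let $\mathcal L$ be the realization of $Q$, that is $\mathcal Lf=Q(f)$ for all $f\in\mathcal H$ such that $\sigma f\in\mathcal H$, the integral defining $Q(f)(v)$ converges absolutely for almost every $v$, and $Q(f)\in\mathcal H$. The spectrum $\mathfrak S(T)$ of an operator $T$ with domain $\mathscr D(T)$ is the set of $z\in\mathbb C$ for which $z-T:\mathscr D(T)\to\mathcal H$ has no bounded inverse defined on all of $\mathcal H$; the algebraic multiplicity of an eigenvalue $z$ of $T$ is the dimension of $\bigcup_n\ker(T-z)^n$. **Theorem.** The domain of $\mathcal L$ is $\mathscr D(\mathcal L)=\{f\in\mathcal H:\sigma f\in\mathcal H\}$. One has $\nu_0>0$ and $\mathfrak S(-\mathcal L^-)=(-\infty,-\nu_0]$. Moreover $$\mathfrak S(\mathcal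 L)=(-\infty,-\nu_0]\cup\{\lambda_n:n\in I\},$$ where either $I=\mathbb N$ or $I=\{0,\dots,N\}$ for some $N\ge 0$, and $0=\lambda_0>\lambda_1>\lambda_2>\dots$ is a strictly decreasing (finite or infinite) sequence of real eigenvalues of $\mathcal L$ in $(-\nu_0,0]$, of finite algebraic multiplicity, whose only possible cluster point is $-\nu_0$. In particular $\mathcal L$ has a positive spectral gap: there is $\delta>0$ such that every $z\in\mathfrak S(\mathcal L)\setminus\{0\}$ satisfies $\operatorname{Re}z\le-\delta$. -/

import Mathlib

open MeasureTheory Filter Topology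

namespace Granular

noncomputable section

/-- The velocity space `ℝ³` with its Euclidean norm. -/
abbrev Vel : Type := EuclideanSpace ℝ (Fin 3)

/-- The unit sphere `S²` of `ℝ³`. -/
abbrev S2 : Type := Metric.sphere (0 : Vel) 1

/-- The surface measure `dn` on `S²` (total mass `4π`). -/
def surface : Measure S2 := (volume : Measure Vel).toSphere

instance : IsFiniteMeasure surface := by
  unfold surface; infer_instance

/-- Physical data: mass `m` of the dilute particles, mass `m₁`, temperature `ϑ₁` and bulk
velocity `u₁` of the host fluid, and constant restitution coefficient `ε ∈ (0,1)`. -/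
structure Params where
  m : ℝ
  m₁ : ℝ
  ϑ₁ : ℝ
  ε : ℝ
  u₁ : Vel
  m_pos : 0 < m
  m₁_pos : 0 < m₁
  ϑ₁_pos : 0 < ϑ₁
  ε_pos : 0 < ε
  ε_lt_one : ε < 1

variable (P : Params)

/-- The mass ratio `α`. -/
def Params.α : ℝ := P.m₁ / (P.m + P.m₁)

/-- The inelasticity parameter `β`. -/
def Params.β : ℝ := (1 - P.ε) / 2

/-- The temperature `ϑ#` of the equilibrium state. -/
def Params.ϑeq : ℝ := (1 - P.α) * (1 - P.β) / (1 - P.α * (1 - P.β)) * P.ϑ₁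

/-- The normalized Maxwellian of particle mass `m`, temperature `ϑ` and bulk velocity `u`. -/
def maxwellian (m ϑ : ℝ) (u v : Vel) : ℝ :=
  (m / (2 * Real.pi * ϑ)) ^ (3 / 2 : ℝ) * Real.exp (-(m * ‖v - u‖ ^ 2) / (2 * ϑ))

/-- The distribution function `M₁` of the host fluid. -/
def hostMaxwellian (v : Vel) : ℝ := maxwellian P.m₁ P.ϑ₁ P.u₁ v

/-- The equilibrium Maxwellian `M`. -/
def eqMaxwellian (v : Vel) : ℝ := maxwellian P.m P.ϑeq P.u₁ v

/-- Pre-collisional velocity `v⋆` of the dilute particle that leaves the collision with velocity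
`v`; `w` is the post-collisional velocity of the host particle. -/
def vStar (v w n : Vel) : Vel :=
  v - (2 * P.α * ((1 - P.β) / (1 - 2 * P.β)) * inner ℝ (v - w) n) • n

/-- Pre-collisional velocity `w⋆` of the host particle. -/
def wStar (v w n : Vel) : Vel :=
  w + (2 * (1 - P.α) * ((1 - P.β) / (1 - 2 * P.β)) * inner ℝ (v - w) n) • n

/-- The collision frequency `σ(v) = ∫_{ℝ³ × S²} |(v - w) · n| M₁(w) dw dn`. -/
def collisionFreq (v : Vel) : ℝ :=
  ∫ p : Vel × S2, |inner ℝ (v - p.1) (p.2 : Vel)| * hostMaxwellian P p.1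
    ∂((volume : Measure Vel).prod surface)

/-- The integrand, at `p = (w, n)`, of the collision integral of `f` at `v`. -/
def collisionIntegrand (f : Vel → ℂ) (v : Vel) (p : Vel × S2) : ℂ :=
  (|inner ℝ (v - p.1) (p.2 : Vel)| : ℝ) *
    ((1 / P.ε ^ 2 : ℝ) * f (vStar P v p.1 p.2) * (hostMaxwellian P (wStar P v p.1 p.2) : ℝ)
      - f v * (hostMaxwellian P p.1 : ℝ))

/-- The linear collision operator for dissipative hard spheres,
`Q(f)(v) = ∫_{ℝ³ × S²} |q · n| [ε⁻² f(v⋆) M₁(w⋆) - f(v) M₁(w)] dw dn`, `q = v - w`. -/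
def collisionOp (f : Vel → ℂ) (v : Vel) : ℂ :=
  ∫ p : Vel × S2, collisionIntegrand P f v p ∂((volume : Measure Vel).prod surface)

/-- The measure `M⁻¹(v) dv` on the velocity space. -/
def weight : Measure Vel :=
  (volume : Measure Vel).withDensity fun v => ENNReal.ofReal (eqMaxwellian P v)⁻¹

/-- The complex Hilbert space `H = L²(ℝ³; M⁻¹(v) dv)`. -/
abbrev H : Type := Lp ℂ 2 (weight P)

/-! Helper facts: `collisionOp` is well defined and linear on classes of functions modulo
equality almost everywhere. -/

lemma Params.ϑeq_pos : 0 < P.ϑeq := by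
  have h1 := P.m_pos
  have h2 := P.m₁_pos
  have h3 := P.ε_pos
  have h4 := P.ε_lt_one
  have a0 : 0 < P.α := by unfold Params.α; positivity
  have a1 : P.α < 1 := by
    unfold Params.α; rw [div_lt_one (by positivity)]; linarith
  have b0 : 0 < 1 - P.β := by unfold Params.β; linarith
  have b1 : 1 - P.β < 1 := by unfold Params.β; linarith
  have : P.α * (1 - P.β) < 1 := by nlinarith
  unfold Params.ϑeq
  have := P.ϑ₁_pos
  have : 0 < 1 - P.α := by linarith
  have : 0 < 1 - P.α * (1 - P.β) := by linarith
  positivity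

lemma eqMaxwellian_pos (v : Vel) : 0 < eqMaxwellian P v := by
  have := P.ϑeq_pos
  have := P.m_pos
  unfold eqMaxwellian maxwellian
  positivity

lemma weight_ac : weight P ≪ volume := withDensity_absolutelyContinuous _ _

lemma ac_weight : (volume : Measure Vel) ≪ weight P := by
  refine withDensity_absolutelyContinuous' ?_ ?_
  · apply Measurable.aemeasurable
    unfold eqMaxwellian maxwellian
    fun_prop
  · filter_upwards with v
    simp [eqMaxwellian_pos P v]

lemma ae_vStar_mem {s : Set Vel} (hs : MeasurableSet s) (h : ∀ᵐ x, x ∈ s) :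
    ∀ᵐ v : Vel, ∀ᵐ p : Vel × S2 ∂((volume : Measure Vel).prod surface),
      vStar P v p.1 p.2 ∈ s := by
  have meas : Measurable fun x : (Vel × Vel) × S2 => vStar P x.1.1 x.1.2 x.2 := by
    unfold vStar; fun_prop
  have key : ∀ n : S2, ∀ᵐ x : Vel × Vel ∂((volume : Measure Vel).prod volume), vStar P x.1 x.2 n ∈ s := by
    intro n
    set c := 2 * P.α * ((1 - P.β) / (1 - 2 * P.β)) with hc
    let L : Vel × Vel →ₗ[ℝ] Vel :=
      LinearMap.fst ℝ Vel Vel - ((c • (innerₛₗ ℝ (n : Vel))) ∘ₗ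
        (LinearMap.fst ℝ Vel Vel - LinearMap.snd ℝ Vel Vel)).smulRight (n : Vel)
    have hL : ∀ x, L x = vStar P x.1 x.2 n := by
      intro x
      simp [L, vStar, ← hc, real_inner_comm]
    have hsurj : Function.Surjective L := fun y => ⟨(y, y), by simp [L]⟩
    have := (ae_comp_linearMap_mem_iff L ((volume : Measure Vel).prod volume) (volume : Measure Vel)
      hsurj hs).2 h
    simpa [hL] using this
  have h2 : ∀ᵐ x : Vel × Vel ∂((volume : Measure Vel).prod volume), ∀ᵐ n : S2 ∂surface,
      vStar P x.1 x.2 n ∈ s := by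
    have := Measure.ae_ae_comm (μ := surface) (ν := (volume : Measure Vel).prod volume)
      (p := fun (n : S2) x => vStar P x.1 x.2 n ∈ s)
      (meas.comp measurable_swap hs)
    exact this.1 (Eventually.of_forall key)
  have h3 := Measure.ae_ae_of_ae_prod (μ := (volume : Measure Vel)) (ν := (volume : Measure Vel)) h2
  filter_upwards [h3] with v hv
  have mv : MeasurableSet {p : Vel × S2 | vStar P v p.1 p.2 ∈ s} := by
    have : Measurable fun p : Vel × S2 => vStar P v p.1 p.2 := by unfold vStar; fun_prop
    exact this hs
  exact (Measure.ae_prod_mem_iff_ae_ae_mem mv).2 hv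

lemma collisionIntegrand_congr {f g : Vel → ℂ} (h : f =ᵐ[weight P] g) :
    ∀ᵐ v ∂(weight P), collisionIntegrand P f v =ᵐ[(volume : Measure Vel).prod surface]
      collisionIntegrand P g v := by
  have h' : f =ᵐ[volume] g := (ac_weight P).ae_le h
  obtain ⟨t, hsub, ht, ht0⟩ := exists_measurable_superset_of_null (ae_iff.1 h')
  have hmem : ∀ᵐ x : Vel, x ∈ tᶜ := compl_mem_ae_iff.2 ht0
  have hfg : ∀ x ∈ tᶜ, f x = g x := fun x hx => by
    by_contra hne
    exact hx (hsub hne)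
  filter_upwards [(weight_ac P).ae_le (ae_vStar_mem P ht.compl hmem), h] with v hv hfv
  filter_upwards [hv] with p hp
  simp only [collisionIntegrand, hfg _ hp, hfv]

lemma collisionOp_congr {f g : Vel → ℂ} (h : f =ᵐ[weight P] g) :
    collisionOp P f =ᵐ[weight P] collisionOp P g := by
  filter_upwards [collisionIntegrand_congr P h] with v hv
  exact integral_congr_ae hv

/-- The collision integral of `f` at `v` converges absolutely for almost every `v`. -/
def CollisionIntegrable (f : Vel → ℂ) : Prop :=
  ∀ᵐ v ∂(weight P),
    Integrable (collisionIntegrand P f v) ((volume : Measure Vel).prod surface)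

lemma CollisionIntegrable.congr {f g : Vel → ℂ} (hf : CollisionIntegrable P f)
    (h : f =ᵐ[weight P] g) : CollisionIntegrable P g := by
  filter_upwards [hf, collisionIntegrand_congr P h] with v hv hc
  exact hv.congr hc

lemma collisionIntegrand_add (f g : Vel → ℂ) (v : Vel) :
    collisionIntegrand P (f + g) v = collisionIntegrand P f v + collisionIntegrand P g v := by
  funext p
  simp only [collisionIntegrand, Pi.add_apply]
  ring

lemma collisionIntegrand_smul (c : ℂ) (f : Vel → ℂ) (v : Vel) :
    collisionIntegrand P (c • f) v = c • collisionIntegrand P f v := by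
  funext p
  simp only [collisionIntegrand, Pi.smul_apply, smul_eq_mul]
  ring

lemma CollisionIntegrable.add {f g : Vel → ℂ} (hf : CollisionIntegrable P f)
    (hg : CollisionIntegrable P g) : CollisionIntegrable P (f + g) := by
  filter_upwards [hf, hg] with v h1 h2
  rw [collisionIntegrand_add]
  exact h1.add h2

lemma CollisionIntegrable.smul (c : ℂ) {f : Vel → ℂ} (hf : CollisionIntegrable P f) :
    CollisionIntegrable P (c • f) := by
  filter_upwards [hf] with v h1
  rw [collisionIntegrand_smul]
  exact h1.smul c

lemma collisionOp_add {f g : Vel → ℂ} (hf : CollisionIntegrable P f)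
    (hg : CollisionIntegrable P g) :
    collisionOp P (f + g) =ᵐ[weight P] collisionOp P f + collisionOp P g := by
  filter_upwards [hf, hg] with v h1 h2
  simp only [collisionOp, Pi.add_apply, collisionIntegrand_add]
  exact integral_add h1 h2

lemma collisionOp_smul (c : ℂ) (f : Vel → ℂ) :
    collisionOp P (c • f) = c • collisionOp P f := by
  funext v
  simp only [collisionOp, Pi.smul_apply, collisionIntegrand_smul]
  exact integral_smul c _

/-! The operators on `H`. -/

/-- Multiplication by the collision frequency, `σ f`. -/
def lossFun (f : Vel → ℂ) (v : Vel) : ℂ := (collisionFreq P v : ℂ) * f v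

lemma lossFun_congr {f g : Vel → ℂ} (h : f =ᵐ[weight P] g) :
    lossFun P f =ᵐ[weight P] lossFun P g := by
  filter_upwards [h] with v hv
  simp only [lossFun, hv]

lemma lossFun_add (f g : Vel → ℂ) : lossFun P (f + g) = lossFun P f + lossFun P g := by
  funext v
  simp only [lossFun, Pi.add_apply, mul_add]

lemma lossFun_smul (c : ℂ) (f : Vel → ℂ) : lossFun P (c • f) = c • lossFun P f := by
  funext v
  simp only [lossFun, Pi.smul_apply, smul_eq_mul]
  ring

lemma lossFun_coe_add (f g : H P) :
    lossFun P (f + g : H P) =ᵐ[weight P] lossFun P f + lossFun P g :=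
  (lossFun_congr P (Lp.coeFn_add f g)).trans (Eq.eventuallyEq (lossFun_add P f g))

lemma lossFun_coe_smul (c : ℂ) (f : H P) :
    lossFun P (c • f : H P) =ᵐ[weight P] c • lossFun P f :=
  (lossFun_congr P (Lp.coeFn_smul c f)).trans (Eq.eventuallyEq (lossFun_smul P c f))

/-- The functions `f ∈ H` with `σ f ∈ H`, that is `∫ |f|² σ² M⁻¹ dv < ∞`. -/
def lossDomain : Submodule ℂ (H P) where
  carrier := {f | MemLp (lossFun P f) 2 (weight P)}
  zero_mem' := by
    have h0 : (0 : Vel → ℂ) =ᵐ[weight P] (0 : H P) := (Lp.coeFn_zero ℂ 2 (weight P)).symm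
    refine (MemLp.zero (ε := ℂ)).ae_eq (EventuallyEq.trans ?_ (lossFun_congr P h0))
    filter_upwards with v
    simp [lossFun]
  add_mem' {f g} hf hg := (MemLp.add hf hg).ae_eq (lossFun_coe_add P f g).symm
  smul_mem' c f hf := (MemLp.const_smul hf c).ae_eq (lossFun_coe_smul P c f).symm

lemma mem_lossDomain {f : H P} (hf : f ∈ lossDomain P) : MemLp (lossFun P f) 2 (weight P) := hf

/-- The loss operator `L⁻ f = σ f` in `H`. -/
def lossOperator : H P →ₗ.[ℂ] H P where
  domain := lossDomain P
  toFun :=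
    { toFun := fun f => MemLp.toLp (lossFun P f.1) (mem_lossDomain P f.2)
      map_add' := fun f g => by
        rw [← MemLp.toLp_add]
        exact MemLp.toLp_congr _ _ (lossFun_coe_add P f.1 g.1)
      map_smul' := fun c f => by
        rw [RingHom.id_apply, ← MemLp.toLp_const_smul]
        exact MemLp.toLp_congr _ _ (lossFun_coe_smul P c f.1) }

/-- The functions `f ∈ H` with `σ f ∈ H` for which the collision integral converges absolutely
almost everywhere and `Q(f) ∈ H`. -/
def collisionDomain : Submodule ℂ (H P) where
  carrier := {f | f ∈ lossDomain P ∧ CollisionIntegrable P f ∧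
    MemLp (collisionOp P f) 2 (weight P)}
  zero_mem' := by
    have h0 : (0 : Vel → ℂ) =ᵐ[weight P] (0 : H P) := (Lp.coeFn_zero ℂ 2 (weight P)).symm
    have hz : ∀ v, collisionIntegrand P 0 v = 0 := fun v => by
      funext p; simp [collisionIntegrand]
    have hi : CollisionIntegrable P (0 : Vel → ℂ) := by
      filter_upwards with v
      rw [hz]
      exact integrable_zero _ _ _
    refine ⟨zero_mem _, hi.congr P h0, ?_⟩
    refine (MemLp.zero (ε := ℂ)).ae_eq (EventuallyEq.trans ?_ (collisionOp_congr P h0))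
    filter_upwards with v
    simp [collisionOp, hz]
  add_mem' {f g} hf hg :=
    ⟨add_mem hf.1 hg.1,
      (hf.2.1.add P hg.2.1).congr P (Lp.coeFn_add f g).symm,
      (hf.2.2.add hg.2.2).ae_eq
        ((collisionOp_add P hf.2.1 hg.2.1).symm.trans
          (collisionOp_congr P (Lp.coeFn_add f g).symm))⟩
  smul_mem' c f hf :=
    ⟨Submodule.smul_mem _ c hf.1,
      (hf.2.1.smul P c).congr P (Lp.coeFn_smul c f).symm,
      (hf.2.2.const_smul c).ae_eq
        ((Eq.eventuallyEq (collisionOp_smul P c f)).symm.trans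
          (collisionOp_congr P (Lp.coeFn_smul c f).symm))⟩

lemma mem_collisionDomain {f : H P} (hf : f ∈ collisionDomain P) :
    MemLp (collisionOp P f) 2 (weight P) := hf.2.2

/-- The realization `L` of the collision operator `Q` in `H`. -/
def collisionOperator : H P →ₗ.[ℂ] H P where
  domain := collisionDomain P
  toFun :=
    { toFun := fun f => MemLp.toLp (collisionOp P f.1) (mem_collisionDomain P f.2)
      map_add' := fun f g => by
        rw [← MemLp.toLp_add]
        exact MemLp.toLp_congr _ _ ((collisionOp_congr P (Lp.coeFn_add f.1 g.1)).trans
          (collisionOp_add P f.2.2.1 g.2.2.1))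
      map_smul' := fun c f => by
        rw [RingHom.id_apply, ← MemLp.toLp_const_smul]
        exact MemLp.toLp_congr _ _ ((collisionOp_congr P (Lp.coeFn_smul c f.1)).trans
          (Eq.eventuallyEq (collisionOp_smul P c f.1))) }

/-- `ν₀ = inf σ`. -/
def nuZero : ℝ := ⨅ v : Vel, collisionFreq P v

end

/-! Spectral notions for an unbounded operator `T` in a complex normed space. -/

section Spectral

variable {E : Type*} [NormedAddCommGroup E] [NormedSpace ℂ E] (T : E →ₗ.[ℂ] E)

/-- The spectrum of `T`: the complex numbers `z` for which `z - T`, as a map from the domain of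
`T` to `E`, has no bounded everywhere defined inverse `R`. -/
def opSpectrum : Set ℂ :=
  {z | ¬ ∃ R : E →L[ℂ] E,
    (∀ h : E, ∃ hR : R h ∈ T.domain, z • R h - T ⟨R h, hR⟩ = h) ∧
    ∀ f : T.domain, R (z • (f : E) - T f) = f}

/-- `z` is an eigenvalue of `T`. -/
def IsEigenvalue (z : ℂ) : Prop :=
  ∃ f : T.domain, f ≠ 0 ∧ T f = z • (f : E)

/-- The null space of `(T - z)ⁿ` on its natural domain. -/
def powKer (z : ℂ) : ℕ → Submodule ℂ E
  | 0 => ⊥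
  | n + 1 => ((powKer z n).comap (T.toFun - z • T.domain.subtype)).map T.domain.subtype

/-- The algebraic eigenspace of `T` at `z`: all `f` with `(T - z)ⁿ f = 0` for some `n`. Its
dimension is the algebraic multiplicity of `z`. -/
def algEigenspace (z : ℂ) : Submodule ℂ E := ⨆ n, powKer T z n

end Spectral

end Granular

/-!
The operator `L` is a compact perturbation of the multiplication operator `-L⁻ = -σ`, and it is
symmetric and nonpositive. This determines its spectrum.

*The gain term.* Integrating out the components of `w` orthogonal to `n` and using polar
coordinates over full lines, the gain term becomes an integral operator with an explicit kernel
(`lintegral_gainDensity`). With respect to the measure `M⁻¹ dv` the kernel is, up to a constant,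
`|y|⁻¹ exp(-c ((x · y / |y| - |y| / 2)² + κ² |y|²)) √M(v) √M(v')` where `x = v - u₁` and
`y = v - v'` (`symKernel_eq`). The choice of the temperature `ϑ#` enters through the identity `μ = 2 c κ`
(`Params.μ_eq`), which makes the kernel symmetric (`symKernel_symm`, detailed balance); `α < 1` and
`ε < 1` give `κ > 0`, hence decay in `y`.

*Compactness.* The Schur test with weight `√M` bounds the gain operator `K`. Its Schur integrals
tend to zero as `|v| → ∞`, because the Gaussian concentrates near the plane orthogonal to `v - u₁`
(`tendsto_lintegral_profile`), and on bounded sets of `v` the kernel is square integrable, since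
`|y|⁻²` is locally integrable in `ℝ³`. So `K` is a norm limit of Hilbert–Schmidt operators
(`SchurBound.isCompactOperator`). In particular the gain term of any `f ∈ H` converges almost
everywhere and lies in `H`, so that the domains of `L` and `L⁻` agree.

*Nonpositivity.* The Maxwellian `M` satisfies `K M = σ M` (`lintegral_gainKernel_eqMaxwellian`).
The Schur test for the quadratic form, now with weight `M`, gives `|⟨f, K f⟩| ≤ ∫ σ |f|² M⁻¹ dv`,
that is `⟨L f, f⟩ ≤ 0` (`norm_inner_gain_le`). The same identity says that `M` is an eigenfunction
of `L` at `0`.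

*The spectrum.* The collision frequency `σ` is Lipschitz, is minimal and positive at `u₁`, and is
unbounded, so its range is `[ν₀, ∞)`. Indicators of small shells form Weyl sequences of `-L⁻` at
every point of `(-∞, -ν₀]`, and compact operators map orthonormal sequences to null sequences, so
these points remain in the spectrum of `L`. Elsewhere the Fredholm alternative leaves only
eigenvalues of finite multiplicity. By symmetry and nonpositivity they lie in `(-ν₀, 0]` and have
no Jordan chains, and since `x + L⁻` is bounded below by `x + ν₀ > 0` for `x > -ν₀` they cannot
accumulate there (`IsPerturbation.spectrum_structure`).
-/

namespace Granular

/-! ### Compact operators on a Hilbert space -/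

section CompactOperators

open scoped ComplexInnerProductSpace

universe u

variable {E : Type u} [NormedAddCommGroup E] [InnerProductSpace ℂ E]

theorem tendsto_inner_orthonormal {e : ℕ → E} (he : Orthonormal ℂ e) (x : E) :
    Tendsto (fun n => ⟪e n, x⟫) atTop (𝓝 0) := by
  have h := (he.inner_products_summable (x := x)).tendsto_atTop_zero
  rw [tendsto_zero_iff_norm_tendsto_zero]
  have := h.sqrt
  simpa using this

/-- A compact operator maps orthonormal sequences, which converge weakly to zero, to sequences that
converge to zero in norm. -/
theorem tendsto_zero_of_isCompactOperator [CompleteSpace E] {K : E →L[ℂ] E}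
    (hK : IsCompactOperator K) {e : ℕ → E} (he : Orthonormal ℂ e) :
    Tendsto (fun n => K (e n)) atTop (𝓝 0) := by
  refine tendsto_of_subseq_tendsto fun ns hns => ?_
  obtain ⟨C, hC, hC'⟩ := hK.image_closedBall_subset_compact 1
  obtain ⟨y, -, φ, hφ, hy⟩ := hC.tendsto_subseq (x := fun n => K (e (ns n)))
    fun n => hC' ⟨e (ns n), by simp [he.1], rfl⟩
  refine ⟨φ, ?_⟩
  have h1 : Tendsto (fun n => ⟪K (e (ns (φ n))), y⟫) atTop (𝓝 0) := by
    have := (tendsto_inner_orthonormal he (K.adjoint y)).comp (hns.comp hφ.tendsto_atTop)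
    refine this.congr fun n => ?_
    simp [ContinuousLinearMap.adjoint_inner_right]
  have h2 : Tendsto (fun n => ⟪K (e (ns (φ n))), y⟫) atTop (𝓝 ⟪y, y⟫) :=
    hy.inner tendsto_const_nhds
  have h3 := tendsto_nhds_unique h1 h2
  rw [eq_comm, inner_self_eq_zero] at h3
  rw [h3] at hy
  exact hy

/-- A Hilbert–Schmidt operator is compact: it is the norm limit of its restrictions to the span of
finitely many basis vectors. -/
theorem isCompactOperator_of_sum_sq_le [CompleteSpace E] (T : E →L[ℂ] E) (C : ℝ)
    (h : ∀ (ι : Type u) (s : Finset ι) (e : ι → E), Orthonormal ℂ e → ∑ i ∈ s, ‖T (e i)‖ ^ 2 ≤ C) :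
    IsCompactOperator T := by
  -- The index type `ι` ranges over `Type u`, which contains the index of a Hilbert basis.
  obtain ⟨w, b, -⟩ := exists_hilbertBasis ℂ E
  have hsum : Summable fun i => ‖T (b i)‖ ^ 2 :=
    summable_of_sum_le (fun i => by positivity) fun s => h _ s b b.orthonormal
  let F : Finset w → E →L[ℂ] E := fun s =>
    ∑ i ∈ s, (innerSL ℂ (b i)).smulRight (T (b i))
  refine isCompactOperator_of_tendsto (l := atTop) (F := F) ?_ (Eventually.of_forall fun s => ?_)
  · rw [tendsto_iff_norm_sub_tendsto_zero]
    have htail : Tendsto (fun s : Finset w => √(∑' i : {i // i ∉ s}, ‖T (b i)‖ ^ 2)) atTop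
        (𝓝 0) := by
      simpa using (tendsto_tsum_compl_atTop_zero fun i => ‖T (b i)‖ ^ 2).sqrt
    refine squeeze_zero (fun _ => norm_nonneg _) (fun s => ?_) htail
    refine ContinuousLinearMap.opNorm_le_bound _ (by positivity) fun x => ?_
    have hx : HasSum (fun i => b.repr x i • T (b i)) (T x) := by
      simpa using (b.hasSum_repr x).mapL T
    have hx2 : HasSum (fun i : {i // i ∉ s} => b.repr x i • T (b i)) (T x - F s x) := by
      have := (Finset.hasSum_compl_iff s (f := fun i => b.repr x i • T (b i))
        (a := T x - F s x)).2
      refine this ?_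
      convert hx using 1
      simp [F, b.repr_apply_apply]
    have hl2 : Summable fun i : {i // i ∉ s} => ‖b.repr x i‖ ^ 2 := by
      have := b.orthonormal.inner_products_summable (x := x)
      simp only [← b.repr_apply_apply] at this
      exact this.subtype _
    have hT2 : Summable fun i : {i // i ∉ s} => ‖T (b i)‖ ^ 2 := hsum.subtype _
    have hb : ∑' i : {i // i ∉ s}, ‖b.repr x i‖ ^ 2 ≤ ‖x‖ ^ 2 := by
      have := (b.orthonormal.comp (fun i : {i // i ∉ s} => (i : w))
        Subtype.val_injective).tsum_inner_products_le (x := x)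
      simpa [← b.repr_apply_apply] using this
    have hmul : Summable (fun i : {i // i ∉ s} => ‖b.repr x i‖ * ‖T (b i)‖) ∧
        ∑' i : {i // i ∉ s}, ‖b.repr x i‖ * ‖T (b i)‖ ≤
          √(∑' i : {i // i ∉ s}, ‖b.repr x i‖ ^ 2) * √(∑' i : {i // i ∉ s}, ‖T (b i)‖ ^ 2) := by
      have := Real.summable_and_inner_le_Lp_mul_Lq_tsum_of_nonneg (p := 2) (q := 2)
        (f := fun i : {i // i ∉ s} => ‖b.repr x i‖) (g := fun i => ‖T (b i)‖)
        (by norm_num [Real.holderConjugate_iff]) (fun i => norm_nonneg _) (fun i => norm_nonneg _)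
        (by simpa using hl2) (by simpa using hT2)
      simpa [Real.sqrt_eq_rpow] using this
    change ‖F s x - T x‖ ≤ _
    rw [← norm_sub_rev, ← hx2.tsum_eq]
    have hn : Summable fun i : {i // i ∉ s} => ‖b.repr x i • T (b i)‖ := by
      simpa [norm_smul] using hmul.1
    calc _ ≤ ∑' i : {i // i ∉ s}, ‖b.repr x i • T (b i)‖ := norm_tsum_le_tsum_norm hn
      _ = ∑' i : {i // i ∉ s}, ‖b.repr x i‖ * ‖T (b i)‖ := by simp [norm_smul]
      _ ≤ _ := hmul.2
      _ ≤ _ := by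
        rw [mul_comm]
        gcongr
        exact Real.sqrt_le_iff.2 ⟨norm_nonneg _, hb⟩
  · have : F s ∈ compactOperator (RingHom.id ℂ) E E := by
      refine Submodule.sum_mem _ fun i _ => ?_
      have h1 : IsCompactOperator (innerSL ℂ (b i)) :=
        isCompactOperator_of_locallyCompactSpace_dom _
      exact h1.clm_comp (ContinuousLinearMap.toSpanSingleton ℂ (T (b i)))
    exact this

end CompactOperators

/-! ### Compact perturbations of an unbounded operator -/

section Perturbation

open scoped ComplexInnerProductSpace

variable {E : Type*} [NormedAddCommGroup E] [InnerProductSpace ℂ E] {T₀ T : E →ₗ.[ℂ] E}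

theorem IsEigenvalue.mem_opSpectrum {z : ℂ} (hz : IsEigenvalue T z) : z ∈ opSpectrum T := by
  rintro ⟨R, -, hR⟩
  obtain ⟨f, hf, hfz⟩ := hz
  have := hR f
  rw [hfz, sub_self, map_zero] at this
  exact hf (Subtype.ext this.symm)

/-- `T` is the perturbation `T₀ + K` of `T₀` by the bounded operator `K`, with the same domain. -/
structure IsPerturbation (T T₀ : E →ₗ.[ℂ] E) (K : E →L[ℂ] E) : Prop where
  domain_eq : T.domain = T₀.domain
  apply_eq : ∀ f (h : f ∈ T.domain) (h₀ : f ∈ T₀.domain), T ⟨f, h⟩ = T₀ ⟨f, h₀⟩ + K f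

variable {K : E →L[ℂ] E}

/-- Outside the spectrum of `T₀`, with `R = (z - T₀)⁻¹`, one has `z - T = (1 - K R) (z - T₀)`, and
the Fredholm alternative for the compact operator `K R` applies. -/
theorem IsPerturbation.isEigenvalue_or_notMem_opSpectrum [CompleteSpace E]
    (hT : IsPerturbation T T₀ K) (hK : IsCompactOperator K) {z : ℂ} (hz : z ∉ opSpectrum T₀) :
    IsEigenvalue T z ∨ z ∉ opSpectrum T := by
  simp only [opSpectrum, Set.mem_ofPred_eq, not_not] at hz
  obtain ⟨R, hR1, hR2⟩ := hz
  rcases (hK.comp_clm R).hasEigenvalue_or_mem_resolventSet (T := K ∘L R) (μ := 1) one_ne_zero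
    with h | h
  · left
    obtain ⟨g, hg⟩ := h.exists_hasEigenvector
    have hg1 : K (R g) = g := by simpa using hg.apply_eq_smul
    obtain ⟨h0, h1⟩ := hR1 g
    refine ⟨⟨R g, hT.domain_eq ▸ h0⟩, fun h2 => hg.2 ?_, ?_⟩
    · rw [← hg1, show R g = 0 from congrArg Subtype.val h2, map_zero]
    · rw [hT.apply_eq _ _ h0, hg1]
      nth_rw 2 [← h1]
      simp
  · right
    simp only [opSpectrum, Set.mem_ofPred_eq, not_not]
    rw [spectrum.mem_resolventSet_iff] at h
    obtain ⟨u, hu⟩ := h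
    have hu1 : ∀ x, (u : E →L[ℂ] E) x = x - K (R x) := fun x => by simp [hu]
    have hu2 : ∀ x, (u : E →L[ℂ] E) ((u⁻¹ : (E →L[ℂ] E)ˣ).1 x) = x := fun x => by
      rw [← mul_apply_eq_comp, Units.mul_inv, one_apply_eq_self]
    have hu3 : ∀ x, (u⁻¹ : (E →L[ℂ] E)ˣ).1 ((u : E →L[ℂ] E) x) = x := fun x => by
      rw [← mul_apply_eq_comp, Units.inv_mul, one_apply_eq_self]
    refine ⟨R ∘L (u⁻¹ : (E →L[ℂ] E)ˣ).1, fun h => ?_, fun f => ?_⟩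
    · obtain ⟨h0, h1⟩ := hR1 ((u⁻¹ : (E →L[ℂ] E)ˣ).1 h)
      refine ⟨hT.domain_eq ▸ h0, ?_⟩
      simp only [ContinuousLinearMap.comp_apply]
      rw [hT.apply_eq _ _ h0, ← sub_sub, h1, ← hu1, hu2]
    · obtain ⟨f, hf⟩ := f
      have hf0 : f ∈ T₀.domain := hT.domain_eq ▸ hf
      have h1 := hR2 ⟨f, hf0⟩
      simp only [ContinuousLinearMap.comp_apply] at h1 ⊢
      rw [hT.apply_eq _ _ hf0, ← sub_sub]
      nth_rw 3 [← h1]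
      rw [← hu1, hu3, h1]

/-- `T` has a *Weyl sequence* at `z`: an orthonormal sequence of approximate eigenvectors. -/
def HasWeylSequence (T : E →ₗ.[ℂ] E) (z : ℂ) : Prop :=
  ∃ e : ℕ → T.domain, Orthonormal ℂ (fun n => (e n : E)) ∧
    Tendsto (fun n => z • (e n : E) - T (e n)) atTop (𝓝 0)

theorem HasWeylSequence.mem_opSpectrum {z : ℂ} (h : HasWeylSequence T z) : z ∈ opSpectrum T := by
  rintro ⟨R, -, hR⟩
  obtain ⟨e, he, hlim⟩ := h
  have h1 := (R.continuous.tendsto 0).comp hlim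
  rw [map_zero] at h1
  have h2 : Tendsto (fun n => ‖(e n : E)‖) atTop (𝓝 ‖(0 : E)‖) :=
    (h1.congr fun n => hR (e n)).norm
  simp only [he.1, norm_zero] at h2
  exact one_ne_zero (tendsto_nhds_unique tendsto_const_nhds h2)

/-- Weyl sequences survive compact perturbations, and with them the essential spectrum. -/
theorem HasWeylSequence.perturb [CompleteSpace E] {z : ℂ} (h : HasWeylSequence T₀ z)
    (hT : IsPerturbation T T₀ K) (hK : IsCompactOperator K) : HasWeylSequence T z := by
  obtain ⟨e, he, hlim⟩ := h
  refine ⟨fun n => ⟨(e n).1, hT.domain_eq.symm ▸ (e n).2⟩, he, ?_⟩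
  have := hlim.sub (tendsto_zero_of_isCompactOperator hK he)
  rw [sub_zero] at this
  refine this.congr fun n => ?_
  rw [hT.apply_eq _ _ (e n).2]
  abel

/-- `T` is symmetric: `⟨T f, g⟩ = ⟨f, T g⟩` on the domain of `T`. Self-adjointness, and density of
the domain, are not required. -/
def IsSymmetricOp (T : E →ₗ.[ℂ] E) : Prop :=
  ∀ f g : T.domain, ⟪T f, (g : E)⟫ = ⟪(f : E), T g⟫

theorem IsSymmetricOp.eigenvalue_re (hT : IsSymmetricOp T) {z : ℂ} (hz : IsEigenvalue T z) :
    (z.re : ℂ) = z := by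
  obtain ⟨f, hf, hfz⟩ := hz
  have h := hT f f
  rw [hfz, inner_smul_left, inner_smul_right] at h
  have h0 : ⟪(f : E), (f : E)⟫ ≠ 0 := by
    rw [Ne, inner_self_eq_zero]
    exact fun h => hf (Subtype.ext h)
  exact Complex.conj_eq_iff_re.1 (mul_right_cancel₀ h0 h)

theorem mem_powKer_one {z : ℂ} {f : E} :
    f ∈ powKer T z 1 ↔ ∃ hf : f ∈ T.domain, T ⟨f, hf⟩ = z • f := by
  simp [powKer, sub_eq_zero]

theorem mem_powKer_succ {z : ℂ} {f : E} {n : ℕ} :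
    f ∈ powKer T z (n + 1) ↔ ∃ hf : f ∈ T.domain, T ⟨f, hf⟩ - z • f ∈ powKer T z n := by
  simp [powKer]

/-- A symmetric operator has no Jordan chains at a real point. -/
theorem IsSymmetricOp.algEigenspace_eq (hT : IsSymmetricOp T) (x : ℝ) :
    algEigenspace T x = powKer T x 1 := by
  have key : ∀ n, powKer T x (n + 1) ≤ powKer T x 1 := by
    intro n
    induction n with
    | zero => exact le_rfl
    | succ n ih =>
      intro f hf
      obtain ⟨hf, hg⟩ := mem_powKer_succ.1 hf
      obtain ⟨hgD, hgx⟩ := mem_powKer_one.1 (ih hg)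
      refine mem_powKer_one.2 ⟨hf, ?_⟩
      rw [← sub_eq_zero, ← inner_self_eq_zero (𝕜 := ℂ)]
      have h1 := hT ⟨f, hf⟩ ⟨_, hgD⟩
      rw [hgx, inner_smul_right] at h1
      simp only at h1
      nth_rw 1 [inner_sub_left]
      rw [h1, inner_smul_left, Complex.conj_ofReal, sub_self]
  refine le_antisymm (iSup_le fun n => ?_) (le_iSup (powKer T (x : ℂ)) 1)
  cases n with
  | zero => exact bot_le
  | succ n => exact key n

/-- Off the spectrum of `T₀`, every eigenvector of `T` at `z` is a fixed vector of the compact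
operator `(z - T₀)⁻¹ K`. -/
theorem IsPerturbation.finiteDimensional_powKer_one [CompleteSpace E]
    (hT : IsPerturbation T T₀ K) (hK : IsCompactOperator K) {z : ℂ} (hz : z ∉ opSpectrum T₀) :
    FiniteDimensional ℂ (powKer T z 1) := by
  simp only [opSpectrum, Set.mem_ofPred_eq, not_not] at hz
  obtain ⟨R, -, hR2⟩ := hz
  have hfin := ContinuousLinearMap.finite_dimensional_eigenspace (T := R ∘L K)
    (hK.clm_comp R) 1 one_ne_zero
  refine Submodule.finiteDimensional_of_le
    (S₂ := Module.End.eigenspace (R ∘L K).toLinearMap 1) fun f hf => ?_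
  obtain ⟨hf, hfz⟩ := mem_powKer_one.1 hf
  have hf0 : f ∈ T₀.domain := hT.domain_eq ▸ hf
  rw [hT.apply_eq _ _ hf0] at hfz
  rw [Module.End.mem_eigenspace_iff, one_smul]
  have := hR2 ⟨f, hf0⟩
  rw [← hfz, add_sub_cancel_left] at this
  exact this

/-- If `x - T₀` is bounded below by `x + ν`, the eigenvalues of `T` accumulate only at or below
`-ν`: infinitely many eigenvalues `x ≥ a > -ν` would give an orthonormal sequence of eigenvectors
`e n` with `‖K (e n)‖ = ‖(x - T₀) (e n)‖ ≥ a + ν`, which compactness forbids. -/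
theorem IsPerturbation.finite_eigenvalues [CompleteSpace E]
    (hT : IsPerturbation T T₀ K) (hK : IsCompactOperator K) (hsymm : IsSymmetricOp T) {ν a : ℝ}
    (hlow : ∀ (x : ℝ) (f : T₀.domain), (x + ν) * ‖(f : E)‖ ≤ ‖(x : ℂ) • (f : E) - T₀ f‖)
    (ha : -ν < a) : {x : ℝ | a ≤ x ∧ IsEigenvalue T x}.Finite := by
  by_contra hinf
  let φ := Set.Infinite.natEmbedding _ hinf
  choose f hf0 hf using fun n => (φ n).2.2
  have hne : ∀ n, (f n : E) ≠ 0 := fun n h => hf0 n (Subtype.ext h)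
  have hfn : ∀ n, ‖(f n : E)‖ ≠ 0 := fun n => norm_ne_zero_iff.2 (hne n)
  let e : ℕ → E := fun n => ((‖(f n : E)‖⁻¹ : ℝ) : ℂ) • (f n : E)
  have he1 : ∀ n, ‖e n‖ = 1 := fun n => by
    simp [e, norm_smul, hfn n]
  have he : Orthonormal ℂ e := by
    refine ⟨he1, fun i j hij => ?_⟩
    simp only [e, inner_smul_left, inner_smul_right]
    have h := hsymm (f i) (f j)
    rw [hf, hf, inner_smul_left, inner_smul_right, Complex.conj_ofReal, ← sub_eq_zero,
      ← sub_mul, mul_eq_zero] at h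
    rcases h with h | h
    · refine absurd (φ.injective (Subtype.ext ?_)) hij
      exact_mod_cast sub_eq_zero.1 h
    · simp [h]
  have hlim := (tendsto_zero_of_isCompactOperator hK he).norm
  rw [norm_zero] at hlim
  have hge : ∀ n, a + ν ≤ ‖K (e n)‖ := by
    intro n
    have hf0 : (f n : E) ∈ T₀.domain := hT.domain_eq ▸ (f n).2
    have h1 : K (f n) = ((φ n : ℝ) : ℂ) • (f n : E) - T₀ ⟨f n, hf0⟩ := by
      rw [← hf n, hT.apply_eq _ _ hf0]
      abel
    have h2 := hlow (φ n) ⟨f n, hf0⟩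
    rw [← h1] at h2
    have h3 : ‖K (e n)‖ = ‖(f n : E)‖⁻¹ * ‖K (f n)‖ := by simp [e, norm_smul]
    rw [h3, ← div_eq_inv_mul, le_div_iff₀ (norm_pos_iff.2 (hne n))]
    refine le_trans ?_ h2
    gcongr
    exact (φ n).2.1
  have := ge_of_tendsto' hlim hge
  linarith

end Perturbation

/-! ### Enumeration of discrete sets of reals -/

section Enumeration

/-- A set of reals with a greatest element `0`, each of whose upper parts is finite, is enumerated
by a strictly decreasing sequence. -/
theorem exists_strictAntiOn_enumeration {S : Set ℝ} (h0 : (0 : ℝ) ∈ S) (hle : ∀ x ∈ S, x ≤ 0)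
    (hfin : ∀ a ∈ S, (S ∩ Set.Ici a).Finite) :
    ∃ (I : Set ℕ) (lam : ℕ → ℝ), IsLowerSet I ∧ 0 ∈ I ∧ lam 0 = 0 ∧ StrictAntiOn lam I ∧
      lam '' I = S := by
  classical
  -- the rank of `x` is the number of elements of `S` above it
  let r : ℝ → ℕ := fun x => (S ∩ Set.Ioi x).ncard
  have hfin' : ∀ a ∈ S, (S ∩ Set.Ioi a).Finite := fun a ha =>
    (hfin a ha).subset (Set.inter_subset_inter_right _ Set.Ioi_subset_Ici_self)
  have hr : ∀ x ∈ S, ∀ y ∈ S, x < y → r y < r x := by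
    intro x hx y hy hxy
    refine Set.ncard_lt_ncard ⟨?_, fun h => ?_⟩ (hfin' x hx)
    · exact Set.inter_subset_inter_right _ (Set.Ioi_subset_Ioi hxy.le)
    · exact lt_irrefl y (h ⟨hy, hxy⟩).2
  have hinj : Set.InjOn r S := by
    intro x hx y hy hxy
    by_contra hne
    rcases lt_or_gt_of_ne hne with h | h
    · exact (hr x hx y hy h).ne hxy.symm
    · exact (hr y hy x hx h).ne hxy
  have hstep : ∀ n, n + 1 ∈ r '' S → n ∈ r '' S := by
    rintro n ⟨x, hx, hxn⟩
    have hne : (S ∩ Set.Ioi x).Nonempty := by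
      rw [← Set.ncard_pos (hfin' x hx)]
      change 0 < r x
      omega
    obtain ⟨y, hy⟩ := (hfin' x hx).exists_minimal hne
    refine ⟨y, hy.1.1, ?_⟩
    have : S ∩ Set.Ioi x = insert y (S ∩ Set.Ioi y) := by
      ext w
      constructor
      · rintro ⟨hw, hxw⟩
        rcases le_or_gt w y with h | h
        · exact Or.inl (le_antisymm h (hy.2 ⟨hw, hxw⟩ h))
        · exact Or.inr ⟨hw, h⟩
      · rintro (rfl | ⟨hw, hyw⟩)
        · exact hy.1
        · exact ⟨hw, lt_trans (Set.mem_Ioi.1 hy.1.2) hyw⟩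
    have h2 : r x = r y + 1 := by
      change (S ∩ Set.Ioi x).ncard = _
      rw [this, Set.ncard_insert_of_notMem (fun h => lt_irrefl y h.2) (hfin' y hy.1.1)]
    omega
  have hr0 : r 0 = 0 := by
    have : S ∩ Set.Ioi 0 = ∅ := by
      ext x
      simp only [Set.mem_inter_iff, Set.mem_Ioi, Set.mem_empty_iff_false, iff_false, not_and,
        not_lt]
      exact hle x
    simp [r, this]
  have hlam : ∀ x ∈ S, Function.invFunOn r S (r x) = x := fun x hx =>
    hinj (Function.invFunOn_mem ⟨x, hx, rfl⟩) hx (Function.invFunOn_eq ⟨x, hx, rfl⟩)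
  refine ⟨r '' S, Function.invFunOn r S, ?_, ⟨0, h0, hr0⟩, ?_, ?_, ?_⟩
  · intro a b hba ha
    induction hba using Nat.decreasingInduction with
    | self => exact ha
    | of_succ k _ ih => exact hstep k ih
  · have := hlam 0 h0
    rwa [hr0] at this
  · rintro _ ⟨x, hx, rfl⟩ _ ⟨y, hy, rfl⟩ hxy
    rw [hlam x hx, hlam y hy]
    by_contra hle
    rcases (not_lt.1 hle).eq_or_lt with h | h
    · exact hxy.ne (by rw [h])
    · exact lt_asymm hxy (hr x hx y hy h)
  · rw [Set.image_image]
    ext x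
    constructor
    · rintro ⟨y, hy, rfl⟩
      simpa only [hlam y hy] using hy
    · exact fun hx => ⟨x, hx, hlam x hx⟩

end Enumeration

/-! ### The spectrum of a symmetric nonpositive compact perturbation -/

section SpectrumStructure

open scoped ComplexInnerProductSpace

variable {E : Type*} [NormedAddCommGroup E] [InnerProductSpace ℂ E] [CompleteSpace E]
  {T₀ T : E →ₗ.[ℂ] E} {K : E →L[ℂ] E}

/-- Below `-ν` the spectrum of `T₀` consists of Weyl points, which persist for `T = T₀ + K`; above
`-ν` the spectrum of `T` consists of eigenvalues, which are real, nonpositive, of finite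
multiplicity, and can accumulate only at `-ν`. -/
theorem IsPerturbation.spectrum_structure (hT : IsPerturbation T T₀ K) (hK : IsCompactOperator K)
    (hsymm : IsSymmetricOp T) (hneg : ∀ f : T.domain, (⟪T f, (f : E)⟫).re ≤ 0) {ν : ℝ} (hν : 0 < ν)
    (hlow : ∀ (x : ℝ) (f : T₀.domain), (x + ν) * ‖(f : E)‖ ≤ ‖(x : ℂ) • (f : E) - T₀ f‖)
    (hspec : opSpectrum T₀ = Complex.ofReal '' Set.Iic (-ν))
    (hweyl : ∀ x ≤ -ν, HasWeylSequence T₀ (x : ℂ)) (hzero : IsEigenvalue T 0) :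
    (∃ (I : Set ℕ) (lam : ℕ → ℝ),
      IsLowerSet I ∧ 0 ∈ I ∧ lam 0 = 0 ∧ StrictAntiOn lam I ∧
      (∀ n ∈ I, -ν < lam n ∧ IsEigenvalue T (lam n) ∧
        FiniteDimensional ℂ (algEigenspace T (lam n))) ∧
      (∀ x : ℝ, AccPt x (𝓟 (lam '' I)) → x = -ν) ∧
      opSpectrum T = Complex.ofReal '' (Set.Iic (-ν) ∪ lam '' I)) ∧
    ∃ δ : ℝ, 0 < δ ∧ ∀ z ∈ opSpectrum T, z ≠ 0 → z.re ≤ -δ := by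
  let S : Set ℝ := {x | -ν < x ∧ IsEigenvalue T x}
  have hS0 : ∀ x ∈ S, x ≤ 0 := by
    rintro x ⟨-, f, hf, hfx⟩
    have h := hneg f
    have hf' : 0 < ‖(f : E)‖ := norm_pos_iff.2 fun h => hf (Subtype.ext h)
    have h2 : (⟪(f : E), (f : E)⟫).re = ‖(f : E)‖ ^ 2 := inner_self_eq_norm_sq (𝕜 := ℂ) (f : E)
    rw [hfx, inner_smul_left, Complex.conj_ofReal, Complex.re_ofReal_mul, h2] at h
    by_contra! hx
    have : 0 < x * ‖(f : E)‖ ^ 2 := by positivity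
    linarith
  have hfin : ∀ a, -ν < a → (S ∩ Set.Ici a).Finite := fun a ha =>
    (hT.finite_eigenvalues hK hsymm hlow ha).subset fun x hx => ⟨hx.2, hx.1.2⟩
  have h0S : (0 : ℝ) ∈ S := ⟨by linarith, by simpa using hzero⟩
  have hns : ∀ x : ℝ, -ν < x → (x : ℂ) ∉ opSpectrum T₀ := by
    rintro x hx h
    rw [hspec] at h
    obtain ⟨y, hy, hyx⟩ := h
    have : y = x := by exact_mod_cast hyx
    exact absurd (this ▸ hy) (not_le.2 hx)
  have hsp : opSpectrum T = Complex.ofReal '' (Set.Iic (-ν) ∪ S) := by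
    ext z
    constructor
    · intro hz
      by_cases hz0 : z ∈ opSpectrum T₀
      · rw [hspec] at hz0
        exact Set.image_mono Set.subset_union_left hz0
      · have he := (hT.isEigenvalue_or_notMem_opSpectrum hK hz0).resolve_right (fun h => h hz)
        have hre := hsymm.eigenvalue_re he
        refine ⟨z.re, ?_, hre⟩
        rcases le_or_gt z.re (-ν) with h | h
        · exact Or.inl h
        · exact Or.inr ⟨h, by rwa [hre]⟩
    · rintro ⟨x, hx | hx, rfl⟩
      · exact ((hweyl x hx).perturb hT hK).mem_opSpectrum
      · exact hx.2.mem_opSpectrum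
  obtain ⟨I, lam, hI, h0I, hlam0, hanti, hIS⟩ :=
    exists_strictAntiOn_enumeration h0S hS0 fun a ha => hfin a ha.1
  refine ⟨⟨I, lam, hI, h0I, hlam0, hanti, fun n hn => ?_, fun x hx => ?_, by rw [hIS, hsp]⟩, ?_⟩
  · have hn' : lam n ∈ S := hIS ▸ Set.mem_image_of_mem lam hn
    refine ⟨hn'.1, hn'.2, ?_⟩
    rw [hsymm.algEigenspace_eq]
    exact hT.finiteDimensional_powKer_one hK (hns _ hn'.1)
  · rw [hIS] at hx
    have hxge : -ν ≤ x := by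
      have := hx.clusterPt
      have h2 : x ∈ closure S := mem_closure_iff_clusterPt.2 this
      exact closure_minimal (fun y hy => hy.1.le) isClosed_Ici h2
    by_contra hne
    have hlt : -ν < x := lt_of_le_of_ne hxge (Ne.symm hne)
    let a := (x - ν) / 2
    have ha1 : -ν < a := by simp only [a]; linarith
    have ha2 : a < x := by simp only [a]; linarith
    have := hx.nhds_inter (Ici_mem_nhds ha2)
    rw [Set.inter_comm] at this
    exact Set.Infinite.of_accPt (x := x) this (hfin a ha1)
  · -- only finitely many points of the spectrum lie in `(-ν/2, 0)`
    have hF : ((S ∩ Set.Ici (-ν / 2)) \ {0}).Finite := (hfin (-ν / 2) (by linarith)).sdiff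
    obtain ⟨δ, hδ, hδF⟩ : ∃ δ > 0, ∀ x ∈ (S ∩ Set.Ici (-ν / 2)) \ {0}, x ≤ -δ := by
      rcases ((S ∩ Set.Ici (-ν / 2)) \ {0}).eq_empty_or_nonempty with h | h
      · exact ⟨1, one_pos, by simp [h]⟩
      · obtain ⟨y, hy, hmax⟩ := hF.exists_maximalFor id _ h
        refine ⟨-y, ?_, fun x hx => ?_⟩
        · have := lt_of_le_of_ne (hS0 y hy.1.1) hy.2
          linarith
        · rw [neg_neg]
          rcases le_total x y with h | h
          · exact h
          · exact hmax hx h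
    refine ⟨min δ (ν / 2), by positivity, fun z hz hz0 => ?_⟩
    rw [hsp] at hz
    obtain ⟨x, hx, rfl⟩ := hz
    rw [Complex.ofReal_re]
    by_cases hxν : -ν / 2 ≤ x
    · have hxS : x ∈ S := hx.resolve_left fun h => by
        have : x ≤ -ν := h
        linarith
      have := hδF x ⟨⟨hxS, hxν⟩, by simpa using hz0⟩
      linarith [min_le_left δ (ν / 2)]
    · linarith [min_le_right δ (ν / 2)]

end SpectrumStructure

/-! ### The Schur test and compactness of integral operators -/

section IntegralOperators

open scoped ENNReal NNReal ComplexInnerProductSpace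

variable {X : Type*} [MeasurableSpace X] {μ : Measure X}

theorem enorm_ofReal_complex (r : ℝ) : ‖(r : ℂ)‖ₑ = ‖r‖ₑ := by
  rw [← ofReal_norm, ← ofReal_norm, Complex.norm_real]

/-- The Cauchy–Schwarz inequality. -/
theorem sq_lintegral_le {u a b : X → ℝ≥0∞} (ha : AEMeasurable a μ) (hb : AEMeasurable b μ)
    (h : ∀ x, u x ^ 2 ≤ a x * b x) :
    (∫⁻ x, u x ∂μ) ^ 2 ≤ (∫⁻ x, a x ∂μ) * ∫⁻ x, b x ∂μ := by
  have h2 : (2 : ℝ).HolderConjugate 2 := by norm_num [Real.holderConjugate_iff]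
  have hsq : ∀ t : ℝ≥0∞, (t ^ (1 / 2 : ℝ)) ^ (2 : ℝ) = t := fun t => by
    rw [← ENNReal.rpow_mul]; norm_num
  have h1 := ENNReal.lintegral_mul_le_Lp_mul_Lq μ h2 (ha.pow_const (1 / 2 : ℝ))
    (hb.pow_const (1 / 2 : ℝ))
  simp only [hsq, Pi.mul_apply] at h1
  have h3 : ∫⁻ x, u x ∂μ ≤ ∫⁻ x, a x ^ (1 / 2 : ℝ) * b x ^ (1 / 2 : ℝ) ∂μ := by
    refine lintegral_mono fun x => ?_
    rw [← ENNReal.mul_rpow_of_nonneg _ _ (by norm_num)]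
    have := ENNReal.rpow_le_rpow (h x) (by norm_num : (0 : ℝ) ≤ 1 / 2)
    rwa [← ENNReal.rpow_natCast, ← ENNReal.rpow_mul, Nat.cast_ofNat,
      show (2 : ℝ) * (1 / 2) = 1 by norm_num, ENNReal.rpow_one] at this
  calc _ ≤ ((∫⁻ x, a x ∂μ) ^ (1 / 2 : ℝ) * (∫⁻ x, b x ∂μ) ^ (1 / 2 : ℝ)) ^ 2 := by
        gcongr; exact h3.trans h1
    _ = _ := by
      rw [mul_pow, ← ENNReal.rpow_ofNat, ← ENNReal.rpow_ofNat, hsq, hsq]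

theorem lintegral_enorm_sq_eq (f : Lp ℂ 2 μ) : ∫⁻ x, ‖f x‖ₑ ^ 2 ∂μ = ‖f‖ₑ ^ 2 := by
  rw [Lp.enorm_def, eLpNorm_eq_lintegral_rpow_enorm_toReal (by norm_num) (by norm_num)]
  simp only [ENNReal.toReal_ofNat, ENNReal.rpow_ofNat]
  rw [← ENNReal.rpow_natCast, ← ENNReal.rpow_mul]
  norm_num

theorem memLp_two_iff_lintegral {f : X → ℂ} (hf : AEStronglyMeasurable f μ) :
    MemLp f 2 μ ↔ ∫⁻ x, ‖f x‖ₑ ^ 2 ∂μ < ∞ := by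
  rw [MemLp, and_iff_right hf,
    eLpNorm_lt_top_iff_lintegral_rpow_enorm_lt_top (by norm_num) (by norm_num)]
  simp

variable {k : X → X → ℝ≥0∞} {p : X → ℝ≥0∞}

/-- The Cauchy–Schwarz inequality in the variable `y`, with the weight `p` distributed over the two
factors. -/
theorem schur_pointwise (hk : Measurable (Function.uncurry k)) (hp : Measurable p)
    (hp0 : ∀ x, p x ≠ 0) (hpt : ∀ x, p x ≠ ∞) {f : X → ℝ≥0∞} (hf : Measurable f) (x : X) :
    (∫⁻ y, k x y * f y ∂μ) ^ 2 ≤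
      (∫⁻ y, k x y * p y ∂μ) * ∫⁻ y, k x y * ((p y)⁻¹ * f y ^ 2) ∂μ := by
  have hkx : Measurable (k x) := hk.comp measurable_prodMk_left
  refine sq_lintegral_le (hkx.mul hp).aemeasurable
    (hkx.mul (hp.inv.mul (hf.pow_const 2))).aemeasurable fun y => le_of_eq ?_
  calc _ = (k x y * f y) ^ 2 * (p y * (p y)⁻¹) := by
        rw [ENNReal.mul_inv_cancel (hp0 y) (hpt y), mul_one]
    _ = _ := by ring

/-- **Schur test**, operator form. -/
theorem schur_test [SFinite μ] (hk : Measurable (Function.uncurry k)) (hp : Measurable p)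
    (hp0 : ∀ x, p x ≠ 0) (hpt : ∀ x, p x ≠ ∞) {A B : ℝ≥0∞}
    (hA : ∀ x, ∫⁻ y, k x y * p y ∂μ ≤ A * p x) (hB : ∀ y, ∫⁻ x, k x y * p x ∂μ ≤ B * p y)
    {f : X → ℝ≥0∞} (hf : Measurable f) :
    ∫⁻ x, (∫⁻ y, k x y * f y ∂μ) ^ 2 ∂μ ≤ A * B * ∫⁻ x, f x ^ 2 ∂μ := by
  have hm : Measurable (Function.uncurry fun x y => p x * (k x y * ((p y)⁻¹ * f y ^ 2))) :=
    (hp.comp measurable_fst).mul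
      (hk.mul ((hp.inv.mul (hf.pow_const 2)).comp measurable_snd))
  calc _ ≤ ∫⁻ x, A * ∫⁻ y, p x * (k x y * ((p y)⁻¹ * f y ^ 2)) ∂μ ∂μ := by
        refine lintegral_mono fun x => ?_
        refine (schur_pointwise hk hp hp0 hpt hf x).trans ?_
        have hmx : Measurable fun y => k x y * ((p y)⁻¹ * f y ^ 2) :=
          (hk.comp measurable_prodMk_left).mul (hp.inv.mul (hf.pow_const 2))
        rw [lintegral_const_mul _ hmx, ← mul_assoc]
        gcongr
        exact hA x
    _ = A * ∫⁻ y, ∫⁻ x, p x * (k x y * ((p y)⁻¹ * f y ^ 2)) ∂μ ∂μ := by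
        rw [lintegral_const_mul _ hm.lintegral_prod_right, lintegral_lintegral_swap hm.aemeasurable]
    _ ≤ A * ∫⁻ y, B * f y ^ 2 ∂μ := by
        gcongr with y
        calc _ = (∫⁻ x, k x y * p x ∂μ) * ((p y)⁻¹ * f y ^ 2) := by
              have hmy : Measurable fun x => k x y * p x :=
                (hk.comp measurable_prodMk_right).mul hp
              rw [← lintegral_mul_const _ hmy]
              congr 1 with x
              ring
          _ ≤ B * p y * ((p y)⁻¹ * f y ^ 2) := by gcongr; exact hB y
          _ = B * f y ^ 2 * (p y * (p y)⁻¹) := by ring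
          _ = _ := by rw [ENNReal.mul_inv_cancel (hp0 y) (hpt y), mul_one]
    _ = _ := by rw [lintegral_const_mul _ (hf.pow_const 2), mul_assoc]

/-- **Schur test** for the bilinear form of a kernel. The bounds `A` and `B` may depend on the
point; they enter as weights on the right-hand side. -/
theorem schur_form [SFinite μ] (hk : Measurable (Function.uncurry k)) (hp : Measurable p)
    (hp0 : ∀ x, p x ≠ 0) (hpt : ∀ x, p x ≠ ∞) {A B : X → ℝ≥0∞}
    (hA : ∀ x, ∫⁻ y, k x y * p y ∂μ ≤ A x * p x) (hB : ∀ y, ∫⁻ x, k x y * p x ∂μ ≤ B y * p y)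
    {f g : X → ℝ≥0∞} (hf : Measurable f) (hg : Measurable g) :
    (∫⁻ x, ∫⁻ y, k x y * (f x * g y) ∂μ ∂μ) ^ 2 ≤
      (∫⁻ x, A x * f x ^ 2 ∂μ) * ∫⁻ y, B y * g y ^ 2 ∂μ := by
  have hm1 : Measurable fun z : X × X => k z.1 z.2 * (p z.2 * ((p z.1)⁻¹ * f z.1 ^ 2)) :=
    hk.mul ((hp.comp measurable_snd).mul ((hp.inv.mul (hf.pow_const 2)).comp measurable_fst))
  have hm2 : Measurable fun z : X × X => k z.1 z.2 * (p z.1 * ((p z.2)⁻¹ * g z.2 ^ 2)) :=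
    hk.mul ((hp.comp measurable_fst).mul ((hp.inv.mul (hg.pow_const 2)).comp measurable_snd))
  have hm3 : Measurable fun z : X × X => k z.1 z.2 * (f z.1 * g z.2) :=
    hk.mul ((hf.comp measurable_fst).mul (hg.comp measurable_snd))
  rw [lintegral_lintegral (f := fun x y => k x y * (f x * g y)) hm3.aemeasurable]
  refine (sq_lintegral_le hm1.aemeasurable hm2.aemeasurable fun z => le_of_eq ?_).trans ?_
  · calc _ = (k z.1 z.2 * (f z.1 * g z.2)) ^ 2 * (p z.1 * (p z.1)⁻¹) * (p z.2 * (p z.2)⁻¹) := by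
          rw [ENNReal.mul_inv_cancel (hp0 _) (hpt _), ENNReal.mul_inv_cancel (hp0 _) (hpt _),
            mul_one, mul_one]
      _ = _ := by ring
  · gcongr
    · rw [lintegral_prod _ hm1.aemeasurable]
      refine lintegral_mono fun x => ?_
      calc _ = (∫⁻ y, k x y * p y ∂μ) * ((p x)⁻¹ * f x ^ 2) := by
            have hmx : Measurable fun y => k x y * p y :=
              (hk.comp measurable_prodMk_left).mul hp
            rw [← lintegral_mul_const _ hmx]
            congr 1 with y
            ring
        _ ≤ A x * p x * ((p x)⁻¹ * f x ^ 2) := by gcongr; exact hA x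
        _ = A x * f x ^ 2 * (p x * (p x)⁻¹) := by ring
        _ = _ := by rw [ENNReal.mul_inv_cancel (hp0 _) (hpt _), mul_one]
    · rw [lintegral_prod_symm _ hm2.aemeasurable]
      refine lintegral_mono fun y => ?_
      calc _ = (∫⁻ x, k x y * p x ∂μ) * ((p y)⁻¹ * g y ^ 2) := by
            have hmy : Measurable fun x => k x y * p x :=
              (hk.comp measurable_prodMk_right).mul hp
            rw [← lintegral_mul_const _ hmy]
            congr 1 with x
            ring
        _ ≤ B y * p y * ((p y)⁻¹ * g y ^ 2) := by gcongr; exact hB y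
        _ = B y * g y ^ 2 * (p y * (p y)⁻¹) := by ring
        _ = _ := by rw [ENNReal.mul_inv_cancel (hp0 _) (hpt _), mul_one]

/-- `T` is the integral operator on `L²(μ)` with kernel `Γ`. -/
def IsIntegralOperator (Γ : X → X → ℝ) (T : Lp ℂ 2 μ →L[ℂ] Lp ℂ 2 μ) : Prop :=
  ∀ f, T f =ᵐ[μ] fun x => ∫ y, (Γ x y : ℂ) * f y ∂μ

/-- The hypotheses of the Schur test for the nonnegative kernel `Γ`: a positive finite weight `p`
whose integrals against `Γ` in either variable are bounded by the constants `A` and `B` times `p`.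
-/
structure SchurBound (μ : Measure X) (Γ : X → X → ℝ) (p : X → ℝ≥0∞) (A B : ℝ≥0) : Prop where
  measurable : Measurable (Function.uncurry Γ)
  nonneg : ∀ x y, 0 ≤ Γ x y
  measurable_weight : Measurable p
  weight_ne_zero : ∀ x, p x ≠ 0
  weight_ne_top : ∀ x, p x ≠ ∞
  left : ∀ x, ∫⁻ y, ‖Γ x y‖ₑ * p y ∂μ ≤ A * p x
  right : ∀ y, ∫⁻ x, ‖Γ x y‖ₑ * p x ∂μ ≤ B * p y

variable {Γ : X → X → ℝ} {A B : ℝ≥0}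

theorem SchurBound.lintegral_le [SFinite μ] (h : SchurBound μ Γ p A B) (f : Lp ℂ 2 μ) :
    ∫⁻ x, (∫⁻ y, ‖(Γ x y : ℂ) * f y‖ₑ ∂μ) ^ 2 ∂μ ≤ A * B * ‖f‖ₑ ^ 2 := by
  have := schur_test (k := fun x y => ‖Γ x y‖ₑ) h.measurable.enorm h.measurable_weight
    h.weight_ne_zero h.weight_ne_top h.left h.right (f := fun x => ‖f x‖ₑ)
    (Lp.stronglyMeasurable f).measurable.enorm
  rw [lintegral_enorm_sq_eq] at this
  simpa only [enorm_mul, enorm_ofReal_complex] using this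

theorem SchurBound.measurable_mul (h : SchurBound μ Γ p A B) (f : Lp ℂ 2 μ) :
    StronglyMeasurable fun z : X × X => (Γ z.1 z.2 : ℂ) * f z.2 :=
  ((Complex.measurable_ofReal.comp h.measurable).mul
    ((Lp.stronglyMeasurable f).measurable.comp measurable_snd)).stronglyMeasurable

theorem SchurBound.ae_integrable [SFinite μ] (h : SchurBound μ Γ p A B) (f : Lp ℂ 2 μ) :
    ∀ᵐ x ∂μ, Integrable (fun y => (Γ x y : ℂ) * f y) μ := by
  have hm := (h.measurable_mul f).measurable
  have hlt : ∫⁻ x, (∫⁻ y, ‖(Γ x y : ℂ) * f y‖ₑ ∂μ) ^ 2 ∂μ ≠ ∞ :=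
    ne_top_of_le_ne_top (by finiteness) (h.lintegral_le f)
  filter_upwards [ae_lt_top (hm.enorm.lintegral_prod_right.pow_const 2) hlt] with x hx
  refine ⟨(hm.comp measurable_prodMk_left).aestronglyMeasurable, ?_⟩
  rw [ENNReal.pow_lt_top_iff] at hx
  exact hx.resolve_right two_ne_zero

theorem SchurBound.memLp [SFinite μ] (h : SchurBound μ Γ p A B) (f : Lp ℂ 2 μ) :
    MemLp (fun x => ∫ y, (Γ x y : ℂ) * f y ∂μ) 2 μ := by
  rw [memLp_two_iff_lintegral (h.measurable_mul f).integral_prod_right.aestronglyMeasurable]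
  refine lt_of_le_of_lt ?_ ((h.lintegral_le f).trans_lt (by finiteness))
  gcongr with x
  exact enorm_integral_le_lintegral_enorm _

/-- A kernel that satisfies the Schur test defines a bounded operator on `L²(μ)`. -/
theorem SchurBound.exists_operator [SFinite μ] (h : SchurBound μ Γ p A B) :
    ∃ T : Lp ℂ 2 μ →L[ℂ] Lp ℂ 2 μ, ‖T‖ ≤ √(A * B) ∧ IsIntegralOperator Γ T := by
  let L : Lp ℂ 2 μ →ₗ[ℂ] Lp ℂ 2 μ :=
    { toFun := fun f => (h.memLp f).toLp
      map_add' := fun f g => by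
        rw [← MemLp.toLp_add]
        refine MemLp.toLp_congr _ _ ?_
        filter_upwards [h.ae_integrable f, h.ae_integrable g] with x hf hg
        rw [Pi.add_apply, ← integral_add hf hg]
        refine integral_congr_ae ?_
        filter_upwards [Lp.coeFn_add f g] with y hy
        rw [hy, Pi.add_apply, mul_add]
      map_smul' := fun c f => by
        rw [RingHom.id_apply, ← MemLp.toLp_const_smul]
        refine MemLp.toLp_congr _ _ (Eventually.of_forall fun x => ?_)
        simp only [Pi.smul_apply]
        rw [← integral_smul]
        refine integral_congr_ae ?_
        filter_upwards [Lp.coeFn_smul c f] with y hy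
        rw [hy, Pi.smul_apply, smul_eq_mul, smul_eq_mul]
        ring }
  have hL : ∀ f, L f =ᵐ[μ] fun x => ∫ y, (Γ x y : ℂ) * f y ∂μ := fun f =>
    MemLp.coeFn_toLp (h.memLp f)
  have hbd : ∀ f, ‖L f‖ ≤ √(A * B) * ‖f‖ := by
    intro f
    have h1 : ‖L f‖ₑ ^ 2 ≤ A * B * ‖f‖ₑ ^ 2 := by
      rw [← lintegral_enorm_sq_eq]
      refine (lintegral_mono_ae ?_).trans (h.lintegral_le f)
      filter_upwards [hL f] with x hx
      rw [hx]
      gcongr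
      exact enorm_integral_le_lintegral_enorm _
    have h2 : ‖L f‖ ^ 2 ≤ A * B * ‖f‖ ^ 2 := by
      have := ENNReal.toReal_mono (by finiteness) h1
      simpa using this
    refine le_of_sq_le_sq ?_ (by positivity)
    rwa [mul_pow, Real.sq_sqrt (by positivity)]
  exact ⟨L.mkContinuous _ hbd, L.mkContinuous_norm_le (by positivity) hbd, hL⟩

/-- A square integrable kernel defines a Hilbert–Schmidt operator: by Bessel's inequality for
`Γ x ·`, the sum of `|T (e i) x|²` is at most `∫ |Γ x y|² dy` at almost every `x`. -/
theorem IsIntegralOperator.isCompactOperator [SFinite μ] {T : Lp ℂ 2 μ →L[ℂ] Lp ℂ 2 μ}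
    (hT : IsIntegralOperator Γ T) (hm : Measurable (Function.uncurry Γ))
    (hΓ : ∫⁻ x, ∫⁻ y, ‖Γ x y‖ₑ ^ 2 ∂μ ∂μ ≠ ∞) : IsCompactOperator T := by
  set C := ∫⁻ x, ∫⁻ y, ‖Γ x y‖ₑ ^ 2 ∂μ ∂μ with hC
  refine isCompactOperator_of_sum_sq_le T C.toReal fun ι s e he => ?_
  have hmem : ∀ᵐ x ∂μ, MemLp (fun y => (Γ x y : ℂ)) 2 μ := by
    have hm2 : Measurable fun x => ∫⁻ y, ‖Γ x y‖ₑ ^ 2 ∂μ :=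
      (hm.enorm.pow_const 2).lintegral_prod_right'
    filter_upwards [ae_lt_top hm2 hΓ] with x hx
    have hmx : Measurable fun y => (Γ x y : ℂ) :=
      Complex.measurable_ofReal.comp (hm.comp measurable_prodMk_left)
    rw [memLp_two_iff_lintegral hmx.aestronglyMeasurable]
    simpa only [enorm_ofReal_complex] using hx
  have hbessel : ∀ᵐ x ∂μ, ∑ i ∈ s, ‖(T (e i)) x‖ₑ ^ 2 ≤ ∫⁻ y, ‖Γ x y‖ₑ ^ 2 ∂μ := by
    have hall : ∀ᵐ x ∂μ, ∀ i ∈ s, T (e i) x = ∫ y, (Γ x y : ℂ) * e i y ∂μ :=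
      (Finset.eventually_all s).2 fun i _ => hT (e i)
    filter_upwards [hmem, hall] with x hx hxe
    let g : Lp ℂ 2 μ := hx.toLp
    have hg : g =ᵐ[μ] fun y => (Γ x y : ℂ) := hx.coeFn_toLp
    have hin : ∀ i ∈ s, ‖T (e i) x‖ = ‖⟪e i, g⟫‖ := by
      intro i hi
      rw [hxe i hi, norm_inner_symm, L2.inner_def]
      congr 1
      refine integral_congr_ae ?_
      filter_upwards [hg] with y hy
      rw [hy]
      simp [mul_comm]
    have h1 : ∑ i ∈ s, ‖T (e i) x‖ ^ 2 ≤ ‖g‖ ^ 2 := by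
      rw [Finset.sum_congr rfl fun i hi => by rw [hin i hi]]
      exact he.sum_inner_products_le g
    have h2 : ‖g‖ₑ ^ 2 = ∫⁻ y, ‖Γ x y‖ₑ ^ 2 ∂μ := by
      rw [← lintegral_enorm_sq_eq]
      refine lintegral_congr_ae ?_
      filter_upwards [hg] with y hy
      rw [hy, enorm_ofReal_complex]
    rw [← h2]
    have h3 := ENNReal.ofReal_le_ofReal h1
    rw [ENNReal.ofReal_sum_of_nonneg (fun _ _ => by positivity)] at h3
    simpa only [ENNReal.ofReal_pow (norm_nonneg _), ofReal_norm] using h3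
  have h4 : ∑ i ∈ s, ‖T (e i)‖ₑ ^ 2 ≤ C := by
    calc _ = ∑ i ∈ s, ∫⁻ x, ‖T (e i) x‖ₑ ^ 2 ∂μ := by simp only [lintegral_enorm_sq_eq]
      _ = ∫⁻ x, ∑ i ∈ s, ‖T (e i) x‖ₑ ^ 2 ∂μ :=
        (lintegral_finsetSum _ fun i _ =>
          (Lp.stronglyMeasurable (T (e i))).measurable.enorm.pow_const 2).symm
      _ ≤ C := lintegral_mono_ae hbessel
  have h5 := ENNReal.toReal_mono hΓ h4
  rw [ENNReal.toReal_sum (fun _ _ => by finiteness)] at h5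
  simpa using h5

/-- Compactness of an integral operator without square integrability of its kernel: if restricting
`x` to suitable sets `S` makes the kernel square integrable and leaves a remainder with small Schur
bound, the operator is a norm limit of Hilbert–Schmidt operators. -/
theorem SchurBound.isCompactOperator [SFinite μ] (h : SchurBound μ Γ p A B)
    {T : Lp ℂ 2 μ →L[ℂ] Lp ℂ 2 μ} (hT : IsIntegralOperator Γ T)
    (htrunc : ∀ η : ℝ≥0, 0 < η → ∃ S : Set X, MeasurableSet S ∧
      ∫⁻ x in S, ∫⁻ y, ‖Γ x y‖ₑ ^ 2 ∂μ ∂μ ≠ ∞ ∧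
      ∀ x ∉ S, ∫⁻ y, ‖Γ x y‖ₑ * p y ∂μ ≤ η * p x) : IsCompactOperator T := by
  have hind : ∀ S : Set X, MeasurableSet S → ∀ A' : ℝ≥0,
      (∀ x ∈ S, ∫⁻ y, ‖Γ x y‖ₑ * p y ∂μ ≤ A' * p x) →
      SchurBound μ (fun x y => S.indicator (fun x => Γ x y) x) p A' B := by
    intro S hS A' hA'
    refine ⟨?_, fun x y => Set.indicator_nonneg (fun x _ => h.nonneg x y) x, h.measurable_weight,
      h.weight_ne_zero, h.weight_ne_top, fun x => ?_, fun y => ?_⟩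
    · convert h.measurable.indicator (hS.prod MeasurableSet.univ) using 1
      ext ⟨x, y⟩
      by_cases hx : x ∈ S <;> simp [Function.uncurry, hx]
    · by_cases hx : x ∈ S
      · simpa [hx] using hA' x hx
      · simp [hx]
    · refine le_trans (lintegral_mono fun x => ?_) (h.right y)
      by_cases hx : x ∈ S <;> simp [hx]
  -- `U n` is the Hilbert–Schmidt part, with `x` in `S n`, and `V n` the small remainder.
  have hη : ∀ n : ℕ, (0 : ℝ≥0) < 1 / (n + 1) := fun n => by positivity
  choose S hS hHS hsmall using fun n => htrunc _ (hη n)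
  choose U _ hU using fun n => (hind (S n) (hS n) A fun x _ => h.left x).exists_operator
  choose V hV hV' using fun n =>
    (hind (S n)ᶜ (hS n).compl _ fun x hx => hsmall n x hx).exists_operator
  have hsub : ∀ n, U n - T = -V n := by
    intro n
    rw [sub_eq_iff_eq_add', ← sub_eq_add_neg, eq_sub_iff_add_eq]
    ext1 f
    refine Lp.ext ?_
    rw [add_apply]
    filter_upwards [Lp.coeFn_add (U n f) (V n f), hU n f, hV' n f, hT f] with x h1 h2 h3 h4
    rw [h1, Pi.add_apply, h2, h3, h4]
    by_cases hx : x ∈ S n <;> simp [hx]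
  refine isCompactOperator_of_tendsto (l := atTop) (F := U) ?_ (Eventually.of_forall fun n => ?_)
  · rw [tendsto_iff_norm_sub_tendsto_zero]
    simp only [hsub, norm_neg]
    refine squeeze_zero (fun _ => norm_nonneg _) hV ?_
    have : Tendsto (fun n : ℕ => √((1 / ((n : ℝ) + 1)) * B)) atTop (𝓝 (√(0 * B))) :=
      (tendsto_one_div_add_atTop_nhds_zero_nat.mul_const _).sqrt
    simpa using this
  · refine (hU n).isCompactOperator (hind (S n) (hS n) A fun x _ => h.left x).measurable ?_
    convert hHS n using 1
    rw [← lintegral_indicator (hS n)]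
    refine lintegral_congr fun x => ?_
    by_cases hx : x ∈ S n <;> simp [hx]

theorem IsIntegralOperator.enorm_inner_le [SFinite μ] {T : Lp ℂ 2 μ →L[ℂ] Lp ℂ 2 μ}
    (hT : IsIntegralOperator Γ T) (hm : Measurable (Function.uncurry Γ)) (f g : Lp ℂ 2 μ) :
    ‖⟪g, T f⟫‖ₑ ≤ ∫⁻ x, ∫⁻ y, ‖Γ x y‖ₑ * (‖g x‖ₑ * ‖f y‖ₑ) ∂μ ∂μ := by
  rw [L2.inner_def]
  refine (enorm_integral_le_lintegral_enorm _).trans (lintegral_mono_ae ?_)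
  filter_upwards [hT f] with x hx
  rw [hx]
  have h1 : ‖(inner ℂ (g x) (∫ y, (Γ x y : ℂ) * f y ∂μ) : ℂ)‖ₑ
      = ‖g x‖ₑ * ‖∫ y, (Γ x y : ℂ) * f y ∂μ‖ₑ := by
    rw [RCLike.inner_apply, enorm_mul, mul_comm, RCLike.enorm_conj]
  rw [h1]
  calc _ ≤ ‖g x‖ₑ * ∫⁻ y, ‖(Γ x y : ℂ) * f y‖ₑ ∂μ := by
        gcongr; exact enorm_integral_le_lintegral_enorm _
    _ = ∫⁻ y, ‖g x‖ₑ * ‖(Γ x y : ℂ) * f y‖ₑ ∂μ := by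
        rw [lintegral_const_mul]
        exact ((Complex.measurable_ofReal.comp (hm.comp measurable_prodMk_left)).mul
          (Lp.stronglyMeasurable f).measurable).enorm
    _ = _ := by
        congr 1 with y
        rw [enorm_mul, enorm_ofReal_complex]
        ring

/-- A symmetric kernel defines a symmetric operator. The Schur test for the form justifies Fubini's
theorem. -/
theorem SchurBound.inner_symm [SFinite μ] (h : SchurBound μ Γ p A B)
    {T : Lp ℂ 2 μ →L[ℂ] Lp ℂ 2 μ} (hT : IsIntegralOperator Γ T) (hsymm : ∀ x y, Γ x y = Γ y x)
    (f g : Lp ℂ 2 μ) : ⟪T f, g⟫ = ⟪f, T g⟫ := by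
  have hf := (Lp.stronglyMeasurable f).measurable
  have hg := (Lp.stronglyMeasurable g).measurable
  let F : X × X → ℂ := fun z => (Γ z.1 z.2 : ℂ) * (starRingEnd ℂ (f z.1) * g z.2)
  have hF : Integrable F (μ.prod μ) := by
    refine ⟨(h.measurable.complex_ofReal.mul
      (((RCLike.continuous_conj.measurable).comp (hf.comp measurable_fst)).mul
        (hg.comp measurable_snd))).aestronglyMeasurable, ?_⟩
    have hms : Measurable fun z : X × X => ‖Γ z.1 z.2‖ₑ * (‖f z.1‖ₑ * ‖g z.2‖ₑ) :=
      h.measurable.enorm.mul ((hf.comp measurable_fst).enorm.mul (hg.comp measurable_snd).enorm)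
    have hsf := schur_form (k := fun x y => ‖Γ x y‖ₑ) h.measurable.enorm h.measurable_weight
      h.weight_ne_zero h.weight_ne_top h.left h.right hf.enorm hg.enorm
    rw [lintegral_const_mul _ (hf.enorm.pow_const 2), lintegral_const_mul _ (hg.enorm.pow_const 2),
      lintegral_enorm_sq_eq, lintegral_enorm_sq_eq] at hsf
    have h2 := hsf.trans_lt (by finiteness : _ < ∞)
    rw [ENNReal.pow_lt_top_iff] at h2
    rw [HasFiniteIntegral]
    calc _ = ∫⁻ z, ‖Γ z.1 z.2‖ₑ * (‖f z.1‖ₑ * ‖g z.2‖ₑ) ∂(μ.prod μ) := by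
          congr 1 with z
          simp only [F, enorm_mul, enorm_ofReal_complex, RCLike.enorm_conj]
      _ = _ := lintegral_prod _ hms.aemeasurable
      _ < ∞ := by simpa using h2
  have h1 : ⟪f, T g⟫ = ∫ x, ∫ y, F (x, y) ∂μ ∂μ := by
    rw [L2.inner_def]
    refine integral_congr_ae ?_
    filter_upwards [hT g] with x hx
    rw [hx, RCLike.inner_apply, ← integral_mul_const]
    refine integral_congr_ae (Eventually.of_forall fun y => ?_)
    simp only [F]
    ring
  have h2 : ⟪T f, g⟫ = ∫ y, ∫ x, F (x, y) ∂μ ∂μ := by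
    rw [L2.inner_def]
    refine integral_congr_ae ?_
    filter_upwards [hT f] with y hy
    rw [hy, RCLike.inner_apply, ← integral_conj, ← integral_const_mul]
    refine integral_congr_ae (Eventually.of_forall fun x => ?_)
    simp only [F, map_mul, Complex.conj_ofReal, hsymm x y]
    ring
  rw [h1, h2, integral_integral_swap (f := fun x y => F (x, y)) hF]

end IntegralOperators

/-! ### The collision frequency -/

section CollisionFrequency

variable (P : Params)

theorem measurable_maxwellian (m ϑ : ℝ) (u : Vel) : Measurable (maxwellian m ϑ u) := by
  unfold maxwellian; fun_prop

theorem measurable_hostMaxwellian : Measurable (hostMaxwellian P) := measurable_maxwellian _ _ _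

theorem measurable_eqMaxwellian : Measurable (eqMaxwellian P) := measurable_maxwellian _ _ _

theorem hostMaxwellian_pos (v : Vel) : 0 < hostMaxwellian P v := by
  have := P.ϑ₁_pos
  have := P.m₁_pos
  unfold hostMaxwellian maxwellian
  positivity

theorem sq_mul_exp_le {c : ℝ} (hc : 0 < c) (t : ℝ) :
    (1 + t) ^ 2 * Real.exp (-c * t ^ 2) ≤ (2 + 4 / c) * Real.exp (-(c / 2) * t ^ 2) := by
  have h1 : Real.exp (-c * t ^ 2) = Real.exp (-(c / 2) * t ^ 2) * Real.exp (-(c / 2 * t ^ 2)) := by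
    rw [← Real.exp_add]; congr 1; ring
  have h2 := Real.add_one_le_exp (c / 2 * t ^ 2)
  have h3 : (1 + t) ^ 2 ≤ (2 + 4 / c) * Real.exp (c / 2 * t ^ 2) := by
    have h4 : 2 + 2 * t ^ 2 ≤ (2 + 4 / c) * (c / 2 * t ^ 2 + 1) := by
      have : (2 + 4 / c) * (c / 2 * t ^ 2 + 1) = 2 + 2 * t ^ 2 + (c * t ^ 2 + 4 / c) := by
        field_simp; ring
      rw [this]
      have : 0 ≤ c * t ^ 2 + 4 / c := by positivity
      linarith
    have h5 : (2 + 4 / c) * (c / 2 * t ^ 2 + 1) ≤ (2 + 4 / c) * Real.exp (c / 2 * t ^ 2) := by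
      gcongr
    nlinarith [sq_nonneg (1 - t)]
  rw [h1, mul_comm (Real.exp _), ← mul_assoc]
  refine mul_le_mul_of_nonneg_right ?_ (Real.exp_pos _).le
  rw [Real.exp_neg, ← div_eq_mul_inv, div_le_iff₀ (Real.exp_pos _)]
  exact h3

theorem integrable_exp_neg_mul_sq_norm {c : ℝ} (hc : 0 < c) :
    Integrable fun v : Vel => Real.exp (-c * ‖v‖ ^ 2) := by
  have h := (GaussianFourier.integrable_cexp_neg_mul_sq_norm_add (V := Vel) (b := (c : ℂ))
    (by simpa using hc) 0 0).norm
  refine h.congr (Eventually.of_forall fun v => ?_)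
  beta_reduce
  rw [zero_mul, add_zero, ← Complex.ofReal_neg, ← Complex.ofReal_pow, ← Complex.ofReal_mul,
    Complex.norm_exp_ofReal]

/-- All moments of order at most two of a Gaussian are finite. -/
theorem integrable_sq_mul_maxwellian {m ϑ : ℝ} (hm : 0 < m) (hϑ : 0 < ϑ) (u : Vel) :
    Integrable fun v : Vel => (1 + ‖v‖) ^ 2 * maxwellian m ϑ u v := by
  set c := m / (2 * ϑ) with hc
  have hc0 : 0 < c := by positivity
  have h1 : Integrable fun v : Vel => (1 + ‖v - u‖) ^ 2 * Real.exp (-c * ‖v - u‖ ^ 2) := by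
    have : Integrable fun v : Vel => (1 + ‖v‖) ^ 2 * Real.exp (-c * ‖v‖ ^ 2) := by
      refine ((integrable_exp_neg_mul_sq_norm (half_pos hc0)).const_mul (2 + 4 / c)).mono'
        (by fun_prop) (Eventually.of_forall fun v => ?_)
      rw [Real.norm_of_nonneg (by positivity)]
      exact sq_mul_exp_le hc0 _
    exact this.comp_sub_right u
  refine (h1.const_mul ((1 + ‖u‖) ^ 2 * (m / (2 * Real.pi * ϑ)) ^ (3 / 2 : ℝ))).mono'
    (by have := measurable_maxwellian m ϑ u; fun_prop) (Eventually.of_forall fun v => ?_)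
  have hexp : Real.exp (-(m * ‖v - u‖ ^ 2) / (2 * ϑ)) = Real.exp (-c * ‖v - u‖ ^ 2) := by
    congr 1; rw [hc]; field_simp
  unfold maxwellian
  rw [Real.norm_of_nonneg (by positivity), hexp]
  have h2 : 1 + ‖v‖ ≤ (1 + ‖u‖) * (1 + ‖v - u‖) := by
    have : ‖v‖ ≤ ‖v - u‖ + ‖u‖ := by simpa using norm_add_le (v - u) u
    nlinarith [mul_nonneg (norm_nonneg u) (norm_nonneg (v - u))]
  have h3 : (1 + ‖v‖) ^ 2 ≤ ((1 + ‖u‖) * (1 + ‖v - u‖)) ^ 2 := by gcongr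
  have h4 : 0 ≤ (m / (2 * Real.pi * ϑ)) ^ (3 / 2 : ℝ) * Real.exp (-c * ‖v - u‖ ^ 2) := by positivity
  calc _ ≤ ((1 + ‖u‖) * (1 + ‖v - u‖)) ^ 2 *
        ((m / (2 * Real.pi * ϑ)) ^ (3 / 2 : ℝ) * Real.exp (-c * ‖v - u‖ ^ 2)) := by gcongr
    _ = _ := by ring

theorem integrable_hostMaxwellian_mul :
    Integrable fun v : Vel => (1 + ‖v‖) * hostMaxwellian P v := by
  refine (integrable_sq_mul_maxwellian P.m₁_pos P.ϑ₁_pos P.u₁).mono'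
    (by have := measurable_hostMaxwellian P; fun_prop) (Eventually.of_forall fun v => ?_)
  have := hostMaxwellian_pos P v
  rw [Real.norm_of_nonneg (by positivity)]
  change _ ≤ _ * hostMaxwellian P v
  gcongr
  nlinarith [norm_nonneg v]

theorem integrable_hostMaxwellian : Integrable (hostMaxwellian P) := by
  refine (integrable_hostMaxwellian_mul P).mono'
    (measurable_hostMaxwellian P).aestronglyMeasurable (Eventually.of_forall fun v => ?_)
  have := hostMaxwellian_pos P v
  rw [Real.norm_of_nonneg this.le]
  nlinarith [norm_nonneg v]

theorem norm_sphere (n : S2) : ‖(n : Vel)‖ = 1 := by simp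

theorem abs_inner_sphere_le (x : Vel) (n : S2) : |inner ℝ x (n : Vel)| ≤ ‖x‖ := by
  simpa [norm_sphere n] using abs_real_inner_le_norm x (n : Vel)

theorem integrable_fst {g : Vel → ℝ} (hg : Integrable g) :
    Integrable (fun p : Vel × S2 => g p.1) ((volume : Measure Vel).prod surface) := by
  simpa using hg.mul_prod (integrable_const (1 : ℝ) (μ := surface))

theorem measurable_lossIntegrand (v : Vel) : Measurable fun p : Vel × S2 =>
    |inner ℝ (v - p.1) (p.2 : Vel)| * hostMaxwellian P p.1 := by
  have := measurable_hostMaxwellian P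
  fun_prop

theorem integrable_lossIntegrand (v : Vel) : Integrable (fun p : Vel × S2 =>
    |inner ℝ (v - p.1) (p.2 : Vel)| * hostMaxwellian P p.1)
    ((volume : Measure Vel).prod surface) := by
  refine ((integrable_fst (integrable_hostMaxwellian_mul P)).const_mul (1 + ‖v‖)).mono'
    (measurable_lossIntegrand P v).aestronglyMeasurable (Eventually.of_forall fun p => ?_)
  have := hostMaxwellian_pos P p.1
  rw [Real.norm_of_nonneg (by positivity), ← mul_assoc]
  gcongr
  refine (abs_inner_sphere_le _ _).trans ((norm_sub_le _ _).trans ?_)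
  nlinarith [norm_nonneg v, norm_nonneg p.1]

theorem exists_collisionFreq_lipschitz : ∃ C : ℝ, 0 ≤ C ∧ ∀ v v' : Vel,
    |collisionFreq P v - collisionFreq P v'| ≤ C * ‖v - v'‖ := by
  have hint := integrable_fst (integrable_hostMaxwellian P)
  refine ⟨_, integral_nonneg (μ := (volume : Measure Vel).prod surface)
    (f := fun p => hostMaxwellian P p.1) fun p => (hostMaxwellian_pos P p.1).le, fun v v' => ?_⟩
  unfold collisionFreq
  rw [← integral_sub (integrable_lossIntegrand P v) (integrable_lossIntegrand P v'),
    mul_comm, ← integral_const_mul, ← Real.norm_eq_abs]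
  refine norm_integral_le_of_norm_le (hint.const_mul _) (Eventually.of_forall fun p => ?_)
  have hp := hostMaxwellian_pos P p.1
  rw [← sub_mul, norm_mul, Real.norm_of_nonneg hp.le, Real.norm_eq_abs]
  gcongr
  refine (abs_abs_sub_abs_le_abs_sub _ _).trans ?_
  rw [← inner_sub_left, sub_sub_sub_cancel_right]
  exact abs_inner_sphere_le _ _

theorem continuous_collisionFreq : Continuous (collisionFreq P) := by
  obtain ⟨C, hC, h⟩ := exists_collisionFreq_lipschitz P
  exact (LipschitzWith.of_dist_le_mul (K := ⟨C, hC⟩) fun x y => by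
    rw [Real.dist_eq, dist_eq_norm]; exact h x y).continuous

theorem collisionFreq_nonneg (v : Vel) : 0 ≤ collisionFreq P v :=
  integral_nonneg fun p => mul_nonneg (abs_nonneg _) (hostMaxwellian_pos P p.1).le

theorem hostMaxwellian_reflect (w : Vel) :
    hostMaxwellian P (P.u₁ + P.u₁ - w) = hostMaxwellian P w := by
  unfold hostMaxwellian maxwellian
  rw [show P.u₁ + P.u₁ - w - P.u₁ = -(w - P.u₁) by abel, norm_neg]

/-- Averaging over the reflection of the host velocity about its mean bounds `σ(v)` from below
by any integrand dominated by the symmetrised one. -/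
theorem le_collisionFreq (v : Vel) {F : Vel × S2 → ℝ}
    (hF : Integrable F ((volume : Measure Vel).prod surface))
    (h : ∀ w n, 2 * F (w, n) ≤ (|inner ℝ (v - w) (n : Vel)|
      + |inner ℝ (v - (P.u₁ + P.u₁ - w)) (n : Vel)|) * hostMaxwellian P w) :
    ∫ p, F p ∂((volume : Measure Vel).prod surface) ≤ collisionFreq P v := by
  let r : Vel → Vel := fun w => P.u₁ + P.u₁ - w
  have hr : MeasurePreserving (Prod.map r (id : S2 → S2))
      ((volume : Measure Vel).prod surface) ((volume : Measure Vel).prod surface) :=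
    (Measure.measurePreserving_sub_left volume (P.u₁ + P.u₁)).prod (MeasurePreserving.id surface)
  have hre : MeasurableEmbedding (Prod.map r (id : S2 → S2)) :=
    ((MeasurableEquiv.subLeft (P.u₁ + P.u₁)).prodCongr
      (MeasurableEquiv.refl S2)).measurableEmbedding
  let G : Vel × S2 → ℝ := fun p => |inner ℝ (v - p.1) (p.2 : Vel)| * hostMaxwellian P p.1
  have hG : Integrable G ((volume : Measure Vel).prod surface) := integrable_lossIntegrand P v
  have h1 : ∫ p, G (Prod.map r id p) ∂((volume : Measure Vel).prod surface) = collisionFreq P v :=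
    hr.integral_comp hre G
  have h2 : Integrable (fun p => G (Prod.map r id p)) ((volume : Measure Vel).prod surface) :=
    hr.integrable_comp_of_integrable hG
  have h3 : ∫ p, 2 * F p ∂((volume : Measure Vel).prod surface) ≤
      ∫ p, (G p + G (Prod.map r id p)) ∂((volume : Measure Vel).prod surface) := by
    refine integral_mono (hF.const_mul 2) (hG.add h2) fun p => ?_
    refine (h p.1 p.2).trans (le_of_eq ?_)
    simp only [G, r, Prod.map, id, hostMaxwellian_reflect]
    ring
  rw [integral_add hG h2, h1, integral_const_mul] at h3
  change _ ≤ collisionFreq P v + collisionFreq P v at h3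
  linarith

/-- The collision frequency is smallest at the mean velocity of the host fluid. -/
theorem collisionFreq_min (v : Vel) : collisionFreq P P.u₁ ≤ collisionFreq P v := by
  refine le_collisionFreq P v (integrable_lossIntegrand P P.u₁) fun w n => ?_
  have hw := hostMaxwellian_pos P w
  simp only
  rw [← mul_assoc]
  gcongr
  have : 2 * |inner ℝ (P.u₁ - w) (n : Vel)| = |inner ℝ (v - w) (n : Vel)
      - inner ℝ (v - (P.u₁ + P.u₁ - w)) (n : Vel)| := by
    rw [← inner_sub_left, show v - w - (v - (P.u₁ + P.u₁ - w)) = (2 : ℝ) • (P.u₁ - w) by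
      rw [two_smul]; abel, real_inner_smul_left, abs_mul, abs_two]
  rw [this]
  exact abs_sub _ _

theorem surface_ne_zero : surface ≠ 0 := Measure.toSphere_ne_zero (volume : Measure Vel)

theorem collisionFreq_u₁_pos : 0 < collisionFreq P P.u₁ := by
  refine lt_of_le_of_ne (collisionFreq_nonneg P _) fun h => ?_
  have h0 : 0 ≤ fun p : Vel × S2 =>
      |inner ℝ (P.u₁ - p.1) (p.2 : Vel)| * hostMaxwellian P p.1 :=
    fun p => mul_nonneg (abs_nonneg _) (hostMaxwellian_pos P p.1).le
  have h1 := (integral_eq_zero_iff_of_nonneg h0 (integrable_lossIntegrand P P.u₁)).1 h.symm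
  have h2 : ∀ᵐ w : Vel, ∀ᵐ n : S2 ∂surface, inner ℝ (P.u₁ - w) (n : Vel) = 0 := by
    filter_upwards [Measure.ae_ae_of_ae_prod h1] with w hw
    filter_upwards [hw] with n hn
    simpa [(hostMaxwellian_pos P w).ne'] using hn
  have hms : MeasurableSet {x : Vel × S2 | inner ℝ (P.u₁ - x.1) (x.2 : Vel) = 0} :=
    measurableSet_eq_fun (by fun_prop) measurable_const
  have h3 := (Measure.ae_ae_comm (μ := (volume : Measure Vel)) (ν := surface)
    (p := fun (w : Vel) (n : S2) => inner ℝ (P.u₁ - w) (n : Vel) = 0) hms).1 h2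
  have : NeZero surface := ⟨surface_ne_zero⟩
  obtain ⟨n, hn⟩ := h3.exists
  have h4 : (fun w : Vel => inner ℝ (P.u₁ - w) (n : Vel)) = fun _ => 0 :=
    (Continuous.ae_eq_iff_eq volume (by fun_prop) continuous_const).1 hn
  have h5 := congrFun h4 (P.u₁ - n)
  simp [norm_sphere n] at h5

/-- The collision frequency grows at least linearly along some ray from `u₁`. -/
theorem exists_collisionFreq_growth :
    ∃ (e : Vel) (c : ℝ), 0 < c ∧ ∀ t : ℝ, 0 ≤ t → c * t ≤ collisionFreq P (P.u₁ + t • e) := by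
  have hint : ∀ e : Vel, Integrable (fun p : Vel × S2 =>
      |inner ℝ e (p.2 : Vel)| * hostMaxwellian P p.1) ((volume : Measure Vel).prod surface) := by
    intro e
    refine ((integrable_fst (integrable_hostMaxwellian P)).const_mul ‖e‖).mono'
      ?_ (Eventually.of_forall fun p => ?_)
    · have := measurable_hostMaxwellian P
      exact Measurable.aestronglyMeasurable (by fun_prop)
    · have := hostMaxwellian_pos P p.1
      rw [Real.norm_of_nonneg (by positivity)]
      gcongr
      exact abs_inner_sphere_le _ _
  obtain ⟨e, he⟩ : ∃ e : Vel, 0 < ∫ p : Vel × S2, |inner ℝ e (p.2 : Vel)| * hostMaxwellian P p.1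
      ∂((volume : Measure Vel).prod surface) := by
    by_contra! hcon
    have h1 : ∀ e : Vel, ∀ᵐ p : Vel × S2 ∂((volume : Measure Vel).prod surface),
        inner ℝ e (p.2 : Vel) = 0 := by
      intro e
      have h0 : 0 ≤ fun p : Vel × S2 => |inner ℝ e (p.2 : Vel)| * hostMaxwellian P p.1 :=
        fun p => mul_nonneg (abs_nonneg _) (hostMaxwellian_pos P p.1).le
      have h2 := (integral_eq_zero_iff_of_nonneg h0 (hint e)).1
        (le_antisymm (hcon e) (integral_nonneg h0))
      filter_upwards [h2] with p hp
      simpa [(hostMaxwellian_pos P p.1).ne'] using hp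
    have h2 : ∀ᵐ p : Vel × S2 ∂((volume : Measure Vel).prod surface),
        ∀ i : Fin 3, inner ℝ (EuclideanSpace.basisFun (Fin 3) ℝ i) (p.2 : Vel) = 0 :=
      ae_all_iff.2 fun i => h1 _
    have : NeZero surface := ⟨surface_ne_zero⟩
    obtain ⟨w, hw⟩ := (Measure.ae_ae_of_ae_prod h2).exists
    obtain ⟨n, hn⟩ := hw.exists
    have h3 : (n : Vel) = 0 := by
      rw [← (EuclideanSpace.basisFun (Fin 3) ℝ).sum_repr' (n : Vel)]
      exact Finset.sum_eq_zero fun i _ => by rw [hn i, zero_smul]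
    have := norm_sphere n
    simp [h3] at this
  refine ⟨e, _, he, fun t ht => ?_⟩
  rw [mul_comm, ← integral_const_mul]
  refine le_collisionFreq P _ ((hint e).const_mul t) fun w n => ?_
  have hw := hostMaxwellian_pos P w
  simp only
  rw [← mul_assoc, ← mul_assoc]
  gcongr
  have : 2 * t * |inner ℝ e (n : Vel)| = |inner ℝ (P.u₁ + t • e - w) (n : Vel)
      + inner ℝ (P.u₁ + t • e - (P.u₁ + P.u₁ - w)) (n : Vel)| := by
    rw [← inner_add_left, show P.u₁ + t • e - w + (P.u₁ + t • e - (P.u₁ + P.u₁ - w))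
      = (2 * t) • e by rw [mul_smul, two_smul]; abel, real_inner_smul_left, abs_mul,
      abs_of_nonneg (by positivity : 0 ≤ 2 * t)]
  rw [this]
  exact abs_add_le _ _

theorem nuZero_eq : nuZero P = collisionFreq P P.u₁ := by
  have hbdd : BddBelow (Set.range (collisionFreq P)) :=
    ⟨collisionFreq P P.u₁, by rintro _ ⟨v, rfl⟩; exact collisionFreq_min P v⟩
  exact le_antisymm (ciInf_le hbdd _) (le_ciInf (collisionFreq_min P))

theorem nuZero_pos : 0 < nuZero P := nuZero_eq P ▸ collisionFreq_u₁_pos P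

theorem nuZero_le (v : Vel) : nuZero P ≤ collisionFreq P v := nuZero_eq P ▸ collisionFreq_min P v

/-- By the intermediate value theorem, `σ` attains every value in `[ν₀, ∞)`. -/
theorem exists_collisionFreq_eq {x : ℝ} (hx : nuZero P ≤ x) : ∃ v, collisionFreq P v = x := by
  obtain ⟨e, c, hc, h⟩ := exists_collisionFreq_growth P
  have hx0 : 0 ≤ x := (nuZero_pos P).le.trans hx
  refine mem_range_of_exists_le_of_exists_ge (continuous_collisionFreq P)
    ⟨P.u₁, nuZero_eq P ▸ hx⟩ ⟨P.u₁ + (x / c) • e, ?_⟩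
  have := h (x / c) (by positivity)
  rwa [mul_div_cancel₀ _ hc.ne'] at this

end CollisionFrequency

/-! ### The spectrum of the loss operator -/

section LossOperator

open scoped ENNReal

variable (P : Params)

theorem continuous_eqMaxwellian : Continuous (eqMaxwellian P) := by
  unfold eqMaxwellian maxwellian; fun_prop

instance : IsLocallyFiniteMeasure (weight P) :=
  IsLocallyFiniteMeasure.withDensity_ofReal
    ((continuous_eqMaxwellian P).inv₀ fun v => (eqMaxwellian_pos P v).ne')

instance : SigmaFinite (weight P) := SigmaFinite.withDensity_ofReal _

instance : (weight P).IsOpenPosMeasure := (ac_weight P).isOpenPosMeasure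

theorem lossOperator_coeFn (f : (lossOperator P).domain) :
    lossOperator P f =ᵐ[weight P] lossFun P f.1 :=
  MemLp.coeFn_toLp (mem_lossDomain P f.2)

theorem aestronglyMeasurable_lossFun (f : H P) :
    AEStronglyMeasurable (lossFun P f) (weight P) :=
  (((continuous_collisionFreq P).measurable.complex_ofReal).aestronglyMeasurable).mul
    (Lp.aestronglyMeasurable f)

/-- For `f` in the domain, `z f - (-L⁻) f = (z + σ) f`. -/
theorem smul_sub_neg_loss_coeFn (z : ℂ) (f : (-lossOperator P).domain) :
    (z • (f : H P) - (-lossOperator P) f : H P) =ᵐ[weight P]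
      fun v => (z + collisionFreq P v) * (f : H P) v := by
  have h := lossOperator_coeFn P f
  rw [LinearPMap.neg_apply, sub_neg_eq_add]
  filter_upwards [Lp.coeFn_add (z • (f : H P)) (lossOperator P f), Lp.coeFn_smul z (f : H P), h]
    with v h1 h2 h3
  rw [h1, Pi.add_apply, h2, h3, lossFun, Pi.smul_apply, smul_eq_mul]
  ring

theorem le_norm_smul_sub_neg_loss (x : ℝ) (f : (-lossOperator P).domain) :
    (x + nuZero P) * ‖(f : H P)‖ ≤ ‖(x : ℂ) • (f : H P) - (-lossOperator P) f‖ := by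
  rcases le_or_gt (x + nuZero P) 0 with hx | hx
  · exact (mul_nonpos_of_nonpos_of_nonneg hx (norm_nonneg _)).trans (norm_nonneg _)
  · have h1 : ‖((x + nuZero P : ℝ) : ℂ) • (f : H P)‖ ≤
        ‖(x : ℂ) • (f : H P) - (-lossOperator P) f‖ := by
      refine Lp.norm_le_norm_of_ae_le ?_
      filter_upwards [smul_sub_neg_loss_coeFn P x f,
        Lp.coeFn_smul ((x + nuZero P : ℝ) : ℂ) (f : H P)] with v h1 h2
      rw [h1, h2, Pi.smul_apply, smul_eq_mul, norm_mul, norm_mul, ← Complex.ofReal_add,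
        Complex.norm_real, Complex.norm_real, Real.norm_of_nonneg hx.le]
      have := nuZero_le P v
      rw [Real.norm_of_nonneg (by linarith)]
      gcongr
    rwa [norm_smul, Complex.norm_real, Real.norm_of_nonneg hx.le] at h1

/-- Multiplication by a bounded measurable function is a bounded operator on `L²`. -/
theorem exists_mulOperator {m : Vel → ℂ} (hm : Measurable m) {C : ℝ}
    (hC : ∀ v, ‖m v‖ ≤ C) : ∃ R : H P →L[ℂ] H P, ∀ f, R f =ᵐ[weight P] fun v => m v * f v := by
  have hmem : ∀ f : H P, MemLp (fun v => m v * f v) 2 (weight P) := fun f =>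
    (Lp.memLp f).of_le_mul (c := C)
      (hm.aestronglyMeasurable.mul (Lp.aestronglyMeasurable f)) <| Eventually.of_forall fun v => by
        rw [norm_mul]; gcongr; exact hC v
  let L : H P →ₗ[ℂ] H P :=
    { toFun := fun f => (hmem f).toLp
      map_add' := fun f g => by
        rw [← MemLp.toLp_add]
        refine MemLp.toLp_congr _ _ ?_
        filter_upwards [Lp.coeFn_add f g] with v hv
        rw [hv, Pi.add_apply, Pi.add_apply, mul_add]
      map_smul' := fun c f => by
        rw [RingHom.id_apply, ← MemLp.toLp_const_smul]
        refine MemLp.toLp_congr _ _ ?_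
        filter_upwards [Lp.coeFn_smul c f] with v hv
        rw [hv, Pi.smul_apply, Pi.smul_apply, smul_eq_mul, smul_eq_mul]
        ring }
  have hL : ∀ f, L f =ᵐ[weight P] fun v => m v * f v := fun f => (hmem f).coeFn_toLp
  refine ⟨L.mkContinuous C fun f => ?_, hL⟩
  refine Lp.norm_le_mul_norm_of_ae_le_mul ?_
  filter_upwards [hL f] with v hv
  rw [hv, norm_mul]
  gcongr
  exact hC v

/-- Off `(-∞, -ν₀]`, division by `z + σ` is a bounded inverse of `z - (-L⁻)`. -/
theorem opSpectrum_neg_loss_subset :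
    opSpectrum (-lossOperator P) ⊆ Complex.ofReal '' Set.Iic (-nuZero P) := by
  intro z hz
  by_contra hzn
  refine hz ?_
  have hclosed : IsClosed (Complex.ofReal '' Set.Iic (-nuZero P)) :=
    Complex.isometry_ofReal.isClosedEmbedding.isClosedMap _ isClosed_Iic
  obtain ⟨d, hd, hdist⟩ := Metric.isOpen_iff.1 hclosed.isOpen_compl z hzn
  have hlow : ∀ v, d ≤ ‖z + collisionFreq P v‖ := by
    intro v
    by_contra! hlt
    have : ((-collisionFreq P v : ℝ) : ℂ) ∈ Metric.ball z d := by
      rw [Metric.mem_ball, dist_comm, dist_eq_norm, Complex.ofReal_neg, sub_neg_eq_add]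
      exact hlt
    exact hdist this ⟨_, neg_le_neg (nuZero_le P v), rfl⟩
  have hne : ∀ v, z + collisionFreq P v ≠ 0 := fun v h => by
    have := hlow v
    rw [h, norm_zero] at this
    linarith
  have hσ : Measurable fun v => z + (collisionFreq P v : ℂ) :=
    (continuous_collisionFreq P).measurable.complex_ofReal.const_add z
  obtain ⟨R, hR⟩ := exists_mulOperator P (m := fun v => (z + collisionFreq P v)⁻¹) hσ.inv (C := d⁻¹)
    fun v => by
      rw [norm_inv]
      exact inv_anti₀ hd (hlow v)
  refine ⟨R, fun h => ?_, fun f => ?_⟩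
  · have hmem : R h ∈ (-lossOperator P).domain := by
      change MemLp (lossFun P (R h)) 2 (weight P)
      refine ((Lp.memLp h).sub ((Lp.memLp (R h)).const_mul z)).ae_eq ?_
      filter_upwards [hR h] with v hv
      simp only [Pi.sub_apply, lossFun, hv]
      field_simp [hne v]
      ring
    refine ⟨hmem, Lp.ext ?_⟩
    filter_upwards [smul_sub_neg_loss_coeFn P z ⟨R h, hmem⟩, hR h] with v h1 h2
    rw [h1, h2, mul_inv_cancel_left₀ (hne v)]
  · refine Lp.ext ?_
    filter_upwards [smul_sub_neg_loss_coeFn P z f, hR (z • (f : H P) - (-lossOperator P) f)]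
      with v h1 h2
    rw [h2, h1, inv_mul_cancel_left₀ (hne v)]

/-- Normalised indicators of disjoint shells shrinking to a point `v₀` with `σ(v₀) = -x` form a
Weyl sequence of `-L⁻`. -/
theorem hasWeylSequence_neg_loss {x : ℝ} (hx : x ≤ -nuZero P) :
    HasWeylSequence (-lossOperator P) (x : ℂ) := by
  obtain ⟨v₀, hv₀⟩ := exists_collisionFreq_eq P (x := -x) (by linarith)
  obtain ⟨C, hC, hlip⟩ := exists_collisionFreq_lipschitz P
  let ρ : ℕ → ℝ := fun n => 1 / ((n : ℝ) + 1)
  have hρ : ∀ n, 0 < ρ n := fun n => by positivity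
  have hρanti : StrictAnti ρ := strictAnti_nat_of_succ_lt fun n => by
    simp only [ρ]
    push_cast
    gcongr
    linarith
  let A : ℕ → Set Vel := fun n => Metric.ball v₀ (ρ n) \ Metric.closedBall v₀ (ρ (n + 1))
  have hAopen : ∀ n, IsOpen (A n) := fun n => Metric.isOpen_ball.sdiff Metric.isClosed_closedBall
  have hAne : ∀ n, (A n).Nonempty := by
    intro n
    obtain ⟨r, hr1, hr2⟩ := exists_between (hρanti (Nat.lt_succ_self n))
    have hr0 : 0 < r := (hρ _).trans hr1
    obtain ⟨w, hw⟩ := (NormedSpace.sphere_nonempty (x := v₀) (r := r)).2 hr0.le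
    rw [Metric.mem_sphere] at hw
    exact ⟨w, by rw [Metric.mem_ball, hw]; exact hr2, by
      rw [Metric.mem_closedBall, hw, not_le]; exact hr1⟩
  have hAmeas : ∀ n, MeasurableSet (A n) := fun n => (hAopen n).measurableSet
  have hAfin : ∀ n, weight P (A n) ≠ ∞ := fun n => by
    refine ne_top_of_le_ne_top (isCompact_closedBall v₀ (ρ n)).measure_lt_top.ne
      (measure_mono fun w hw => Metric.ball_subset_closedBall hw.1)
  have hApos : ∀ n, 0 < (weight P).real (A n) := fun n =>
    ENNReal.toReal_pos ((hAopen n).measure_pos _ (hAne n)).ne' (hAfin n)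
  have hdisj : ∀ i j, i < j → Disjoint (A i) (A j) := by
    intro i j hij
    rw [Set.disjoint_left]
    rintro w ⟨-, h1⟩ ⟨h2, -⟩
    rw [Metric.mem_closedBall, not_le] at h1
    rw [Metric.mem_ball] at h2
    have : ρ j ≤ ρ (i + 1) := hρanti.antitone hij
    linarith
  let c : ℕ → ℝ := fun n => (√((weight P).real (A n)))⁻¹
  let e : ℕ → H P := fun n => indicatorConstLp 2 (hAmeas n) (hAfin n) (c n : ℂ)
  have he : ∀ n, e n =ᵐ[weight P] (A n).indicator fun _ => (c n : ℂ) := fun n =>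
    indicatorConstLp_coeFn
  have hon : Orthonormal ℂ e := by
    refine ⟨fun n => ?_, fun i j hij => ?_⟩
    · rw [norm_indicatorConstLp (by norm_num) (by norm_num), Complex.norm_real]
      have := hApos n
      rw [Real.norm_of_nonneg (by positivity)]
      simp only [ENNReal.toReal_ofNat, ← Real.sqrt_eq_rpow, c]
      exact inv_mul_cancel₀ (by positivity)
    · change inner ℂ (indicatorConstLp 2 (hAmeas i) (hAfin i) (c i : ℂ))
        (indicatorConstLp 2 (hAmeas j) (hAfin j) (c j : ℂ)) = 0
      rw [L2.inner_indicatorConstLp_indicatorConstLp _ _ (hAfin i) (hAfin j)]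
      have : A i ∩ A j = ∅ := by
        rw [← Set.disjoint_iff_inter_eq_empty]
        rcases lt_or_gt_of_ne hij with h | h
        · exact hdisj i j h
        · exact (hdisj j i h).symm
      simp [this]
  have hclose : ∀ n, ∀ v ∈ A n, |collisionFreq P v - collisionFreq P v₀| ≤ C * ρ n := by
    intro n v hv
    refine (hlip v v₀).trans ?_
    gcongr
    have := hv.1
    rw [Metric.mem_ball, dist_eq_norm] at this
    exact this.le
  have hmem : ∀ n, e n ∈ (-lossOperator P).domain := by
    intro n
    change MemLp (lossFun P (e n)) 2 (weight P)
    refine (Lp.memLp (e n)).of_le_mul (c := |collisionFreq P v₀| + C * ρ n)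
      (aestronglyMeasurable_lossFun P (e n)) ?_
    filter_upwards [he n] with v hv
    by_cases hvA : v ∈ A n
    · rw [lossFun, norm_mul, Complex.norm_real, Real.norm_eq_abs]
      gcongr
      have h1 := hclose n v hvA
      have h2 := abs_sub_abs_le_abs_sub (collisionFreq P v) (collisionFreq P v₀)
      linarith
    · simp [lossFun, hv, hvA]
  refine ⟨fun n => ⟨e n, hmem n⟩, hon, ?_⟩
  rw [tendsto_zero_iff_norm_tendsto_zero]
  have hlim : Tendsto (fun n => C * ρ n) atTop (𝓝 0) := by
    simpa only [mul_zero] using (tendsto_one_div_add_atTop_nhds_zero_nat (𝕜 := ℝ)).const_mul C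
  refine squeeze_zero (fun _ => norm_nonneg _) (fun n => ?_) hlim
  have h1 : ‖(x : ℂ) • e n - (-lossOperator P) ⟨e n, hmem n⟩‖ ≤ C * ρ n * ‖e n‖ := by
    refine Lp.norm_le_mul_norm_of_ae_le_mul ?_
    filter_upwards [smul_sub_neg_loss_coeFn P x ⟨e n, hmem n⟩, he n] with v h1 h2
    rw [h1, norm_mul]
    by_cases hvA : v ∈ A n
    · gcongr
      rw [← Complex.ofReal_add, Complex.norm_real, Real.norm_eq_abs, add_comm,
        show x = -collisionFreq P v₀ by linarith, ← sub_eq_add_neg]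
      exact hclose n v hvA
    · simp [h2, hvA]
  rwa [hon.1 n, mul_one] at h1

theorem opSpectrum_neg_loss :
    opSpectrum (-lossOperator P) = Complex.ofReal '' Set.Iic (-nuZero P) := by
  refine (opSpectrum_neg_loss_subset P).antisymm ?_
  rintro _ ⟨x, hx, rfl⟩
  exact (hasWeylSequence_neg_loss P hx).mem_opSpectrum

end LossOperator

/-! ### Integration over lines and planes in velocity space -/

section ChangeOfVariables

open scoped ENNReal

theorem lintegral_comp_smul_eq {E : Type*} [NormedAddCommGroup E] [NormedSpace ℝ E]
    [MeasurableSpace E] [BorelSpace E] [FiniteDimensional ℝ E] (μ : Measure E)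
    [μ.IsAddHaarMeasure] {f : E → ℝ≥0∞} (hf : Measurable f) {r : ℝ} (hr : r ≠ 0) :
    ∫⁻ x, f (r • x) ∂μ = ENNReal.ofReal |(r ^ Module.finrank ℝ E)⁻¹| * ∫⁻ x, f x ∂μ := by
  rw [← lintegral_map hf (measurable_const_smul r), Measure.map_addHaar_smul μ hr,
    lintegral_smul_measure, smul_eq_mul]

/-- Integration in polar coordinates. -/
theorem lintegral_eq_lintegral_toSphere {E : Type*} [NormedAddCommGroup E] [NormedSpace ℝ E]
    [MeasurableSpace E] [BorelSpace E] [FiniteDimensional ℝ E] (μ : Measure E)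
    [μ.IsAddHaarMeasure] [Nontrivial E] {f : E → ℝ≥0∞} (hf : Measurable f) :
    ∫⁻ y, f y ∂μ = ∫⁻ n : Metric.sphere (0 : E) 1, (∫⁻ s in Set.Ioi (0 : ℝ),
      ENNReal.ofReal (s ^ (Module.finrank ℝ E - 1)) * f (s • (n : E))) ∂μ.toSphere := by
  have hm : Measurable fun p : Metric.sphere (0 : E) 1 × Set.Ioi (0 : ℝ) =>
      f (p.2.1 • (p.1 : E)) := hf.comp (by fun_prop)
  calc ∫⁻ y, f y ∂μ = ∫⁻ y : ({0}ᶜ : Set E), f y ∂(μ.comap (↑)) := by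
        rw [lintegral_subtype_comap (measurableSet_singleton _).compl f, restrict_compl_singleton]
    _ = ∫⁻ p : Metric.sphere (0 : E) 1 × Set.Ioi (0 : ℝ), f (p.2.1 • (p.1 : E))
          ∂(μ.toSphere.prod (Measure.volumeIoiPow (Module.finrank ℝ E - 1))) := by
        refine Eq.trans ?_ (μ.measurePreserving_homeomorphUnitSphereProd.lintegral_comp hm)
        refine lintegral_congr fun y => ?_
        congr 1
        have h3 := congrArg Subtype.val ((homeomorphUnitSphereProd E).symm_apply_apply y)
        simpa only [homeomorphUnitSphereProd_symm_apply_coe] using h3.symm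
    _ = _ := by
        rw [lintegral_prod _ hm.aemeasurable]
        refine lintegral_congr fun n => ?_
        have hmn : Measurable fun s : Set.Ioi (0 : ℝ) => f (s.1 • (n : E)) :=
          hm.comp measurable_prodMk_left
        rw [Measure.volumeIoiPow, lintegral_withDensity_eq_lintegral_mul _ (by fun_prop) hmn]
        exact lintegral_subtype_comap measurableSet_Ioi
          (fun s : ℝ => ENNReal.ofReal (s ^ (Module.finrank ℝ E - 1)) * f (s • (n : E)))

/-- Polar coordinates in `ℝ³`, with one power of the radial density `s²` moved into the integrand.
-/
theorem lintegral_sphere_Ioi {Φ : Vel → ℝ≥0∞} (hΦ : Measurable Φ) :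
    ∫⁻ n : S2, (∫⁻ s in Set.Ioi (0 : ℝ), ENNReal.ofReal s * Φ (s • (n : Vel))) ∂surface =
      ∫⁻ y : Vel, ENNReal.ofReal ‖y‖⁻¹ * Φ y := by
  have hdim : Module.finrank ℝ Vel - 1 = 2 := by simp
  have hf : Measurable fun y : Vel => ENNReal.ofReal ‖y‖⁻¹ * Φ y := by fun_prop
  rw [lintegral_eq_lintegral_toSphere volume hf, hdim]
  refine lintegral_congr fun n => setLIntegral_congr_fun measurableSet_Ioi fun s hs => ?_
  have hs : 0 < s := hs
  simp only [norm_smul, norm_sphere, mul_one, Real.norm_of_nonneg hs.le]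
  rw [← mul_assoc, ← ENNReal.ofReal_mul (by positivity)]
  congr 2
  field_simp

/-- Integration in polar coordinates over full lines; each point of `ℝ³` is met twice. -/
theorem lintegral_sphere_line {Φ : Vel → ℝ≥0∞} (hΦ : Measurable Φ) :
    ∫⁻ n : S2, (∫⁻ s : ℝ, ENNReal.ofReal |s| * Φ (s • (n : Vel))) ∂surface =
      2 * ∫⁻ y : Vel, ENNReal.ofReal ‖y‖⁻¹ * Φ y := by
  have hpos : ∀ Ψ : Vel → ℝ≥0∞, ∀ n : S2,
      ∫⁻ s in Set.Ioi (0 : ℝ), ENNReal.ofReal |s| * Ψ (s • (n : Vel)) =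
      ∫⁻ s in Set.Ioi (0 : ℝ), ENNReal.ofReal s * Ψ (s • (n : Vel)) := fun Ψ n =>
    setLIntegral_congr_fun measurableSet_Ioi fun s hs => by
      simp only [abs_of_pos (Set.mem_Ioi.1 hs)]
  have hsplit : ∀ n : S2, ∫⁻ s : ℝ, ENNReal.ofReal |s| * Φ (s • (n : Vel)) =
      (∫⁻ s in Set.Ioi (0 : ℝ), ENNReal.ofReal s * Φ (s • (n : Vel))) +
      ∫⁻ s in Set.Ioi (0 : ℝ), ENNReal.ofReal s * Φ (-(s • (n : Vel))) := by
    intro n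
    rw [← lintegral_add_compl _ (measurableSet_Ioi (a := (0 : ℝ))), hpos Φ, Set.compl_Ioi]
    congr 1
    rw [← hpos (fun y => Φ (-y)), ← lintegral_indicator measurableSet_Iic,
      ← lintegral_neg_eq_self, ← lintegral_indicator measurableSet_Ioi]
    have h0 : ∀ᵐ s : ℝ, s ≠ 0 := by simp [ae_iff]
    refine lintegral_congr_ae ?_
    filter_upwards [h0] with s hs
    by_cases h : 0 < s
    · simp [Set.indicator, h, h.le]
    · have : s < 0 := lt_of_le_of_ne (not_lt.1 h) hs
      simp [Set.indicator, h, this]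
  have hm : Measurable fun p : S2 × ℝ => ENNReal.ofReal p.2 * Φ (p.2 • (p.1 : Vel)) :=
    (by fun_prop : Measurable fun p : S2 × ℝ => ENNReal.ofReal p.2).mul (hΦ.comp (by fun_prop))
  simp only [hsplit]
  rw [lintegral_add_left hm.lintegral_prod_right', lintegral_sphere_Ioi hΦ,
    lintegral_sphere_Ioi (Φ := fun y => Φ (-y)) (by fun_prop), two_mul]
  congr 1
  rw [← lintegral_neg_eq_self]
  simp

/-- The integral of a planar Gaussian. -/
theorem lintegral_gaussian_plane {c : ℝ} (hc : 0 < c) (x₁ x₂ : ℝ) :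
    ∫⁻ z : Fin 2 → ℝ, ENNReal.ofReal (Real.exp (-c * ((x₁ - z 0) ^ 2 + (x₂ - z 1) ^ 2))) =
      ENNReal.ofReal (Real.pi / c) := by
  have h1 : ∀ z : Fin 2 → ℝ, Real.exp (-c * ((x₁ - z 0) ^ 2 + (x₂ - z 1) ^ 2)) =
      ∏ i, Real.exp (-c * (z i - ![x₁, x₂] i) ^ 2) := by
    intro z
    simp only [Fin.prod_univ_two, ← Real.exp_add, Matrix.cons_val_zero, Matrix.cons_val_one]
    congr 1
    ring
  have hint : ∀ i : Fin 2, Integrable fun t : ℝ => Real.exp (-c * (t - ![x₁, x₂] i) ^ 2) :=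
    fun i => (integrable_exp_neg_mul_sq hc).comp_sub_right _
  have hval : ∀ x : ℝ, ∫ t : ℝ, Real.exp (-c * (t - x) ^ 2) = √(Real.pi / c) := fun x => by
    rw [integral_sub_right_eq_self (fun t => Real.exp (-c * t ^ 2)) x, integral_gaussian]
  simp only [h1]
  rw [← ofReal_integral_eq_lintegral_ofReal (by rw [volume_pi]; exact Integrable.fintype_prod hint)
    (Eventually.of_forall fun z => Finset.prod_nonneg fun i _ => (Real.exp_pos _).le),
    integral_fintype_prod_volume_eq_prod (f := fun i t => Real.exp (-c * (t - ![x₁, x₂] i) ^ 2))]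
  congr 1
  simp only [hval, Fin.prod_univ_two]
  exact Real.mul_self_sqrt (by positivity)

theorem exists_linearIsometryEquiv_apply {x y : Vel} (h : ‖x‖ = ‖y‖) :
    ∃ O : Vel ≃ₗᵢ[ℝ] Vel, O x = y :=
  ⟨(ℝ ∙ (x - y))ᗮ.reflection, Submodule.reflection_sub h⟩

/-- Integrating out the directions orthogonal to the unit vector `n`. -/
theorem lintegral_slice {c : ℝ} (hc : 0 < c) (b : ℝ) (u : Vel) (n : S2) {h : ℝ → ℝ≥0∞}
    (hh : Measurable h) :
    ∫⁻ q : Vel, h (inner ℝ q (n : Vel)) * ENNReal.ofReal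
        (Real.exp (-c * ‖u - q + (b * inner ℝ q (n : Vel)) • (n : Vel)‖ ^ 2)) =
      ENNReal.ofReal (Real.pi / c) * ∫⁻ s : ℝ, h s *
        ENNReal.ofReal (Real.exp (-c * (inner ℝ u (n : Vel) + (b - 1) * s) ^ 2)) := by
  -- An isometry reduces to the case that `n` is the first coordinate vector.
  obtain ⟨O, hO⟩ := exists_linearIsometryEquiv_apply
    (x := EuclideanSpace.single (0 : Fin 3) (1 : ℝ)) (y := (n : Vel)) (by simp)
  set x : Vel := O.symm u with hx
  have hOx : O x = u := by simp [x]
  have hin : ∀ y : Vel, inner ℝ (O y) (n : Vel) = y 0 := fun y => by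
    rw [← hO, O.inner_map_map, EuclideanSpace.inner_single_right]; simp
  have hxn : inner ℝ u (n : Vel) = x 0 := by rw [← hOx, hin]
  have hnorm : ∀ y : Vel, ‖u - O y + (b * y 0) • (n : Vel)‖ ^ 2 =
      (x 0 + (b - 1) * y 0) ^ 2 + ((x 1 - y 1) ^ 2 + (x 2 - y 2) ^ 2) := by
    intro y
    rw [← hO, ← hOx, ← map_sub, ← map_smul, ← map_add, O.norm_map,
      EuclideanSpace.real_norm_sq_eq, Fin.sum_univ_three]
    simp
    ring
  have hmeas : Measurable fun y : Fin 3 → ℝ => h (y 0) * ENNReal.ofReal (Real.exp (-c *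
      ((x 0 + (b - 1) * y 0) ^ 2 + ((x 1 - y 1) ^ 2 + (x 2 - y 2) ^ 2)))) := by fun_prop
  rw [← O.measurePreserving.lintegral_comp_emb O.toHomeomorph.measurableEmbedding]
  simp only [hin, hxn, hnorm]
  rw [(PiLp.volume_preserving_ofLp (Fin 3)).lintegral_comp hmeas,
    ← (volume_preserving_piFinSuccAbove (fun _ : Fin 3 => ℝ) 0).symm.lintegral_comp hmeas,
    Measure.volume_eq_prod]
  refine (lintegral_prod _ ?_).trans ?_
  · exact (hmeas.comp (MeasurableEquiv.measurable _)).aemeasurable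
  rw [← lintegral_const_mul _ (by fun_prop)]
  refine lintegral_congr fun s => ?_
  have : ∀ z : Fin 2 → ℝ, ((MeasurableEquiv.piFinSuccAbove (fun _ : Fin 3 => ℝ) 0).symm (s, z)) =
      Fin.cons s z := fun z => by
    simp [MeasurableEquiv.piFinSuccAbove, Fin.insertNthEquiv]
  simp only [this, Fin.cons_zero]
  have hsplit : ∀ z : Fin 2 → ℝ, Real.exp (-c * ((x 0 + (b - 1) * s) ^ 2 +
      ((x 1 - (Fin.cons s z : Fin 3 → ℝ) 1) ^ 2 + (x 2 - (Fin.cons s z : Fin 3 → ℝ) 2) ^ 2))) =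
      Real.exp (-c * (x 0 + (b - 1) * s) ^ 2) *
        Real.exp (-c * ((x 1 - z 0) ^ 2 + (x 2 - z 1) ^ 2)) := by
    intro z
    rw [← Real.exp_add, mul_add]
    rfl
  simp only [hsplit, ENNReal.ofReal_mul (Real.exp_pos _).le]
  simp only [← mul_assoc]
  rw [lintegral_const_mul _ (by fun_prop), lintegral_gaussian_plane hc]
  ring

end ChangeOfVariables

/-! ### The integral kernel of the gain term -/

section Kernel

open scoped ENNReal

variable (P : Params)

namespace Params

/-- The coefficient `2α(1-β)/(1-2β)` in `v⋆ = v - a (q · n) n`. -/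
noncomputable def a : ℝ := 2 * P.α * ((1 - P.β) / (1 - 2 * P.β))

/-- The coefficient `2(1-α)(1-β)/(1-2β)` in `w⋆ = w + b (q · n) n`. -/
noncomputable def b : ℝ := 2 * (1 - P.α) * ((1 - P.β) / (1 - 2 * P.β))

/-- The rate `c = m₁/(2ϑ₁)` in `M₁(v) ∝ exp(-c |v - u₁|²)`. -/
noncomputable def c : ℝ := P.m₁ / (2 * P.ϑ₁)

/-- The rate `μ = m/(2ϑ#)` in `M(v) ∝ exp(-μ |v - u₁|²)`. -/
noncomputable def μ : ℝ := P.m / (2 * P.ϑeq)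

/-- The coefficient `κ` in the exponent `-c κ² |v - v'|²` of the symmetrised kernel. -/
noncomputable def κ : ℝ := 1 / 2 + (P.b - 1) / P.a

/-- The normalisation of `M₁`. -/
noncomputable def N₁ : ℝ := (P.m₁ / (2 * Real.pi * P.ϑ₁)) ^ (3 / 2 : ℝ)

/-- The normalisation of `M`. -/
noncomputable def N : ℝ := (P.m / (2 * Real.pi * P.ϑeq)) ^ (3 / 2 : ℝ)

theorem c_pos : 0 < P.c := by
  have := P.m₁_pos
  have := P.ϑ₁_pos
  unfold c; positivity

theorem μ_pos : 0 < P.μ := by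
  have := P.m_pos
  have := P.ϑeq_pos
  unfold μ; positivity

theorem N₁_pos : 0 < P.N₁ := by
  have := P.m₁_pos
  have := P.ϑ₁_pos
  unfold N₁; positivity

theorem N_pos : 0 < P.N := by
  have := P.m_pos
  have := P.ϑeq_pos
  unfold N; positivity

theorem α_pos : 0 < P.α := by
  have := P.m_pos
  have := P.m₁_pos
  unfold α; positivity

theorem α_lt_one : P.α < 1 := by
  have := P.m_pos
  have := P.m₁_pos
  unfold α
  rw [div_lt_one (by positivity)]
  linarith

theorem a_eq : P.a = P.α * (1 + P.ε) / P.ε := by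
  have := P.ε_pos
  have h1 : 1 - 2 * P.β = P.ε := by unfold β; ring
  have h2 : 1 - P.β = (1 + P.ε) / 2 := by unfold β; ring
  rw [a, h1, h2]
  ring

theorem b_eq : P.b = 1 + 1 / P.ε - P.a := by
  have := P.ε_pos
  have h1 : 1 - 2 * P.β = P.ε := by unfold β; ring
  have h2 : 1 - P.β = (1 + P.ε) / 2 := by unfold β; ring
  rw [a_eq, b, h1, h2]
  field_simp
  ring

theorem a_pos : 0 < P.a := by
  have := P.ε_pos
  have := P.α_pos
  rw [a_eq]; positivity

theorem κ_eq : P.κ = 1 / (P.ε * P.a) - 1 / 2 := by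
  have := P.ε_pos
  have := P.a_pos
  rw [κ, b_eq]
  field_simp
  ring

/-- Positivity of `κ`, which makes the symmetrised kernel decay in the relative velocity. -/
theorem κ_pos : 0 < P.κ := by
  have h1 := P.ε_pos
  have h2 := P.ε_lt_one
  have h3 := P.α_pos
  have h4 := P.α_lt_one
  have h5 : P.ε * P.a = P.α * (1 + P.ε) := by rw [a_eq]; field_simp
  rw [κ_eq, h5, sub_pos, div_lt_div_iff₀ (by norm_num) (by positivity)]
  nlinarith

/-- The relation between the two temperatures that makes `M` the equilibrium state. -/
theorem μ_eq : P.μ = 2 * P.c * P.κ := by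
  have h1 := P.ε_pos
  have h2 := P.ε_lt_one
  have h3 := P.m_pos
  have h4 := P.m₁_pos
  have h5 := P.ϑ₁_pos
  have hα : P.α = P.m₁ / (P.m + P.m₁) := rfl
  have h6 : 1 - P.β = (1 + P.ε) / 2 := by unfold β; ring
  have h8 : 1 - P.α * (1 - P.β) = (2 * P.m + P.m₁ * (1 - P.ε)) / (2 * (P.m + P.m₁)) := by
    rw [h6, hα]; field_simp; ring
  have h9 : 0 < 2 * P.m + P.m₁ * (1 - P.ε) := by nlinarith
  have h10 : 1 - P.α = P.m / (P.m + P.m₁) := by rw [hα]; field_simp; ring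
  rw [μ, ϑeq, h8, h10, h6, κ_eq, a_eq, hα, c]
  field_simp
  ring

end Params

theorem hostMaxwellian_eq (v : Vel) :
    hostMaxwellian P v = P.N₁ * Real.exp (-P.c * ‖v - P.u₁‖ ^ 2) := by
  have := P.ϑ₁_pos
  rw [hostMaxwellian, maxwellian, Params.N₁, Params.c]
  congr 2
  field_simp

theorem eqMaxwellian_eq (v : Vel) :
    eqMaxwellian P v = P.N * Real.exp (-P.μ * ‖v - P.u₁‖ ^ 2) := by
  have := P.ϑeq_pos
  rw [eqMaxwellian, maxwellian, Params.N, Params.μ]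
  congr 2
  field_simp

/-- Integration of a function of `q · n` and `n` against `M₁(w + b (q · n) n)`. -/
theorem lintegral_collision (v : Vel) (b : ℝ) {h : S2 → ℝ → ℝ≥0∞}
    (hh : Measurable (Function.uncurry h)) :
    ∫⁻ p : Vel × S2, h p.2 (inner ℝ (v - p.1) (p.2 : Vel)) * ENNReal.ofReal
        (hostMaxwellian P (p.1 + (b * inner ℝ (v - p.1) (p.2 : Vel)) • (p.2 : Vel)))
        ∂((volume : Measure Vel).prod surface) =
      ENNReal.ofReal (P.N₁ * (Real.pi / P.c)) * ∫⁻ n : S2, (∫⁻ s : ℝ, h n s * ENNReal.ofReal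
        (Real.exp (-P.c * (inner ℝ (v - P.u₁) (n : Vel) + (b - 1) * s) ^ 2))) ∂surface := by
  have hM := measurable_hostMaxwellian P
  have hN := P.N₁_pos
  have hm1 : Measurable fun p : Vel × S2 => h p.2 (inner ℝ (v - p.1) (p.2 : Vel)) :=
    hh.comp (f := fun p : Vel × S2 => (p.2, inner ℝ (v - p.1) (p.2 : Vel))) (by fun_prop)
  have hm2 : Measurable fun p : S2 × ℝ => h p.1 p.2 * ENNReal.ofReal
      (Real.exp (-P.c * (inner ℝ (v - P.u₁) (p.1 : Vel) + (b - 1) * p.2) ^ 2)) :=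
    hh.mul (by fun_prop)
  have hm3 : Measurable fun p : Vel × S2 => h p.2 (inner ℝ (v - p.1) (p.2 : Vel)) *
      ENNReal.ofReal (hostMaxwellian P
        (p.1 + (b * inner ℝ (v - p.1) (p.2 : Vel)) • (p.2 : Vel))) := hm1.mul (by fun_prop)
  rw [lintegral_prod_symm _ hm3.aemeasurable,
    ← lintegral_const_mul _ hm2.lintegral_prod_right']
  refine lintegral_congr fun n => ?_
  have hn : Measurable (h n) := hh.comp measurable_prodMk_left
  rw [ENNReal.ofReal_mul hN.le, mul_assoc, ← lintegral_slice P.c_pos b (v - P.u₁) n hn,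
    ← lintegral_const_mul _ (by fun_prop), ← lintegral_sub_left_eq_self _ v]
  refine lintegral_congr fun q => ?_
  have h1 : v - q + (b * inner ℝ q (n : Vel)) • (n : Vel) - P.u₁ =
      v - P.u₁ - q + (b * inner ℝ q (n : Vel)) • (n : Vel) := by abel
  simp only [sub_sub_cancel, hostMaxwellian_eq, h1, ENNReal.ofReal_mul hN.le]
  ring

/-- The kernel of the gain operator with respect to Lebesgue measure. -/
noncomputable def gainKernel (v v' : Vel) : ℝ :=
  2 / P.ε ^ 2 / P.a ^ 2 * (P.N₁ * (Real.pi / P.c)) * (‖v - v'‖⁻¹ * Real.exp (-P.c *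
    (inner ℝ (v - P.u₁) (v - v') / ‖v - v'‖ + (P.b - 1) / P.a * ‖v - v'‖) ^ 2))

theorem gainKernel_nonneg (v v' : Vel) : 0 ≤ gainKernel P v v' := by
  have := P.N₁_pos
  have := P.c_pos
  unfold gainKernel; positivity

theorem measurable_gainKernel : Measurable (Function.uncurry (gainKernel P)) := by
  unfold gainKernel Function.uncurry; fun_prop

/-- The density `ε⁻² |q · n| M₁(w⋆)` of the gain term. -/
noncomputable def gainDensity (v : Vel) (p : Vel × S2) : ℝ :=
  1 / P.ε ^ 2 * |inner ℝ (v - p.1) (p.2 : Vel)| * hostMaxwellian P (wStar P v p.1 p.2)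

theorem gainDensity_nonneg (v : Vel) (p : Vel × S2) : 0 ≤ gainDensity P v p := by
  have := hostMaxwellian_pos P (wStar P v p.1 p.2)
  unfold gainDensity; positivity

theorem measurable_gainDensity (v : Vel) : Measurable (gainDensity P v) := by
  have := measurable_hostMaxwellian P
  unfold gainDensity wStar; fun_prop

theorem measurable_vStar (v : Vel) : Measurable fun p : Vel × S2 => vStar P v p.1 p.2 := by
  unfold vStar; fun_prop

/-- The gain integral after integrating out the two components of `w` orthogonal to `n`; the
variable `s` is `q · n`. -/
theorem lintegral_gainDensity_slice (v : Vel) {F : Vel → ℝ≥0∞} (hF : Measurable F) :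
    ∫⁻ p : Vel × S2, ENNReal.ofReal (gainDensity P v p) * F (vStar P v p.1 p.2)
        ∂((volume : Measure Vel).prod surface) =
      ENNReal.ofReal (P.N₁ * (Real.pi / P.c)) * ∫⁻ n : S2, (∫⁻ s : ℝ,
        ENNReal.ofReal (1 / P.ε ^ 2 * |s|) * F (v - (P.a * s) • (n : Vel)) * ENNReal.ofReal
        (Real.exp (-P.c * (inner ℝ (v - P.u₁) (n : Vel) + (P.b - 1) * s) ^ 2))) ∂surface := by
  have hε := P.ε_pos
  rw [← lintegral_collision P v P.b (h := fun n s => ENNReal.ofReal (1 / P.ε ^ 2 * |s|) *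
    F (v - (P.a * s) • (n : Vel)))]
  · refine lintegral_congr fun p => ?_
    rw [gainDensity, ENNReal.ofReal_mul (by positivity)]
    simp only [wStar, vStar, Params.a, Params.b]
    ring
  · exact (by fun_prop : Measurable fun z : S2 × ℝ => ENNReal.ofReal (1 / P.ε ^ 2 * |z.2|)).mul
      (hF.comp (by fun_prop))

/-- The gain term is the integral operator with kernel `gainKernel`: the substitution `v' = v - a s
n`, that is polar coordinates over lines, turns the integral over `s` and `n` into one over `v'`.
-/
theorem lintegral_gainDensity (v : Vel) {F : Vel → ℝ≥0∞} (hF : Measurable F) :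
    ∫⁻ p : Vel × S2, ENNReal.ofReal (gainDensity P v p) * F (vStar P v p.1 p.2)
        ∂((volume : Measure Vel).prod surface) =
      ∫⁻ v', ENNReal.ofReal (gainKernel P v v') * F v' := by
  have hε := P.ε_pos
  have ha := P.a_pos
  have hN := P.N₁_pos
  have hc := P.c_pos
  let Φ : Vel → ℝ≥0∞ := fun y => F (v - P.a • y) * ENNReal.ofReal (Real.exp (-P.c *
    (inner ℝ (v - P.u₁) y / ‖y‖ + (P.b - 1) * ‖y‖) ^ 2))
  have hΦ : Measurable Φ := by fun_prop
  let g : Vel → ℝ≥0∞ := fun z => ENNReal.ofReal (‖z‖⁻¹ * Real.exp (-P.c *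
    (inner ℝ (v - P.u₁) z / ‖z‖ + (P.b - 1) / P.a * ‖z‖) ^ 2)) * F (v - z)
  have hg : Measurable g := by fun_prop
  have h1 : ∀ (n : S2) (s : ℝ), ENNReal.ofReal (1 / P.ε ^ 2 * |s|) * F (v - (P.a * s) • (n : Vel)) *
      ENNReal.ofReal (Real.exp (-P.c * (inner ℝ (v - P.u₁) (n : Vel) + (P.b - 1) * s) ^ 2)) =
      ENNReal.ofReal (1 / P.ε ^ 2) * (ENNReal.ofReal |s| * Φ (s • (n : Vel))) := by
    intro n s
    rcases eq_or_ne s 0 with rfl | hs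
    · simp
    have h2 : (inner ℝ (v - P.u₁) (s • (n : Vel)) / ‖s • (n : Vel)‖ +
        (P.b - 1) * ‖s • (n : Vel)‖) ^ 2 =
        (inner ℝ (v - P.u₁) (n : Vel) + (P.b - 1) * s) ^ 2 := by
      rw [norm_smul, norm_sphere, mul_one, real_inner_smul_right, Real.norm_eq_abs]
      rcases abs_cases s with ⟨h, -⟩ | ⟨h, -⟩ <;> rw [h] <;> field_simp
      ring
    simp only [Φ, h2]
    rw [ENNReal.ofReal_mul (by positivity), smul_smul]
    ring
  have hgy : ∀ y, g (P.a • y) = ENNReal.ofReal P.a⁻¹ * (ENNReal.ofReal ‖y‖⁻¹ * Φ y) := by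
    intro y
    have h3 : inner ℝ (v - P.u₁) (P.a • y) / ‖P.a • y‖ + (P.b - 1) / P.a * ‖P.a • y‖ =
        inner ℝ (v - P.u₁) y / ‖y‖ + (P.b - 1) * ‖y‖ := by
      rw [norm_smul, real_inner_smul_right, Real.norm_of_nonneg ha.le, mul_div_mul_left _ _ ha.ne',
        ← mul_assoc, div_mul_cancel₀ _ ha.ne']
    simp only [g, Φ, h3]
    rw [norm_smul, Real.norm_of_nonneg ha.le, mul_inv, ENNReal.ofReal_mul (by positivity),
      ENNReal.ofReal_mul (by positivity)]
    ring
  have hpolar : ∫⁻ y, ENNReal.ofReal ‖y‖⁻¹ * Φ y =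
      ENNReal.ofReal (P.a ^ 2)⁻¹ * ∫⁻ z, g z := by
    have h4 := lintegral_comp_smul_eq (volume : Measure Vel) hg ha.ne'
    simp only [hgy] at h4
    rw [lintegral_const_mul _ (by fun_prop)] at h4
    have h5 : ENNReal.ofReal P.a * ENNReal.ofReal P.a⁻¹ = 1 := by
      rw [← ENNReal.ofReal_mul ha.le, mul_inv_cancel₀ ha.ne', ENNReal.ofReal_one]
    calc _ = ENNReal.ofReal P.a * (ENNReal.ofReal P.a⁻¹ *
          ∫⁻ y, ENNReal.ofReal ‖y‖⁻¹ * Φ y) := by rw [← mul_assoc, h5, one_mul]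
      _ = _ := by
        rw [h4, ← mul_assoc, ← ENNReal.ofReal_mul ha.le]
        congr 2
        rw [finrank_euclideanSpace_fin, abs_of_pos (by positivity)]
        field_simp
  have hmΦ : Measurable fun p : S2 × ℝ => ENNReal.ofReal |p.2| * Φ (p.2 • (p.1 : Vel)) :=
    (by fun_prop : Measurable fun p : S2 × ℝ => ENNReal.ofReal |p.2|).mul (hΦ.comp (by fun_prop))
  have hin : ∀ n : S2, ∫⁻ s : ℝ, ENNReal.ofReal (1 / P.ε ^ 2) *
      (ENNReal.ofReal |s| * Φ (s • (n : Vel))) =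
      ENNReal.ofReal (1 / P.ε ^ 2) * ∫⁻ s : ℝ, ENNReal.ofReal |s| * Φ (s • (n : Vel)) :=
    fun n => lintegral_const_mul _ (hmΦ.comp measurable_prodMk_left)
  have hconst : ∀ I : ℝ≥0∞, ENNReal.ofReal (P.N₁ * (Real.pi / P.c)) *
      (ENNReal.ofReal (1 / P.ε ^ 2) * (2 * (ENNReal.ofReal (P.a ^ 2)⁻¹ * I))) =
      ENNReal.ofReal (P.N₁ * (Real.pi / P.c) * (1 / P.ε ^ 2) * 2 * (P.a ^ 2)⁻¹) * I := by
    intro I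
    rw [ENNReal.ofReal_mul (p := P.N₁ * (Real.pi / P.c) * (1 / P.ε ^ 2) * 2) (by positivity),
      ENNReal.ofReal_mul (p := P.N₁ * (Real.pi / P.c) * (1 / P.ε ^ 2)) (by positivity),
      ENNReal.ofReal_mul (p := P.N₁ * (Real.pi / P.c)) (by positivity), ENNReal.ofReal_ofNat]
    ring
  rw [lintegral_gainDensity_slice P v hF]
  simp only [h1, hin]
  rw [lintegral_const_mul _ hmΦ.lintegral_prod_right', lintegral_sphere_line hΦ, hpolar,
    ← lintegral_sub_left_eq_self g v, hconst, ← lintegral_const_mul _ (by fun_prop)]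
  refine lintegral_congr fun v' => ?_
  simp only [g, sub_sub_cancel]
  rw [← mul_assoc, ← ENNReal.ofReal_mul (by positivity)]
  congr 2
  rw [gainKernel]
  ring

/-- The collision frequency after integrating out the components of `w` orthogonal to `n`. -/
theorem ofReal_collisionFreq (v : Vel) : ENNReal.ofReal (collisionFreq P v) =
    ENNReal.ofReal (P.N₁ * (Real.pi / P.c)) * ∫⁻ n : S2, (∫⁻ s : ℝ, ENNReal.ofReal |s| *
      ENNReal.ofReal (Real.exp (-P.c * (inner ℝ (v - P.u₁) (n : Vel) - s) ^ 2))) ∂surface := by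
  rw [collisionFreq, ofReal_integral_eq_lintegral_ofReal (integrable_lossIntegrand P v)
    (Eventually.of_forall fun p => mul_nonneg (abs_nonneg _) (hostMaxwellian_pos P p.1).le)]
  have h := lintegral_collision P v 0 (h := fun _ s => ENNReal.ofReal |s|) (by
    unfold Function.uncurry; fun_prop)
  simp only [zero_mul, zero_smul, add_zero, zero_sub, neg_mul, one_mul, ← sub_eq_add_neg] at h
  simp only [neg_mul]
  rw [← h]
  exact lintegral_congr fun p => ENNReal.ofReal_mul (abs_nonneg _)

/-- The Maxwellian `M` is an equilibrium: its gain term equals `σ M`. The product of Gaussians in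
the gain term is `M v` times the Gaussian of the collision frequency at `s / ε`. -/
theorem lintegral_gainKernel_eqMaxwellian (v : Vel) :
    ∫⁻ v', ENNReal.ofReal (gainKernel P v v') * ENNReal.ofReal (eqMaxwellian P v') =
      ENNReal.ofReal (collisionFreq P v) * ENNReal.ofReal (eqMaxwellian P v) := by
  have hε := P.ε_pos
  have ha := P.a_pos
  have hN := P.N_pos
  have hM := measurable_eqMaxwellian P
  rw [← lintegral_gainDensity P v (F := fun v' => ENNReal.ofReal (eqMaxwellian P v'))
    (by fun_prop), lintegral_gainDensity_slice P v
    (F := fun v' => ENNReal.ofReal (eqMaxwellian P v')) (by fun_prop), ofReal_collisionFreq,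
    mul_assoc]
  congr 1
  have hm : Measurable fun p : S2 × ℝ => ENNReal.ofReal |p.2| *
      ENNReal.ofReal (Real.exp (-P.c * (inner ℝ (v - P.u₁) (p.1 : Vel) - p.2) ^ 2)) := by
    fun_prop
  rw [← lintegral_mul_const _ hm.lintegral_prod_right']
  refine lintegral_congr fun n => ?_
  set x := inner ℝ (v - P.u₁) (n : Vel) with hx
  let f : ℝ → ℝ≥0∞ := fun t => ENNReal.ofReal |t| * ENNReal.ofReal (Real.exp (-P.c * (x - t) ^ 2))
  have hf : Measurable f := by fun_prop
  have key : ∀ s : ℝ, ENNReal.ofReal (1 / P.ε ^ 2 * |s|) *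
      ENNReal.ofReal (eqMaxwellian P (v - (P.a * s) • (n : Vel))) *
      ENNReal.ofReal (Real.exp (-P.c * (x + (P.b - 1) * s) ^ 2)) =
      ENNReal.ofReal P.ε⁻¹ * ENNReal.ofReal (eqMaxwellian P v) * f (P.ε⁻¹ • s) := by
    intro s
    have hnorm : ‖v - (P.a * s) • (n : Vel) - P.u₁‖ ^ 2 =
        ‖v - P.u₁‖ ^ 2 - 2 * (P.a * s) * x + (P.a * s) ^ 2 := by
      rw [sub_right_comm, norm_sub_sq_real, norm_smul, norm_sphere, real_inner_smul_right, ← hx,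
        mul_one, Real.norm_eq_abs, sq_abs]
      ring
    have hexp : Real.exp (-P.μ * ‖v - (P.a * s) • (n : Vel) - P.u₁‖ ^ 2) *
        Real.exp (-P.c * (x + (P.b - 1) * s) ^ 2) =
        Real.exp (-P.μ * ‖v - P.u₁‖ ^ 2) * Real.exp (-P.c * (x - P.ε⁻¹ * s) ^ 2) := by
      rw [← Real.exp_add, ← Real.exp_add, hnorm, P.μ_eq, P.κ_eq, P.b_eq]
      congr 1
      field_simp
      ring
    simp only [f, smul_eq_mul, eqMaxwellian_eq]
    simp only [← ENNReal.ofReal_mul' (Real.exp_pos _).le,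
      ← ENNReal.ofReal_mul' (mul_nonneg hN.le (Real.exp_pos _).le),
      ← ENNReal.ofReal_mul' (mul_nonneg (abs_nonneg _) (Real.exp_pos _).le)]
    congr 1
    rw [abs_mul, abs_of_pos (inv_pos.2 hε)]
    calc _ = 1 / P.ε ^ 2 * |s| * P.N * (Real.exp (-P.μ * ‖v - (P.a * s) • (n : Vel) - P.u₁‖ ^ 2) *
        Real.exp (-P.c * (x + (P.b - 1) * s) ^ 2)) := by ring
      _ = _ := by rw [hexp]; field_simp
  simp only [key]
  rw [lintegral_const_mul _ (by fun_prop),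
    lintegral_comp_smul_eq (volume : Measure ℝ) hf (inv_ne_zero hε.ne')]
  have h1 : ENNReal.ofReal P.ε⁻¹ * ENNReal.ofReal |(P.ε⁻¹ ^ Module.finrank ℝ ℝ)⁻¹| = 1 := by
    rw [Module.finrank_self, pow_one, inv_inv, abs_of_pos hε,
      ← ENNReal.ofReal_mul (by positivity), inv_mul_cancel₀ hε.ne', ENNReal.ofReal_one]
  calc _ = (ENNReal.ofReal P.ε⁻¹ * ENNReal.ofReal |(P.ε⁻¹ ^ Module.finrank ℝ ℝ)⁻¹|) *
        ((∫⁻ t, f t) * ENNReal.ofReal (eqMaxwellian P v)) := by ring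
    _ = _ := by rw [h1, one_mul]

end Kernel

/-! ### The symmetrised kernel -/

section SymmetricKernel

open scoped ENNReal NNReal

/-- Powers `|y|⁻¹` and `|y|⁻²` are locally integrable in `ℝ³`. -/
theorem lintegral_inv_norm_pow_mul_exp_lt_top {k : ℕ} (hk : k ≤ 2) {d : ℝ} (hd : 0 < d) :
    ∫⁻ y : Vel, ENNReal.ofReal (‖y‖⁻¹ ^ k * Real.exp (-d * ‖y‖ ^ 2)) < ∞ := by
  have h : Integrable fun y : Vel => ‖y‖⁻¹ ^ k * Real.exp (-d * ‖y‖ ^ 2) := by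
    refine (integrable_fun_norm_addHaar (volume : Measure Vel)
      (f := fun r => r⁻¹ ^ k * Real.exp (-d * r ^ 2))).2 ?_
    have h1 := integrableOn_rpow_mul_exp_neg_mul_sq hd (s := (2 - k : ℕ))
      (by linarith [(Nat.cast_nonneg (2 - k) : (0 : ℝ) ≤ (2 - k : ℕ))])
    refine h1.congr_fun (fun r hr => ?_) measurableSet_Ioi
    have hr : 0 < r := hr
    simp only [finrank_euclideanSpace_fin, smul_eq_mul, Real.rpow_natCast]
    rw [← mul_assoc]
    congr 1
    rw [inv_pow, ← div_eq_mul_inv, pow_sub₀ _ hr.ne' hk]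
    rfl
  refine (lintegral_mono fun y => ?_).trans_lt h.2
  rw [← ofReal_norm]
  exact ENNReal.ofReal_le_ofReal (le_abs_self _)

variable (P : Params)

/-- The profile of the symmetrised kernel as a function of `x = v - u₁` and `y = v - v'`. -/
noncomputable def profile (x y : Vel) : ℝ :=
  ‖y‖⁻¹ * Real.exp (-P.c * ((inner ℝ x y / ‖y‖ - ‖y‖ / 2) ^ 2 + P.κ ^ 2 * ‖y‖ ^ 2))

theorem profile_nonneg (x y : Vel) : 0 ≤ profile P x y := by unfold profile; positivity

theorem measurable_profile : Measurable (Function.uncurry (profile P)) := by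
  unfold profile Function.uncurry; fun_prop

theorem profile_le (x y : Vel) :
    profile P x y ≤ ‖y‖⁻¹ * Real.exp (-(P.c * P.κ ^ 2) * ‖y‖ ^ 2) := by
  have := P.c_pos
  refine mul_le_mul_of_nonneg_left (Real.exp_le_exp.2 ?_) (by positivity)
  nlinarith [mul_nonneg P.c_pos.le (sq_nonneg (inner ℝ x y / ‖y‖ - ‖y‖ / 2))]

theorem lintegral_profile_lt_top : ∫⁻ y : Vel,
    ENNReal.ofReal (‖y‖⁻¹ * Real.exp (-(P.c * P.κ ^ 2) * ‖y‖ ^ 2)) < ∞ := by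
  have := P.c_pos
  have := P.κ_pos
  simpa using lintegral_inv_norm_pow_mul_exp_lt_top (k := 1) (by norm_num)
    (d := P.c * P.κ ^ 2) (by positivity)

/-- The integral of the profile depends on `x` only through `|x|`. -/
theorem lintegral_profile_congr {x x' : Vel} (h : ‖x‖ = ‖x'‖) :
    ∫⁻ y, ENNReal.ofReal (profile P x y) = ∫⁻ y, ENNReal.ofReal (profile P x' y) := by
  obtain ⟨O, rfl⟩ := exists_linearIsometryEquiv_apply h
  rw [← O.measurePreserving.lintegral_comp_emb O.toHomeomorph.measurableEmbedding
    (fun y => ENNReal.ofReal (profile P (O x) y))]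
  simp only [profile, O.norm_map, O.inner_map_map]

/-- The Schur integrals of the symmetrised kernel vanish at infinity. By rotation invariance it
suffices to go to infinity along a ray `t e`, where the integrand tends to zero off the plane
orthogonal to `e`. -/
theorem tendsto_lintegral_profile (e : Vel) (he : ‖e‖ = 1) :
    Tendsto (fun t : ℝ => ∫⁻ y, ENNReal.ofReal (profile P (t • e) y)) atTop (𝓝 0) := by
  have hc := P.c_pos
  have hm := measurable_profile P
  have key := tendsto_lintegral_filter_of_dominated_convergence (l := atTop)
    (μ := (volume : Measure Vel))
    (F := fun t : ℝ => fun y => ENNReal.ofReal (profile P (t • e) y)) (f := fun _ => 0)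
    (fun y : Vel => ENNReal.ofReal (‖y‖⁻¹ * Real.exp (-(P.c * P.κ ^ 2) * ‖y‖ ^ 2)))
    (Eventually.of_forall fun t => (hm.comp measurable_prodMk_left).ennreal_ofReal)
    (Eventually.of_forall fun t => Eventually.of_forall fun y =>
      ENNReal.ofReal_le_ofReal (profile_le P _ _))
    (lintegral_profile_lt_top P).ne ?_
  · simpa using key
  have hae : ∀ᵐ y : Vel, inner ℝ e y ≠ 0 := by
    have hne : (innerSL ℝ e).toLinearMap.ker ≠ ⊤ := fun h => by
      have : e ∈ (innerSL ℝ e).toLinearMap.ker := h ▸ Submodule.mem_top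
      simp [he] at this
    have h0 := Measure.addHaar_submodule (volume : Measure Vel) _ hne
    rw [ae_iff]
    convert h0 using 2
    ext y
    simp
  filter_upwards [hae] with y hy
  have hy0 : 0 < ‖y‖ := norm_pos_iff.2 fun h => hy (by simp [h])
  rw [← ENNReal.ofReal_zero]
  refine ENNReal.tendsto_ofReal ?_
  rw [← mul_zero ‖y‖⁻¹]
  refine Tendsto.const_mul _ (Real.tendsto_exp_atBot.comp ?_)
  simp only [neg_mul]
  refine tendsto_neg_atTop_atBot.comp (Tendsto.const_mul_atTop hc
    (tendsto_atTop_add_const_right _ _ ?_))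
  have h1 : Tendsto (fun t : ℝ => |t * (inner ℝ e y / ‖y‖) - ‖y‖ / 2|) atTop atTop := by
    have h2 : inner ℝ e y / ‖y‖ ≠ 0 := div_ne_zero hy hy0.ne'
    rcases lt_or_gt_of_ne h2 with h | h
    · exact tendsto_abs_atBot_atTop.comp (tendsto_atBot_add_const_right _ _
        (tendsto_id.atTop_mul_const_of_neg h))
    · exact tendsto_abs_atTop_atTop.comp (tendsto_atTop_add_const_right _ _
        (tendsto_id.atTop_mul_const h))
  refine ((tendsto_pow_atTop two_ne_zero).comp h1).congr fun t => ?_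
  rw [Function.comp_apply, sq_abs, real_inner_smul_left, mul_div_assoc]

/-- The kernel of the gain operator with respect to the measure `M⁻¹ dv`. -/
noncomputable def symKernel (v v' : Vel) : ℝ := gainKernel P v v' * eqMaxwellian P v'

/-- The square root of the Gaussian factor of `M`, the weight in the Schur test. -/
noncomputable def rootGaussian (v : Vel) : ℝ := Real.exp (-(P.μ / 2) * ‖v - P.u₁‖ ^ 2)

/-- The constant of the symmetrised kernel. -/
noncomputable def Params.C : ℝ := 2 / P.ε ^ 2 / P.a ^ 2 * (P.N₁ * (Real.pi / P.c)) * P.N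

theorem Params.C_pos : 0 < P.C := by
  have := P.ε_pos
  have := P.a_pos
  have := P.N₁_pos
  have := P.c_pos
  have := P.N_pos
  unfold Params.C; positivity

theorem rootGaussian_pos (v : Vel) : 0 < rootGaussian P v := Real.exp_pos _

theorem rootGaussian_le_one (v : Vel) : rootGaussian P v ≤ 1 := by
  have := P.μ_pos
  refine Real.exp_le_one_iff.2 ?_
  have : 0 ≤ P.μ / 2 * ‖v - P.u₁‖ ^ 2 := by positivity
  linarith

theorem measurable_rootGaussian : Measurable (rootGaussian P) := by
  unfold rootGaussian; fun_prop

theorem eqMaxwellian_eq_rootGaussian (v : Vel) :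
    eqMaxwellian P v = P.N * rootGaussian P v ^ 2 := by
  rw [eqMaxwellian_eq, rootGaussian, ← Real.exp_nat_mul]
  congr 2
  push_cast
  ring

/-- Completing the square: the relation `μ = 2 c κ` between the temperatures splits the kernel into
a symmetric profile and the factors `√M` at the two velocities. -/
theorem symKernel_eq (v v' : Vel) : symKernel P v v' =
    P.C * profile P (v - P.u₁) (v - v') * (rootGaussian P v * rootGaussian P v') := by
  rcases eq_or_ne v v' with rfl | hne
  · simp [symKernel, gainKernel, profile]
  have hr : 0 < ‖v - v'‖ := norm_pos_iff.2 (sub_ne_zero.2 hne)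
  have ha := P.a_pos
  set x := v - P.u₁ with hx
  set y := v - v' with hy
  have hv' : v' - P.u₁ = x - y := by rw [hx, hy]; abel
  have hn : ‖x - y‖ ^ 2 = ‖x‖ ^ 2 - 2 * inner ℝ x y + ‖y‖ ^ 2 := norm_sub_sq_real x y
  have hexp : Real.exp (-P.c * (inner ℝ x y / ‖y‖ + (P.b - 1) / P.a * ‖y‖) ^ 2) *
      Real.exp (-P.μ * ‖x - y‖ ^ 2) =
      Real.exp (-P.c * ((inner ℝ x y / ‖y‖ - ‖y‖ / 2) ^ 2 + P.κ ^ 2 * ‖y‖ ^ 2)) *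
      (Real.exp (-(P.μ / 2) * ‖x‖ ^ 2) * Real.exp (-(P.μ / 2) * ‖x - y‖ ^ 2)) := by
    rw [← Real.exp_add, ← Real.exp_add, ← Real.exp_add, hn, P.μ_eq,
      show (P.b - 1) / P.a = P.κ - 1 / 2 by rw [Params.κ]; ring]
    congr 1
    field_simp
    ring
  rw [symKernel, gainKernel, eqMaxwellian_eq, profile, rootGaussian, rootGaussian, Params.C, hv',
    ← hx, ← hy]
  linear_combination (2 / P.ε ^ 2 / P.a ^ 2 * (P.N₁ * (Real.pi / P.c)) * P.N * ‖y‖⁻¹) * hexp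

/-- Detailed balance, in terms of the profile. -/
theorem profile_symm (v v' : Vel) :
    profile P (v - P.u₁) (v - v') = profile P (v' - P.u₁) (v' - v) := by
  rcases eq_or_ne v v' with rfl | hne
  · rfl
  have hr : 0 < ‖v - v'‖ := norm_pos_iff.2 (sub_ne_zero.2 hne)
  rw [profile, profile, norm_sub_rev v' v]
  have h1 : inner ℝ (v' - P.u₁) (v' - v) = ‖v - v'‖ ^ 2 - inner ℝ (v - P.u₁) (v - v') := by
    rw [← real_inner_self_eq_norm_sq, ← inner_sub_left, ← neg_sub v v', inner_neg_right,
      ← inner_neg_left]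
    congr 1
    abel
  rw [h1]
  congr 4
  field_simp
  ring

theorem symKernel_symm (v v' : Vel) : symKernel P v v' = symKernel P v' v := by
  rw [symKernel_eq, symKernel_eq, profile_symm]
  ring

theorem symKernel_nonneg (v v' : Vel) : 0 ≤ symKernel P v v' :=
  mul_nonneg (gainKernel_nonneg P v v') (eqMaxwellian_pos P v').le

theorem measurable_symKernel : Measurable (Function.uncurry (symKernel P)) :=
  (measurable_gainKernel P).mul ((measurable_eqMaxwellian P).comp measurable_snd)

theorem lintegral_weight {f : Vel → ℝ≥0∞} (hf : Measurable f) :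
    ∫⁻ v, f v ∂(weight P) = ∫⁻ v, ENNReal.ofReal (eqMaxwellian P v)⁻¹ * f v := by
  have hm : Measurable fun v => ENNReal.ofReal (eqMaxwellian P v)⁻¹ :=
    (measurable_eqMaxwellian P).inv.ennreal_ofReal
  exact lintegral_withDensity_eq_lintegral_mul _ hm hf

/-- Schur integrals of the symmetrised kernel, for the weight `√M` up to a constant. -/
theorem lintegral_symKernel_rootGaussian (v : Vel) :
    ∫⁻ v', ‖symKernel P v v'‖ₑ * ENNReal.ofReal (rootGaussian P v') ∂(weight P) =
      ENNReal.ofReal (P.C / P.N) * (∫⁻ y, ENNReal.ofReal (profile P (v - P.u₁) y)) *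
        ENNReal.ofReal (rootGaussian P v) := by
  have hC := P.C_pos
  have hN := P.N_pos
  have hm1 : Measurable fun v' => ‖symKernel P v v'‖ₑ * ENNReal.ofReal (rootGaussian P v') :=
    ((measurable_symKernel P).comp measurable_prodMk_left).enorm.mul
      (measurable_rootGaussian P).ennreal_ofReal
  have hm2 : Measurable fun y => ENNReal.ofReal (profile P (v - P.u₁) y) :=
    ((measurable_profile P).comp measurable_prodMk_left).ennreal_ofReal
  have hm3 : Measurable fun v' => ENNReal.ofReal (profile P (v - P.u₁) (v - v')) :=
    hm2.comp (measurable_const.sub measurable_id)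
  rw [lintegral_weight P hm1,
    ← lintegral_sub_left_eq_self (fun y => ENNReal.ofReal (profile P (v - P.u₁) y)) v,
    ← lintegral_const_mul _ hm3, ← lintegral_mul_const _ (hm3.const_mul _)]
  refine lintegral_congr fun v' => ?_
  have hv := rootGaussian_pos P v
  have hv' := rootGaussian_pos P v'
  have hM := eqMaxwellian_pos P v'
  have hp := profile_nonneg P (v - P.u₁) (v - v')
  have hid : (eqMaxwellian P v')⁻¹ * (symKernel P v v' * rootGaussian P v') =
      P.C / P.N * profile P (v - P.u₁) (v - v') * rootGaussian P v := by
    rw [symKernel_eq, eqMaxwellian_eq_rootGaussian]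
    field_simp
  rw [Real.enorm_of_nonneg (symKernel_nonneg P v v'), ← ENNReal.ofReal_mul' hv'.le,
    ← ENNReal.ofReal_mul' (mul_nonneg (symKernel_nonneg P v v') hv'.le),
    ← ENNReal.ofReal_mul' hp, ← ENNReal.ofReal_mul' hv.le, hid]

/-- The square integrals of the symmetrised kernel in the second variable are bounded uniformly in
the first, since `|y|⁻²` is locally integrable in `ℝ³`. -/
theorem lintegral_symKernel_sq_le (v : Vel) :
    ∫⁻ v', ‖symKernel P v v'‖ₑ ^ 2 ∂(weight P) ≤ ENNReal.ofReal (P.C ^ 2 / P.N) *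
      ∫⁻ y : Vel, ENNReal.ofReal (‖y‖⁻¹ ^ 2 * Real.exp (-(2 * P.c * P.κ ^ 2) * ‖y‖ ^ 2)) := by
  have hC := P.C_pos
  have hN := P.N_pos
  have hm1 : Measurable fun v' => ‖symKernel P v v'‖ₑ ^ 2 :=
    ((measurable_symKernel P).comp measurable_prodMk_left).enorm.pow_const 2
  rw [lintegral_weight P hm1, ← lintegral_sub_left_eq_self (fun y : Vel =>
    ENNReal.ofReal (‖y‖⁻¹ ^ 2 * Real.exp (-(2 * P.c * P.κ ^ 2) * ‖y‖ ^ 2))) v,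
    ← lintegral_const_mul _ (by fun_prop)]
  refine lintegral_mono fun v' => ?_
  have hv' := rootGaussian_pos P v'
  have hM := eqMaxwellian_pos P v'
  rw [Real.enorm_of_nonneg (symKernel_nonneg P v v'),
    ← ENNReal.ofReal_pow (symKernel_nonneg P v v'), ← ENNReal.ofReal_mul' (sq_nonneg _),
    ← ENNReal.ofReal_mul' (by positivity)]
  refine ENNReal.ofReal_le_ofReal ?_
  have h1 : Real.exp (-(2 * P.c * P.κ ^ 2) * ‖v - v'‖ ^ 2) =
      Real.exp (-(P.c * P.κ ^ 2) * ‖v - v'‖ ^ 2) ^ 2 := by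
    rw [← Real.exp_nat_mul]; congr 1; push_cast; ring
  rw [symKernel_eq, eqMaxwellian_eq_rootGaussian, h1, ← mul_pow]
  have h2 := profile_le P (v - P.u₁) (v - v')
  have h3 := profile_nonneg P (v - P.u₁) (v - v')
  have h4 := rootGaussian_le_one P v
  have h5 := rootGaussian_pos P v
  calc _ = P.C ^ 2 / P.N * (profile P (v - P.u₁) (v - v') * rootGaussian P v) ^ 2 := by
        field_simp
    _ ≤ P.C ^ 2 / P.N * ((‖v - v'‖⁻¹ * Real.exp (-(P.c * P.κ ^ 2) * ‖v - v'‖ ^ 2)) * 1) ^ 2 := by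
        gcongr
    _ = _ := by rw [mul_one]

/-- The constant of the Schur test. -/
noncomputable def schurConst : ℝ≥0 := (ENNReal.ofReal (P.C / P.N) * ∫⁻ y : Vel,
    ENNReal.ofReal (‖y‖⁻¹ * Real.exp (-(P.c * P.κ ^ 2) * ‖y‖ ^ 2))).toNNReal

theorem schurBound_symKernel : SchurBound (weight P) (symKernel P)
    (fun v => ENNReal.ofReal (rootGaussian P v)) (schurConst P) (schurConst P) := by
  have hleft : ∀ v, ∫⁻ v', ‖symKernel P v v'‖ₑ * ENNReal.ofReal (rootGaussian P v') ∂(weight P) ≤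
      schurConst P * ENNReal.ofReal (rootGaussian P v) := by
    intro v
    rw [lintegral_symKernel_rootGaussian, schurConst, ENNReal.coe_toNNReal
      (ENNReal.mul_lt_top ENNReal.ofReal_lt_top (lintegral_profile_lt_top P)).ne]
    gcongr with y
    exact profile_le P _ y
  refine ⟨measurable_symKernel P, symKernel_nonneg P, (measurable_rootGaussian P).ennreal_ofReal,
    fun v => by simp [rootGaussian_pos], fun v => ENNReal.ofReal_ne_top, hleft, fun v => ?_⟩
  simpa only [symKernel_symm P _ v] using hleft v

/-- Outside a large ball about `u₁` the Schur integrals are small, while over a ball the kernel is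
square integrable. -/
theorem exists_truncation (η : ℝ≥0) (hη : 0 < η) : ∃ S : Set Vel, MeasurableSet S ∧
    ∫⁻ v in S, ∫⁻ v', ‖symKernel P v v'‖ₑ ^ 2 ∂(weight P) ∂(weight P) ≠ ∞ ∧
    ∀ v ∉ S, ∫⁻ v', ‖symKernel P v v'‖ₑ * ENNReal.ofReal (rootGaussian P v') ∂(weight P) ≤
      η * ENNReal.ofReal (rootGaussian P v) := by
  obtain ⟨e, he⟩ := exists_norm_eq Vel (zero_le_one' ℝ)
  have hlim := ENNReal.Tendsto.const_mul (a := ENNReal.ofReal (P.C / P.N))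
    (tendsto_lintegral_profile P e he) (Or.inr ENNReal.ofReal_ne_top)
  rw [mul_zero] at hlim
  have hev := hlim.eventually (Iic_mem_nhds (by simpa using hη : (0 : ℝ≥0∞) < η))
  obtain ⟨R, hR⟩ := eventually_atTop.1 hev
  refine ⟨Metric.closedBall P.u₁ R, measurableSet_closedBall, ?_, fun v hv => ?_⟩
  · have hI : ∫⁻ y : Vel, ENNReal.ofReal (‖y‖⁻¹ ^ 2 *
        Real.exp (-(2 * P.c * P.κ ^ 2) * ‖y‖ ^ 2)) < ∞ := by
      have := P.c_pos
      have := P.κ_pos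
      exact lintegral_inv_norm_pow_mul_exp_lt_top le_rfl (by positivity)
    refine ne_top_of_le_ne_top ?_ (lintegral_mono fun v => lintegral_symKernel_sq_le P v)
    rw [lintegral_const, Measure.restrict_apply_univ]
    exact (ENNReal.mul_lt_top (ENNReal.mul_lt_top ENNReal.ofReal_lt_top hI)
      (isCompact_closedBall P.u₁ R).measure_lt_top).ne
  · rw [lintegral_symKernel_rootGaussian]
    gcongr
    rw [Metric.mem_closedBall, dist_eq_norm, not_le] at hv
    have h1 : ‖v - P.u₁‖ = ‖‖v - P.u₁‖ • e‖ := by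
      rw [norm_smul, he, mul_one, norm_norm]
    rw [lintegral_profile_congr P h1]
    exact hR _ hv.le

end SymmetricKernel

/-! ### The collision operator -/

section Collision

open scoped ENNReal NNReal ComplexInnerProductSpace

variable (P : Params)

/-- For fixed `v`, the pre-collisional velocity `v⋆`, distributed according to the density of the
gain term, has the distribution `symKernel P v` with respect to `M⁻¹ dv'`. -/
theorem map_vStar_gainDensity (v : Vel) :
    ((((volume : Measure Vel).prod surface).withDensity fun p =>
      ENNReal.ofReal (gainDensity P v p)).map fun p => vStar P v p.1 p.2) =
      (weight P).withDensity fun v' => ENNReal.ofReal (symKernel P v v') := by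
  have hg : Measurable fun p => ENNReal.ofReal (gainDensity P v p) :=
    (measurable_gainDensity P v).ennreal_ofReal
  have hk : Measurable fun v' => ENNReal.ofReal (symKernel P v v') :=
    ((measurable_symKernel P).comp measurable_prodMk_left).ennreal_ofReal
  refine Measure.ext_of_lintegral _ fun F hF => ?_
  have hFv : Measurable fun p : Vel × S2 => F (vStar P v p.1 p.2) :=
    hF.comp (measurable_vStar P v)
  rw [lintegral_map hF (measurable_vStar P v), lintegral_withDensity_eq_lintegral_mul _ hg hFv,
    lintegral_withDensity_eq_lintegral_mul _ hk hF]
  refine (lintegral_gainDensity P v hF).trans ?_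
  rw [lintegral_weight P (hk.mul hF)]
  refine lintegral_congr fun v' => ?_
  have hM := eqMaxwellian_pos P v'
  rw [Pi.mul_apply, ← mul_assoc, ← ENNReal.ofReal_mul (inv_pos.2 hM).le, symKernel]
  congr 2
  field_simp

theorem integrable_gain_iff {f : Vel → ℂ} (hf : StronglyMeasurable f) (v : Vel) :
    Integrable (fun p : Vel × S2 => (gainDensity P v p : ℂ) * f (vStar P v p.1 p.2))
      ((volume : Measure Vel).prod surface) ↔
    Integrable (fun v' => (symKernel P v v' : ℂ) * f v') (weight P) := by
  have hg : Measurable fun p => ENNReal.ofReal (gainDensity P v p) :=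
    (measurable_gainDensity P v).ennreal_ofReal
  have hk : Measurable fun v' => ENNReal.ofReal (symKernel P v v') :=
    ((measurable_symKernel P).comp measurable_prodMk_left).ennreal_ofReal
  have h1 := integrable_withDensity_iff_integrable_smul' (μ := weight P) hk
    (Eventually.of_forall fun v' => ENNReal.ofReal_lt_top) (g := f)
  have h2 := integrable_withDensity_iff_integrable_smul'
    (μ := (volume : Measure Vel).prod surface) hg
    (Eventually.of_forall fun v' => ENNReal.ofReal_lt_top) (g := fun p => f (vStar P v p.1 p.2))
  rw [← map_vStar_gainDensity, integrable_map_measure hf.aestronglyMeasurable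
    (measurable_vStar P v).aemeasurable] at h1
  simp only [ENNReal.toReal_ofReal (symKernel_nonneg P _ _), Complex.real_smul] at h1
  simp only [ENNReal.toReal_ofReal (gainDensity_nonneg P _ _), Complex.real_smul] at h2
  exact h2.symm.trans h1

theorem integral_gain {f : Vel → ℂ} (hf : StronglyMeasurable f) (v : Vel) :
    ∫ p : Vel × S2, (gainDensity P v p : ℂ) * f (vStar P v p.1 p.2)
      ∂((volume : Measure Vel).prod surface) =
    ∫ v', (symKernel P v v' : ℂ) * f v' ∂(weight P) := by
  have hg : Measurable fun p => ENNReal.ofReal (gainDensity P v p) :=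
    (measurable_gainDensity P v).ennreal_ofReal
  have hk : Measurable fun v' => ENNReal.ofReal (symKernel P v v') :=
    ((measurable_symKernel P).comp measurable_prodMk_left).ennreal_ofReal
  have h1 := integral_withDensity_eq_integral_toReal_smul (μ := weight P) hk
    (Eventually.of_forall fun v' => ENNReal.ofReal_lt_top) f
  have h2 := integral_withDensity_eq_integral_toReal_smul
    (μ := (volume : Measure Vel).prod surface) hg
    (Eventually.of_forall fun v' => ENNReal.ofReal_lt_top) (fun p => f (vStar P v p.1 p.2))
  rw [← map_vStar_gainDensity, integral_map (measurable_vStar P v).aemeasurable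
    hf.aestronglyMeasurable] at h1
  simp only [ENNReal.toReal_ofReal (symKernel_nonneg P _ _), Complex.real_smul] at h1
  simp only [ENNReal.toReal_ofReal (gainDensity_nonneg P _ _), Complex.real_smul] at h2
  exact h2.symm.trans h1

theorem collisionIntegrand_eq (f : Vel → ℂ) (v : Vel) (p : Vel × S2) :
    collisionIntegrand P f v p = (gainDensity P v p : ℂ) * f (vStar P v p.1 p.2) -
      ((|inner ℝ (v - p.1) (p.2 : Vel)| * hostMaxwellian P p.1 : ℝ) : ℂ) * f v := by
  rw [collisionIntegrand, gainDensity]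
  push_cast
  ring

/-- Almost everywhere the collision integral converges and splits into gain and loss. -/
theorem ae_collision (f : H P) : ∀ᵐ v ∂(weight P),
    Integrable (collisionIntegrand P f v) ((volume : Measure Vel).prod surface) ∧
    collisionOp P f v = (∫ v', (symKernel P v v' : ℂ) * f v' ∂(weight P)) - lossFun P f v := by
  filter_upwards [(schurBound_symKernel P).ae_integrable f] with v hv
  have hf := Lp.stronglyMeasurable f
  have h1 := (integrable_gain_iff P hf v).2 hv
  have h2 : Integrable (fun p : Vel × S2 =>
      ((|inner ℝ (v - p.1) (p.2 : Vel)| * hostMaxwellian P p.1 : ℝ) : ℂ) * f v)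
      ((volume : Measure Vel).prod surface) := (integrable_lossIntegrand P v).ofReal.mul_const _
  have h3 : collisionIntegrand P f v = fun p =>
      (gainDensity P v p : ℂ) * f (vStar P v p.1 p.2) -
      ((|inner ℝ (v - p.1) (p.2 : Vel)| * hostMaxwellian P p.1 : ℝ) : ℂ) * f v :=
    funext fun p => collisionIntegrand_eq P f v p
  refine ⟨h3 ▸ h1.sub h2, ?_⟩
  rw [collisionOp, h3, integral_sub h1 h2, integral_gain P hf, integral_mul_const,
    integral_complex_ofReal]
  rfl

variable {P} {K : H P →L[ℂ] H P}

theorem collisionOp_ae_eq (hK : IsIntegralOperator (symKernel P) K) (f : H P) :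
    collisionOp P f =ᵐ[weight P] fun v => K f v - lossFun P f v := by
  filter_upwards [ae_collision P f, hK f] with v h1 h2
  rw [h1.2, h2]

theorem mem_collisionDomain_iff (hK : IsIntegralOperator (symKernel P) K) {f : H P} :
    f ∈ collisionDomain P ↔ f ∈ lossDomain P := by
  refine ⟨fun h => h.1, fun h => ⟨h, (ae_collision P f).mono fun v hv => hv.1, ?_⟩⟩
  exact ((Lp.memLp (K f)).sub (mem_lossDomain P h)).ae_eq (collisionOp_ae_eq hK f).symm

/-- The operator `L` is the sum of `-L⁻` and the gain operator. -/
theorem isPerturbation_collisionOperator (hK : IsIntegralOperator (symKernel P) K) :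
    IsPerturbation (collisionOperator P) (-lossOperator P) K where
  domain_eq := Submodule.ext fun _ => mem_collisionDomain_iff hK
  apply_eq f h h₀ := by
    have h1 : collisionOperator P ⟨f, h⟩ =ᵐ[weight P] collisionOp P f :=
      MemLp.coeFn_toLp (mem_collisionDomain P h)
    have h2 := lossOperator_coeFn P ⟨f, h₀⟩
    rw [LinearPMap.neg_apply, neg_add_eq_sub]
    refine Lp.ext ?_
    filter_upwards [h1, h2, collisionOp_ae_eq hK f, Lp.coeFn_sub (K f) (lossOperator P ⟨f, h₀⟩)]
      with v h1 h2 h3 h4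
    rw [h1, h3, h4, Pi.sub_apply, h2]

theorem inner_lossOperator_symm (f g : (lossOperator P).domain) :
    ⟪lossOperator P f, (g : H P)⟫ = ⟪(f : H P), lossOperator P g⟫ := by
  rw [L2.inner_def, L2.inner_def]
  refine integral_congr_ae ?_
  filter_upwards [lossOperator_coeFn P f, lossOperator_coeFn P g] with v hf hg
  rw [hf, hg, lossFun, lossFun, ← smul_eq_mul, ← smul_eq_mul, inner_smul_left, inner_smul_right,
    Complex.conj_ofReal]

theorem collisionOperator_apply (hK : IsIntegralOperator (symKernel P) K)
    (f : (collisionOperator P).domain) :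
    collisionOperator P f = K f - lossOperator P ⟨f, f.2.1⟩ := by
  rw [(isPerturbation_collisionOperator hK).apply_eq f f.2 f.2.1, add_comm, LinearPMap.neg_apply,
    sub_eq_add_neg]

theorem isSymmetricOp_collisionOperator (hK : IsIntegralOperator (symKernel P) K) :
    IsSymmetricOp (collisionOperator P) := by
  intro f g
  have h1 := (schurBound_symKernel P).inner_symm hK (symKernel_symm P) f g
  have h2 := inner_lossOperator_symm (P := P) ⟨f, f.2.1⟩ ⟨g, g.2.1⟩
  rw [collisionOperator_apply hK f, collisionOperator_apply hK g]
  exact (inner_sub_left _ _ _).trans ((congrArg₂ _ h1 h2).trans (inner_sub_right _ _ _).symm)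

/-- The equilibrium identity in the form of a Schur integral. -/
theorem lintegral_symKernel_eqMaxwellian (v : Vel) :
    ∫⁻ v', ‖symKernel P v v'‖ₑ * ENNReal.ofReal (eqMaxwellian P v') ∂(weight P) =
      ENNReal.ofReal (collisionFreq P v) * ENNReal.ofReal (eqMaxwellian P v) := by
  have hm : Measurable fun v' => ‖symKernel P v v'‖ₑ * ENNReal.ofReal (eqMaxwellian P v') :=
    ((measurable_symKernel P).comp measurable_prodMk_left).enorm.mul
      (measurable_eqMaxwellian P).ennreal_ofReal
  rw [lintegral_weight P hm, ← lintegral_gainKernel_eqMaxwellian]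
  refine lintegral_congr fun v' => ?_
  have hM := eqMaxwellian_pos P v'
  rw [Real.enorm_of_nonneg (symKernel_nonneg P v v'), ← mul_assoc,
    ← ENNReal.ofReal_mul (inv_pos.2 hM).le, symKernel]
  congr 2
  field_simp

/-- The quadratic form of the gain operator is dominated by that of the loss operator: the Schur
test with the weight `M`, for which the Schur integrals are exactly `σ M`. -/
theorem norm_inner_gain_le (hK : IsIntegralOperator (symKernel P) K)
    (f : (lossOperator P).domain) :
    ‖⟪(f : H P), K f⟫‖ ≤ (⟪lossOperator P f, (f : H P)⟫).re := by
  have hf := (Lp.stronglyMeasurable (f : H P)).measurable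
  have hM : ∀ v, 0 < eqMaxwellian P v := eqMaxwellian_pos P
  have h1 := hK.enorm_inner_le (measurable_symKernel P) (f : H P) (f : H P)
  have h2 := schur_form (μ := weight P) (k := fun v v' => ‖symKernel P v v'‖ₑ)
    (p := fun v => ENNReal.ofReal (eqMaxwellian P v)) (measurable_symKernel P).enorm
    (measurable_eqMaxwellian P).ennreal_ofReal (fun v => by simp [hM v])
    (fun v => ENNReal.ofReal_ne_top) (A := fun v => ENNReal.ofReal (collisionFreq P v))
    (B := fun v => ENNReal.ofReal (collisionFreq P v))
    (fun v => (lintegral_symKernel_eqMaxwellian v).le)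
    (fun v => by simpa only [symKernel_symm P _ v] using (lintegral_symKernel_eqMaxwellian v).le)
    hf.enorm hf.enorm
  rw [← sq, ENNReal.pow_le_pow_left_iff two_ne_zero] at h2
  have h3 : ∀ᵐ v ∂(weight P), ⟪lossOperator P f v, (f : H P) v⟫ =
      ((collisionFreq P v * ‖(f : H P) v‖ ^ 2 : ℝ) : ℂ) := by
    filter_upwards [lossOperator_coeFn P f] with v hv
    rw [hv, lossFun, ← smul_eq_mul, inner_smul_left, Complex.conj_ofReal,
      inner_self_eq_norm_sq_to_K]
    push_cast
    rfl
  have h4 : Integrable (fun v => collisionFreq P v * ‖(f : H P) v‖ ^ 2) (weight P) := by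
    exact ((L2.integrable_inner (lossOperator P f) (f : H P)).congr h3).re
  rw [L2.inner_def (lossOperator P f), integral_congr_ae h3, integral_complex_ofReal,
    Complex.ofReal_re, ← ENNReal.ofReal_le_ofReal_iff (integral_nonneg fun v =>
      mul_nonneg (collisionFreq_nonneg P v) (sq_nonneg _)), ofReal_norm,
    ofReal_integral_eq_lintegral_ofReal h4 (Eventually.of_forall fun v =>
      mul_nonneg (collisionFreq_nonneg P v) (sq_nonneg _))]
  refine (h1.trans h2).trans (lintegral_mono fun v => ?_)
  rw [ENNReal.ofReal_mul (collisionFreq_nonneg P v), ENNReal.ofReal_pow (norm_nonneg _),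
    ofReal_norm]

theorem re_inner_collisionOperator_nonpos (hK : IsIntegralOperator (symKernel P) K)
    (f : (collisionOperator P).domain) :
    (⟪collisionOperator P f, (f : H P)⟫).re ≤ 0 := by
  have h := norm_inner_gain_le hK ⟨f, f.2.1⟩
  rw [collisionOperator_apply hK, inner_sub_left, Complex.sub_re, sub_nonpos]
  refine le_trans ?_ h
  rw [norm_inner_symm]
  exact Complex.re_le_norm _

/-- Functions of at most linear growth times `M`, such as `M` and `σ M`, lie in `H`. -/
theorem memLp_mul_eqMaxwellian {h : Vel → ℝ} (hm : Measurable h) {C : ℝ}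
    (hC : ∀ v, |h v| ≤ C * (1 + ‖v‖)) :
    MemLp (fun v => ((h v * eqMaxwellian P v : ℝ) : ℂ)) 2 (weight P) := by
  have hmeas : Measurable fun v => h v * eqMaxwellian P v := hm.mul (measurable_eqMaxwellian P)
  have hmeas' : Measurable fun v => ((h v * eqMaxwellian P v : ℝ) : ℂ) :=
    Complex.measurable_ofReal.comp hmeas
  rw [memLp_two_iff_lintegral hmeas'.aestronglyMeasurable,
    lintegral_weight P (hmeas'.enorm.pow_const 2)]
  have hint := (integrable_sq_mul_maxwellian P.m_pos P.ϑeq_pos P.u₁).const_mul (C ^ 2)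
  refine lt_of_le_of_lt (lintegral_mono fun v => ?_) hint.lintegral_lt_top
  have hM := eqMaxwellian_pos P v
  rw [enorm_ofReal_complex, ← ofReal_norm, ← ENNReal.ofReal_pow (norm_nonneg _),
    ← ENNReal.ofReal_mul (inv_pos.2 hM).le]
  refine ENNReal.ofReal_le_ofReal ?_
  have h1 : |h v| ^ 2 ≤ (C * (1 + ‖v‖)) ^ 2 := by gcongr; exact hC v
  calc (eqMaxwellian P v)⁻¹ * ‖h v * eqMaxwellian P v‖ ^ 2 = |h v| ^ 2 * eqMaxwellian P v := by
        rw [norm_mul, Real.norm_eq_abs, Real.norm_of_nonneg hM.le]; field_simp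
    _ ≤ (C * (1 + ‖v‖)) ^ 2 * eqMaxwellian P v := by gcongr
    _ = C ^ 2 * ((1 + ‖v‖) ^ 2 * maxwellian P.m P.ϑeq P.u₁ v) := by rw [eqMaxwellian]; ring

/-- The Maxwellian `M` is an eigenfunction of `L` for the eigenvalue `0`. -/
theorem isEigenvalue_zero (hK : IsIntegralOperator (symKernel P) K) :
    IsEigenvalue (collisionOperator P) 0 := by
  obtain ⟨C, hC, hlip⟩ := exists_collisionFreq_lipschitz P
  have hσ : ∀ v, |collisionFreq P v| ≤ (|collisionFreq P 0| + C) * (1 + ‖v‖) := fun v => by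
    have h1 := hlip v 0
    have h2 := abs_add_le (collisionFreq P v - collisionFreq P 0) (collisionFreq P 0)
    rw [sub_add_cancel] at h2
    rw [sub_zero] at h1
    nlinarith [norm_nonneg v, abs_nonneg (collisionFreq P 0),
      mul_nonneg (abs_nonneg (collisionFreq P 0)) (norm_nonneg v)]
  have hM1 : MemLp (fun v => ((1 * eqMaxwellian P v : ℝ) : ℂ)) 2 (weight P) :=
    memLp_mul_eqMaxwellian measurable_const (C := 1) fun v => by
      rw [abs_one, one_mul]; linarith [norm_nonneg v]
  simp only [one_mul] at hM1
  have hM2 := memLp_mul_eqMaxwellian (P := P) (continuous_collisionFreq P).measurable hσ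
  have hcoe := hM1.coeFn_toLp
  have hdom : hM1.toLp _ ∈ lossDomain P := by
    refine MemLp.ae_eq ?_ hM2
    filter_upwards [hcoe] with v hv
    rw [lossFun, hv]
    push_cast
    rfl
  refine ⟨⟨hM1.toLp _, (mem_collisionDomain_iff hK).2 hdom⟩, fun h => ?_, ?_⟩
  · have h0 : hM1.toLp _ = 0 := congrArg Subtype.val h
    have h1 : ∀ᵐ v ∂(weight P), False := by
      filter_upwards [hcoe, Lp.coeFn_zero ℂ 2 (weight P)] with v h1 h2
      rw [h0, h2, Pi.zero_apply, eq_comm, Complex.ofReal_eq_zero] at h1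
      exact (eqMaxwellian_pos P v).ne' h1
    have h2 := (ac_weight P).ae_le h1
    simp at h2
  · rw [zero_smul, collisionOperator_apply hK, sub_eq_zero]
    refine Lp.ext ?_
    filter_upwards [hK (hM1.toLp _), lossOperator_coeFn P ⟨hM1.toLp _, hdom⟩, hcoe]
      with v h1 h2 h3
    rw [h1, h2, lossFun, h3, ← Complex.ofReal_mul]
    have h4 : (∫ v', (symKernel P v v' : ℂ) * hM1.toLp _ v' ∂(weight P)) =
        ((∫ v', symKernel P v v' * eqMaxwellian P v' ∂(weight P) : ℝ) : ℂ) := by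
      rw [← integral_complex_ofReal]
      refine integral_congr_ae ?_
      filter_upwards [hcoe] with v' hv'
      rw [hv', Complex.ofReal_mul]
    have h5 : Measurable fun v' => symKernel P v v' * eqMaxwellian P v' :=
      ((measurable_symKernel P).comp measurable_prodMk_left).mul (measurable_eqMaxwellian P)
    have h6 : ∀ v', 0 ≤ symKernel P v v' * eqMaxwellian P v' := fun v' =>
      mul_nonneg (symKernel_nonneg P v v') (eqMaxwellian_pos P v').le
    have h7 : (∫⁻ v', ENNReal.ofReal (symKernel P v v' * eqMaxwellian P v') ∂(weight P)) =
        ENNReal.ofReal (collisionFreq P v * eqMaxwellian P v) := by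
      rw [ENNReal.ofReal_mul (collisionFreq_nonneg P v), ← lintegral_symKernel_eqMaxwellian]
      refine lintegral_congr fun v' => ?_
      rw [ENNReal.ofReal_mul (symKernel_nonneg P v v'),
        Real.enorm_of_nonneg (symKernel_nonneg P v v')]
    rw [h4, integral_eq_lintegral_of_nonneg_ae (Eventually.of_forall h6) h5.aestronglyMeasurable,
      h7, ENNReal.toReal_ofReal (mul_nonneg (collisionFreq_nonneg P v) (eqMaxwellian_pos P v).le)]

end Collision

end Granular

theorem theorem3p6 (P : Granular.Params) :
    -- the domain of `L` consists of all `f ∈ H` with `σ f ∈ H`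
    (∀ f : Granular.H P, f ∈ (Granular.collisionOperator P).domain ↔
      MemLp (fun v => (Granular.collisionFreq P v : ℂ) * f v) 2 (Granular.weight P)) ∧
    0 < Granular.nuZero P ∧
    -- the spectrum of `-L⁻`
    Granular.opSpectrum (-Granular.lossOperator P) =
      Complex.ofReal '' Set.Iic (-Granular.nuZero P) ∧
    -- the spectrum of `L`
    (∃ (I : Set ℕ) (lam : ℕ → ℝ),
      IsLowerSet I ∧ 0 ∈ I ∧ lam 0 = 0 ∧ StrictAntiOn lam I ∧
      (∀ n ∈ I, -Granular.nuZero P < lam n ∧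
        Granular.IsEigenvalue (Granular.collisionOperator P) (lam n) ∧
        FiniteDimensional ℂ
          (Granular.algEigenspace (Granular.collisionOperator P) (lam n))) ∧
      (∀ x : ℝ, AccPt x (𝓟 (lam '' I)) → x = -Granular.nuZero P) ∧
      Granular.opSpectrum (Granular.collisionOperator P) =
        Complex.ofReal '' (Set.Iic (-Granular.nuZero P) ∪ lam '' I)) ∧
    -- the spectral gap
    ∃ δ : ℝ, 0 < δ ∧
      ∀ z ∈ Granular.opSpectrum (Granular.collisionOperator P), z ≠ 0 → z.re ≤ -δ := by
  open Granular in
  obtain ⟨K, -, hK⟩ := (schurBound_symKernel P).exists_operator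
  have hcompact := (schurBound_symKernel P).isCompactOperator hK (exists_truncation P)
  exact ⟨fun f => mem_collisionDomain_iff hK, nuZero_pos P, opSpectrum_neg_loss P,
    (isPerturbation_collisionOperator hK).spectrum_structure hcompact
      (isSymmetricOp_collisionOperator hK) (re_inner_collisionOperator_nonpos hK) (nuZero_pos P)
      (le_norm_smul_sub_neg_loss P) (opSpectrum_neg_loss P)
      (fun _ hx => hasWeylSequence_neg_loss P hx) (isEigenvalue_zero hK)⟩
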